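/- Let $\mathbb D$ be the open unit disc of $\mathbb C$, $H(\mathbb D)$ the space of analytic functions on $\mathbb D$, and $dA=\frac{dx\,dy}{\pi}$. A *radial weight* is the extension $\mu(z)=\mu(|z|)$, $z\in\mathbb D$, of a non-negative function $\mu\in L^1([0,1))$ with $\widehat\mu(r)=\int_r^1\mu(s)\,ds>0$ for all $r\in(0,1)$; write $\widehat\mu(z)=\widehat\mu(|z|)$ and $\mu_x=\int_0^1 s^x\mu(s)\,ds$. We say $\mu\in\mathcal D$ if there are $C>0$, $K>1$ and $C'>1$ such that $$\widehat\mu(r)\le C\,\widehat\mu\left(\tfrac{1+r}2\right)\quad\text{and}\quad \widehat\mu(r)\ge C'\,\widehat\mu\left(1-\tfrac{1-r}K\right),\qquad 0\le r<1.$$ For $g(z)=\sum_{n\ge0}\widehat g(n)z^n\in H(\mathbb D)$ put $D^\mu(g)(z)=\sum_{n\ge0}\frac{\widehat g(n)}{\mu_{2n+1}}z^n$. Let $S(0)=\mathbb D$ and, for $a\in\mathbb D\setminus\{0\}$, $S(a)=\{z\in\mathbb D: |z|\ge|a|,\ |\arg z-\arg a|\le\frac{1-|a|}2\}$, the difference of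 arguments being taken modulo $2\pi$ in $(-\pi,\pi]$. A positive Borel measure $\nu$ on $\mathbb D$ is a *vanishing Carleson measure* if $\sup_{a\in\mathbb D}\frac{\nu(S(a))}{1-|a|}<\infty$ and $\lim_{|a|\to1^-}\frac{\nu(S(a))}{1-|a|}=0$. For $g\in H(\mathbb D)$ define, with values in $[0,\infty]$, $$\|g\|_{\mathrm{BMOA}}^2=|g(0)|^2+\sup_{a\in\mathbb D}\frac{\int_{S(a)}|g'(z)|^2(1-|z|^2)\,dA(z)}{1-|a|},\qquad \|g\|_{\mathrm{BMOA}_\mu}^2=\sup_{a\in\mathbb D}\frac{\int_{S(a)}|D^\mu(g)(z)|^2\frac{\widehat\mu(z)^2}{1-|z|}\,dA(z)}{1-|a|},$$ and let $\mathrm{VMOA}$ (respectively $\mathrm{VMOA}_\mu$) be the set of $g\in H(\mathbb D)$ for which $|g'(z)|^2(1-|z|^2)\,dA(z)$ (respectively $|D^\mu(g)(z)|^2\frac{\widehat\mu(z)^2}{1-|z|}\,dA(z)$) is a vanishing Carleson measure. Below, $A(g)\lesssim B(g)$ means that $A(g)\le C\,B(g)$ with a constant $0<C<\infty$ that does not depend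 on $g$ (it may depend on $\mu$), and $A(g)\asymp B(g)$ means that $A(g)\lesssim B(g)$ and $B(g)\lesssim A(g)$. **Theorem.** Let $\mu$ be a radial weight. Then the following conditions are equivalent: 1. $\mu\in\mathcal D$; 2. $\|g\|_{\mathrm{BMOA}_\mu}\asymp\|g\|_{\mathrm{BMOA}}$ for $g\in H(\mathbb D)$; 3. $\|g\|_{\mathrm{BMOA}_\mu}\lesssim\|g\|_{\mathrm{BMOA}}$ for $g\in H(\mathbb D)$; 4. $\mathrm{VMOA}_\mu=\mathrm{VMOA}$, and $\|g\|_{\mathrm{BMOA}_\mu}\asymp\|g\|_{\mathrm{BMOA}}$ for $g\in\mathrm{VMOA}$; 5. $\mathrm{VMOA}\subset\mathrm{VMOA}_\mu$, and $\|g\|_{\mathrm{BMOA}_\mu}\lesssim\|g\|_{\mathrm{BMOA}}$ for $g\in\mathrm{VMOA}$; 6. $\mathrm{VMOA}_\mu\subset\mathrm{VMOA}$, and $\|g\|_{\mathrm{BMOA}_\mu}\lesssim\|g\|_{\mathrm{BMOA}}$ for $g\in\mathrm{VMOA}$. Moreover, for every radial weight $\mu$, $\|g\|_{\mathrm{BMOA}}\lesssim\|g\|_{\mathrm{BMOA}_\mu}$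 for $g\in H(\mathbb D)$, and $\mathrm{VMOA}_\mu\subset\mathrm{VMOA}$. -/

import Mathlib

open Set Filter Topology MeasureTheory
open scoped ENNReal NNReal

noncomputable section

/-- The tail integral `μ̂(r) = ∫_r^1 μ(s) ds`. -/
def weightTail (μ : ℝ → ℝ) (r : ℝ) : ℝ := ∫ s in Ico r 1, μ s

/-- The moments `μ_k = ∫_0^1 s^k μ(s) ds`. -/
def weightMoment (μ : ℝ → ℝ) (k : ℕ) : ℝ := ∫ s in Ico (0 : ℝ) 1, s ^ k * μ s

/-- `μ` is the radial profile of a radial weight on the unit disc (only its values on `[0, 1)`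
matter): non-negative, integrable on `[0, 1)`, with positive tail integrals. -/
structure IsRadialWeight (μ : ℝ → ℝ) : Prop where
  nonneg : ∀ r ∈ Ico (0 : ℝ) 1, 0 ≤ μ r
  integrable : IntegrableOn μ (Ico (0 : ℝ) 1)
  tail_pos : ∀ r ∈ Ioo (0 : ℝ) 1, 0 < weightTail μ r

/-- The upper doubling condition (class `D̂`). -/
def IsUpperDoubling (μ : ℝ → ℝ) : Prop :=
  ∃ C : ℝ, 0 < C ∧ ∀ r ∈ Ico (0 : ℝ) 1, weightTail μ r ≤ C * weightTail μ ((1 + r) / 2)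

/-- The lower doubling condition (class `Ď`). -/
def IsLowerDoubling (μ : ℝ → ℝ) : Prop :=
  ∃ K C : ℝ, 1 < K ∧ 1 < C ∧
    ∀ r ∈ Ico (0 : ℝ) 1, C * weightTail μ (1 - (1 - r) / K) ≤ weightTail μ r

/-- The radial doubling weights, `𝒟 = D̂ ∩ Ď`. -/
def IsRadialDoubling (μ : ℝ → ℝ) : Prop := IsUpperDoubling μ ∧ IsLowerDoubling μ

/-- The open unit disc. -/
def unitDisc : Set ℂ := Metric.ball 0 1

/-- `f ∈ H(𝔻)`: `f` is analytic in the unit disc. Its values elsewhere play no role. -/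
def IsAnalyticOnDisc (f : ℂ → ℂ) : Prop := DifferentiableOn ℂ f unitDisc

/-- The `n`-th Taylor coefficient of `f` at the origin. -/
def taylorCoeff (f : ℂ → ℂ) (n : ℕ) : ℂ := iteratedDeriv n f 0 / (n.factorial : ℂ)

/-- The fractional derivative `D^μ(f)(z) = ∑ f̂(n) / μ_{2n+1} z^n`. -/
def fracDeriv (μ : ℝ → ℝ) (f : ℂ → ℂ) (z : ℂ) : ℂ :=
  ∑' n : ℕ, taylorCoeff f n / (weightMoment μ (2 * n + 1) : ℂ) * z ^ n

/-- The normalized area measure `dA = dx dy / π` on the unit disc. -/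
def discArea : Measure ℂ := (ENNReal.ofReal Real.pi)⁻¹ • volume.restrict unitDisc

/-- The Carleson square `S(a)`, with `S(0) = 𝔻`. For `a ≠ 0` every `z` in it is non-zero, and
`|arg (z / a)|` is the distance of `arg z` and `arg a` modulo `2π`. -/
def carlesonSquare (a : ℂ) : Set ℂ :=
  {z | z ∈ unitDisc ∧ (a ≠ 0 → |(z / a).arg| ≤ (1 - ‖a‖) / 2 ∧ 1 - ‖z‖ ≤ 1 - ‖a‖)}

/-- The quotient `ν(S(a)) / (1 - |a|)`. -/
def carlesonQuotient (ν : Measure ℂ) (a : ℂ) : ℝ≥0∞ :=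
  ν (carlesonSquare a) / ENNReal.ofReal (1 - ‖a‖)

/-- `sup_{a ∈ 𝔻} ν(S(a)) / (1 - |a|)`, with values in `[0, ∞]`. -/
def carlesonSup (ν : Measure ℂ) : ℝ≥0∞ := ⨆ a ∈ unitDisc, carlesonQuotient ν a

/-- Classical Carleson measures. -/
def IsCarleson (ν : Measure ℂ) : Prop := carlesonSup ν < ∞

/-- Vanishing Carleson measures: the Carleson quotients tend to `0` as `|a| → 1⁻`. -/
def IsVanishingCarleson (ν : Measure ℂ) : Prop :=
  IsCarleson ν ∧
    Tendsto (carlesonQuotient ν) (comap (fun a : ℂ => ‖a‖) (𝓝[<] (1 : ℝ))) (𝓝 0)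

/-- The measure `|f'(z)|² (1 - |z|²) dA(z)`. -/
def bmoaMeasure (f : ℂ → ℂ) : Measure ℂ :=
  discArea.withDensity fun z => ‖deriv f z‖ₑ ^ 2 * ENNReal.ofReal (1 - ‖z‖ ^ 2)

/-- The measure `|D^μ(f)(z)|² μ̂(z)² / (1 - |z|) dA(z)`. -/
def bmoaWeightMeasure (μ : ℝ → ℝ) (f : ℂ → ℂ) : Measure ℂ :=
  discArea.withDensity fun z =>
    ‖fracDeriv μ f z‖ₑ ^ 2 * ENNReal.ofReal (weightTail μ ‖z‖ ^ 2 / (1 - ‖z‖))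

/-- `‖f‖_BMOA`, with values in `[0, ∞]`. -/
def bmoaNorm (f : ℂ → ℂ) : ℝ≥0∞ :=
  (‖f 0‖ₑ ^ 2 + carlesonSup (bmoaMeasure f)) ^ (1 / 2 : ℝ)

/-- `‖f‖_{BMOA_μ}`, with values in `[0, ∞]`. -/
def bmoaWeightNorm (μ : ℝ → ℝ) (f : ℂ → ℂ) : ℝ≥0∞ :=
  carlesonSup (bmoaWeightMeasure μ f) ^ (1 / 2 : ℝ)

/-- The space `VMOA`. -/
def VMOA : Set (ℂ → ℂ) := {f | IsAnalyticOnDisc f ∧ IsVanishingCarleson (bmoaMeasure f)}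

/-- The space `VMOA_μ`. -/
def weightVMOA (μ : ℝ → ℝ) : Set (ℂ → ℂ) :=
  {f | IsAnalyticOnDisc f ∧ IsVanishingCarleson (bmoaWeightMeasure μ f)}

/-- `A(g) ≲ B(g)` for `g ∈ X`: a finite constant independent of `g` works. -/
def DominatedOn (X : Set (ℂ → ℂ)) (A B : (ℂ → ℂ) → ℝ≥0∞) : Prop :=
  ∃ C : ℝ≥0, 0 < C ∧ ∀ g ∈ X, A g ≤ C * B g

/-- `A(g) ≍ B(g)` for `g ∈ X`. -/
def ComparableOn (X : Set (ℂ → ℂ)) (A B : (ℂ → ℂ) → ℝ≥0∞) : Prop :=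
  DominatedOn X A B ∧ DominatedOn X B A

end

/-! ### Polar coordinates in the unit disc -/

theorem mem_unitDisc {z : ℂ} : z ∈ unitDisc ↔ ‖z‖ < 1 := by simp [unitDisc]

theorem measurableSet_unitDisc : MeasurableSet unitDisc := Metric.isOpen_ball.measurableSet

theorem ae_discArea_mem_unitDisc : ∀ᵐ z ∂discArea, z ∈ unitDisc :=
  Measure.ae_smul_measure (ae_restrict_mem measurableSet_unitDisc) _

theorem polarCoord_symm_eq_circleMap (ρ θ : ℝ) :
    Complex.polarCoord.symm (ρ, θ) = circleMap 0 ρ θ := by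
  simp [circleMap, Complex.exp_mul_I]

theorem norm_circleMap_of_mem {ρ : ℝ} (hρ : ρ ∈ Ioo (0 : ℝ) 1) (θ : ℝ) :
    ‖circleMap 0 ρ θ‖ = ρ := by
  simp [abs_of_pos hρ.1]

theorem measurable_circleMap_uncurry :
    Measurable fun p : ℝ × ℝ => circleMap 0 p.1 p.2 := by
  unfold circleMap
  fun_prop

/-- Integration over the disc in polar coordinates, for functions with values in `[0, ∞]`. -/
theorem lintegral_discArea_polar {u : ℂ → ℝ≥0∞} (hu : Measurable u) :
    ∫⁻ z, u z ∂discArea = ∫⁻ ρ in Ioo (0 : ℝ) 1,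
      ENNReal.ofReal (ρ / Real.pi) * ∫⁻ θ in Ioo (-Real.pi) Real.pi, u (circleMap 0 ρ θ) := by
  have hm : Measurable (unitDisc.indicator u) := hu.indicator measurableSet_unitDisc
  rw [discArea, lintegral_smul_measure, ← lintegral_indicator measurableSet_unitDisc,
    ← Complex.lintegral_comp_polarCoord_symm, polarCoord_target,
    Measure.volume_eq_prod, ← Measure.prod_restrict, lintegral_prod]
  · simp only [polarCoord_symm_eq_circleMap, smul_eq_mul]
    have h1 : ∀ ρ ∈ Ioi (0 : ℝ),
        (∫⁻ θ in Ioo (-Real.pi) Real.pi,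
          ENNReal.ofReal ρ * unitDisc.indicator u (circleMap 0 ρ θ)) =
        (Iio (1 : ℝ)).indicator (fun ρ => ENNReal.ofReal ρ *
          ∫⁻ θ in Ioo (-Real.pi) Real.pi, u (circleMap 0 ρ θ)) ρ := by
      intro ρ hρ
      have hρ : 0 < ρ := hρ
      by_cases h : ρ < 1
      · rw [indicator_of_mem (by exact h), ← lintegral_const_mul']
        · refine lintegral_congr fun θ => ?_
          rw [indicator_of_mem]
          simpa [mem_unitDisc, abs_of_pos hρ] using h
        · simp
      · rw [indicator_of_notMem (by exact h)]
        have : ∀ θ, unitDisc.indicator u (circleMap 0 ρ θ) = 0 := fun θ =>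
          indicator_of_notMem (by simpa [mem_unitDisc, abs_of_pos hρ] using h) _
        simp [this]
    rw [setLIntegral_congr_fun measurableSet_Ioi h1, lintegral_indicator measurableSet_Iio,
      Measure.restrict_restrict measurableSet_Iio, inter_comm, Ioi_inter_Iio,
      ← lintegral_const_mul']
    · refine lintegral_congr fun ρ => ?_
      rw [← mul_assoc, div_eq_inv_mul, ENNReal.ofReal_mul (by positivity),
        ENNReal.ofReal_inv_of_pos Real.pi_pos]
    · simp [Real.pi_pos]
  · refine Measurable.aemeasurable ?_
    simp only [smul_eq_mul]
    refine (by fun_prop : Measurable fun p : ℝ × ℝ => ENNReal.ofReal p.1).mul (hm.comp ?_)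
    rw [show (Complex.polarCoord.symm : ℝ × ℝ → ℂ) = fun p => circleMap 0 p.1 p.2 from
      funext fun p => polarCoord_symm_eq_circleMap p.1 p.2]
    exact measurable_circleMap_uncurry

/-- Integration over the disc in polar coordinates. -/
theorem integral_discArea_polar {u : ℂ → ℂ} (hc : ContinuousOn u (unitDisc \ {0}))
    (hu : Integrable u discArea) :
    ∫ z, u z ∂discArea = ∫ ρ in Ioo (0 : ℝ) 1,
      ((ρ / Real.pi : ℝ) : ℂ) * ∫ θ in Ioo (-Real.pi) Real.pi, u (circleMap 0 ρ θ) := by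
  have hD : MeasurableSet (unitDisc \ {0}) := measurableSet_unitDisc.diff (measurableSet_singleton 0)
  set v := (unitDisc \ {0}).indicator u with hv
  have hvm : StronglyMeasurable v := by
    refine (stronglyMeasurable_iff_measurable).2 ?_
    classical
    rw [hv, ← piecewise_eq_indicator]
    exact hc.measurable_piecewise continuousOn_const hD
  have huv : u =ᵐ[discArea] v := by
    have h0 : ∀ᵐ z ∂discArea, z ≠ 0 := by
      refine Measure.ae_smul_measure (ae_restrict_of_ae ?_) _
      exact Measure.ae_ne volume 0
    filter_upwards [ae_discArea_mem_unitDisc, h0] with z hz hz0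
    rw [hv, indicator_of_mem (show z ∈ unitDisc \ {0} from ⟨hz, hz0⟩)]
  have hvi : Integrable v volume := by
    have h1 : Integrable v discArea := hu.congr huv
    rw [discArea, integrable_smul_measure (by simp) (by simp [Real.pi_pos])] at h1
    rw [hv, integrable_indicator_iff hD, ← integrableOn_congr_set_ae (s := unitDisc)]
    · refine h1.congr ?_
      have h0 : ∀ᵐ z ∂(volume.restrict unitDisc), z ≠ 0 :=
        ae_restrict_of_ae (Measure.ae_ne volume 0)
      filter_upwards [ae_restrict_mem measurableSet_unitDisc, h0] with z hz hz0
      rw [hv, indicator_of_mem (show z ∈ unitDisc \ {0} from ⟨hz, hz0⟩)]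
    · exact (sdiff_null_ae_eq_self (by simp)).symm
  have hpi : Integrable (fun p : ℝ × ℝ => p.1 • v (circleMap 0 p.1 p.2))
      ((volume.restrict (Ioi 0)).prod (volume.restrict (Ioo (-Real.pi) Real.pi))) := by
    refine ⟨?_, ?_⟩
    · refine StronglyMeasurable.aestronglyMeasurable ?_
      exact (by fun_prop : StronglyMeasurable fun p : ℝ × ℝ => p.1).smul
        (hvm.comp_measurable measurable_circleMap_uncurry)
    · have h2 := hvi.2
      rw [HasFiniteIntegral, ← Complex.lintegral_comp_polarCoord_symm] at h2
      rw [HasFiniteIntegral, Measure.prod_restrict, ← Measure.volume_eq_prod]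
      refine lt_of_eq_of_lt ?_ h2
      rw [polarCoord_target]
      refine setLIntegral_congr_fun (measurableSet_Ioi.prod measurableSet_Ioo) fun p hp => ?_
      have hp1 : 0 < p.1 := hp.1
      simp only [enorm_smul, smul_eq_mul]
      rw [← polarCoord_symm_eq_circleMap, Real.enorm_of_nonneg hp1.le]
  have hinteg : ∫ z, u z ∂discArea = (Real.pi)⁻¹ • ∫ z, v z := by
    rw [integral_congr_ae huv, discArea, integral_smul_measure,
      setIntegral_eq_integral_of_forall_compl_eq_zero]
    · simp [Real.pi_pos.le]
    · intro z hz
      rw [hv, indicator_of_notMem]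
      exact fun h => hz h.1
  rw [hinteg, ← Complex.integral_comp_polarCoord_symm, polarCoord_target,
    Measure.volume_eq_prod, ← Measure.prod_restrict]
  rw [show (fun p : ℝ × ℝ => p.1 • v (Complex.polarCoord.symm p)) =
    fun p : ℝ × ℝ => p.1 • v (circleMap 0 p.1 p.2) from
      funext fun p => by rw [← polarCoord_symm_eq_circleMap]]
  rw [integral_prod _ hpi]
  have h1 : ∀ ρ ∈ Ioi (0 : ℝ),
      (∫ θ in Ioo (-Real.pi) Real.pi, ρ • v (circleMap 0 ρ θ)) =
      (Iio (1 : ℝ)).indicator (fun ρ => ρ •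
        ∫ θ in Ioo (-Real.pi) Real.pi, u (circleMap 0 ρ θ)) ρ := by
    intro ρ hρ
    have hρ : 0 < ρ := hρ
    by_cases h : ρ < 1
    · rw [indicator_of_mem (by exact h), ← integral_smul]
      refine integral_congr_ae (ae_of_all _ fun θ => ?_)
      simp only [hv]
      rw [indicator_of_mem]
      simp [mem_unitDisc, abs_of_pos hρ, h, hρ.ne']
    · rw [indicator_of_notMem (by exact h)]
      have : ∀ θ, v (circleMap 0 ρ θ) = 0 := fun θ =>
        indicator_of_notMem (fun hh => h (by simpa [mem_unitDisc, abs_of_pos hρ] using hh.1)) _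
      simp [this]
  rw [setIntegral_congr_fun measurableSet_Ioi h1, integral_indicator measurableSet_Iio,
    Measure.restrict_restrict measurableSet_Iio, inter_comm, Ioi_inter_Iio, ← integral_smul]
  refine integral_congr_ae (ae_of_all _ fun ρ => ?_)
  simp only [Complex.real_smul]
  push_cast
  ring

theorem lintegral_poisson {w : ℂ} (hw : ‖w‖ < 1) :
    ∫⁻ θ in Ioo (-Real.pi) Real.pi, ENNReal.ofReal (1 / ‖circleMap 0 1 θ - w‖ ^ 2) =
      ENNReal.ofReal (2 * Real.pi / (1 - ‖w‖ ^ 2)) := by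
  have hpos : 0 < 1 - ‖w‖ ^ 2 := by nlinarith [norm_nonneg w]
  have hne : ∀ θ, circleMap 0 1 θ - w ≠ 0 := fun θ h => by
    have : ‖circleMap 0 1 θ‖ = ‖w‖ := by rw [sub_eq_zero.1 h]
    simp at this
    linarith
  have hcont : Continuous fun θ => 1 / ‖circleMap 0 1 θ - w‖ ^ 2 := by
    refine Continuous.div continuous_const (by fun_prop) fun θ => ?_
    have := hne θ
    positivity
  have hP := (diffContOnCl_const (𝕜 := ℂ) (c := (1 : ℂ)) (s := Metric.ball (0:ℂ) 1))
    |>.circleAverage_poissonKernel_smul' (R := 1) (c := 0) (w := w) (by simpa using hw)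
  have hA : Real.circleAverage (fun z : ℂ => 1 / ‖z - w‖ ^ 2) 0 1 = 1 / (1 - ‖w‖ ^ 2) := by
    have h2 : Real.circleAverage (fun z : ℂ => (((1 - ‖w‖ ^ 2) / ‖z - w‖ ^ 2 : ℝ) : ℂ)) 0 1 = 1 := by
      refine Eq.trans ?_ hP
      refine Real.circleAverage_congr_sphere fun z hz => ?_
      have : ‖z‖ = 1 := by simpa using hz
      simp [this]
    have h3 : Real.circleAverage (fun z : ℂ => (1 - ‖w‖ ^ 2) / ‖z - w‖ ^ 2) 0 1 = 1 := by
      rw [Real.circleAverage_def, intervalIntegral.integral_ofReal] at h2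
      rw [Real.circleAverage_def]
      rw [Complex.real_smul] at h2
      exact_mod_cast h2
    rw [Real.circleAverage_def] at h3 ⊢
    simp_rw [div_eq_mul_inv, intervalIntegral.integral_const_mul, smul_eq_mul] at h3
    rw [eq_div_iff hpos.ne', smul_eq_mul]
    refine Eq.trans ?_ h3
    simp_rw [one_div]
    ring
  rw [← ofReal_integral_eq_lintegral_ofReal]
  · congr 1
    rw [← integral_Ioc_eq_integral_Ioo, ← intervalIntegral.integral_of_le
      (by linarith [Real.pi_pos])]
    rw [Real.circleAverage_def, smul_eq_mul] at hA
    have hper : Function.Periodic (fun θ => 1 / ‖circleMap 0 1 θ - w‖ ^ 2) (2 * Real.pi) :=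
      fun x => by simp [periodic_circleMap 0 1 x]
    have h5 := hper.intervalIntegral_add_eq (-Real.pi) 0
    rw [show -Real.pi + 2 * Real.pi = Real.pi by ring, zero_add] at h5
    rw [h5]
    have := Real.pi_pos
    field_simp at hA ⊢
    linarith
  · exact (hcont.integrableOn_Icc (a := -Real.pi) (b := Real.pi)).mono_set Ioo_subset_Icc_self
  · exact ae_of_all _ fun θ => by positivity

/-! ### Integrals of powers of the distance to the boundary -/

theorem lintegral_one_sub_rpow_le {q r : ℝ} (hq : q < 1) (hr : r ≤ 1) :
    ∫⁻ ρ in Ioo r 1, ENNReal.ofReal ((1 - ρ) ^ (-q)) ≤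
      ENNReal.ofReal ((1 - r) ^ (1 - q) / (1 - q)) := by
  have hinteg : IntervalIntegrable (fun x : ℝ => x ^ (-q)) volume 0 (1 - r) :=
    intervalIntegral.intervalIntegrable_rpow' (by linarith)
  have hinteg2 : IntervalIntegrable (fun ρ : ℝ => (1 - ρ) ^ (-q)) volume r 1 := by
    have := (hinteg.comp_sub_left 1).symm
    simpa using this
  rw [← ofReal_integral_eq_lintegral_ofReal]
  · refine ENNReal.ofReal_le_ofReal (le_of_eq ?_)
    rw [← integral_Ioc_eq_integral_Ioo, ← intervalIntegral.integral_of_le hr,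
      intervalIntegral.integral_comp_sub_left (fun x : ℝ => x ^ (-q)) 1, sub_self,
      integral_rpow (Or.inl (by linarith)), Real.zero_rpow (by linarith)]
    rw [show -q + 1 = 1 - q by ring, sub_zero]
  · exact ((intervalIntegrable_iff_integrableOn_Ioc_of_le hr).1 hinteg2).mono_set Ioo_subset_Ioc_self
  · filter_upwards [ae_restrict_mem measurableSet_Ioo] with ρ hρ
    exact Real.rpow_nonneg (by linarith [hρ.2]) _

theorem lintegral_one_sub_rpow_sub_one_le {q r : ℝ} (hq : 0 < q) (hr0 : 0 ≤ r) (hr : r < 1) :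
    ∫⁻ ρ in Ioo 0 r, ENNReal.ofReal ((1 - ρ) ^ (-q - 1)) ≤
      ENNReal.ofReal ((1 - r) ^ (-q) / q) := by
  have h0 : (0 : ℝ) ∉ uIcc (1 - r) 1 := by
    rw [uIcc_of_le (by linarith)]
    intro h
    linarith [h.1]
  have hinteg : IntervalIntegrable (fun x : ℝ => x ^ (-q - 1)) volume (1 - r) 1 :=
    intervalIntegral.intervalIntegrable_rpow (Or.inr h0)
  have hinteg2 : IntervalIntegrable (fun ρ : ℝ => (1 - ρ) ^ (-q - 1)) volume 0 r := by
    have := (hinteg.comp_sub_left 1).symm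
    simpa using this
  rw [← ofReal_integral_eq_lintegral_ofReal]
  · refine ENNReal.ofReal_le_ofReal ?_
    rw [← integral_Ioc_eq_integral_Ioo, ← intervalIntegral.integral_of_le hr0,
      intervalIntegral.integral_comp_sub_left (fun x : ℝ => x ^ (-q - 1)) 1, sub_zero,
      integral_rpow (Or.inr ⟨by linarith, h0⟩), Real.one_rpow]
    rw [show -q - 1 + 1 = -q by ring, div_neg, ← neg_div]
    gcongr
    linarith
  · exact ((intervalIntegrable_iff_integrableOn_Ioc_of_le hr0).1 hinteg2).mono_set
      Ioo_subset_Ioc_self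
  · filter_upwards [ae_restrict_mem measurableSet_Ioo] with ρ hρ
    exact Real.rpow_nonneg (by linarith [hρ.2]) _

theorem norm_one_sub_mul_conj_circleMap (z : ℂ) (ρ θ : ℝ) :
    ‖1 - z * (starRingEnd ℂ) (circleMap 0 ρ θ)‖ = ‖circleMap 0 1 θ - z * ρ‖ := by
  have h : circleMap 0 1 θ * (1 - z * (starRingEnd ℂ) (circleMap 0 ρ θ)) =
      circleMap 0 1 θ - z * ρ := by
    have h1 : circleMap 0 1 θ * (starRingEnd ℂ) (circleMap 0 1 θ) = 1 := by
      rw [Complex.mul_conj, Complex.normSq_eq_norm_sq]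
      simp
    have h2 : (starRingEnd ℂ) (circleMap 0 ρ θ) = ρ * (starRingEnd ℂ) (circleMap 0 1 θ) := by
      simp [circleMap]
    rw [h2]
    linear_combination (-z * ρ) * h1
  rw [← h, norm_mul]
  simp

theorem measurable_boundaryKernel (q : ℝ) (z : ℂ) : Measurable fun ζ : ℂ =>
    ENNReal.ofReal ((1 - ‖ζ‖) ^ (-q) / ‖1 - z * (starRingEnd ℂ) ζ‖ ^ 2) := by
  have : Measurable (fun ζ : ℂ => (starRingEnd ℂ) ζ) := Complex.continuous_conj.measurable
  fun_prop

/-- The Forelli–Rudin type estimate for the exponent two. -/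
theorem lintegral_boundaryKernel_le {q : ℝ} (hq0 : 0 < q) (hq1 : q < 1) {z : ℂ}
    (hz : z ∈ unitDisc) :
    ∫⁻ ζ, ENNReal.ofReal ((1 - ‖ζ‖) ^ (-q) / ‖1 - z * (starRingEnd ℂ) ζ‖ ^ 2) ∂discArea ≤
      ENNReal.ofReal ((2 / q + 2 / (1 - q)) * (1 - ‖z‖) ^ (-q)) := by
  have hz1 : ‖z‖ < 1 := mem_unitDisc.1 hz
  have hz0 := norm_nonneg z
  set r := ‖z‖ with hr
  rw [lintegral_discArea_polar (measurable_boundaryKernel q z)]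
  have key : ∀ ρ ∈ Ioo (0 : ℝ) 1, ENNReal.ofReal (ρ / Real.pi) *
      ∫⁻ θ in Ioo (-Real.pi) Real.pi, ENNReal.ofReal ((1 - ‖circleMap 0 ρ θ‖) ^ (-q) /
        ‖1 - z * (starRingEnd ℂ) (circleMap 0 ρ θ)‖ ^ 2) ≤
      ENNReal.ofReal (2 * ((1 - ρ) ^ (-q) / (1 - r * ρ))) := by
    intro ρ hρ
    have hp : 0 ≤ (1 - ρ) ^ (-q) := Real.rpow_nonneg (by linarith [hρ.2]) _
    have hrρ : r * ρ < 1 := by nlinarith [hρ.1, hρ.2]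
    have hrρ0 : 0 ≤ r * ρ := mul_nonneg hz0 hρ.1.le
    have e1 : ∀ θ, ENNReal.ofReal ((1 - ‖circleMap 0 ρ θ‖) ^ (-q) /
        ‖1 - z * (starRingEnd ℂ) (circleMap 0 ρ θ)‖ ^ 2) =
        ENNReal.ofReal ((1 - ρ) ^ (-q)) *
          ENNReal.ofReal (1 / ‖circleMap 0 1 θ - z * ρ‖ ^ 2) := fun θ => by
      rw [norm_circleMap_of_mem hρ, norm_one_sub_mul_conj_circleMap, ← ENNReal.ofReal_mul hp]
      congr 1
      ring
    have hn : ‖z * (ρ : ℂ)‖ = r * ρ := by rw [norm_mul]; simp [abs_of_pos hρ.1, hr]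
    simp_rw [e1]
    rw [lintegral_const_mul' _ _ (by simp), lintegral_poisson (by rw [hn]; exact hrρ), hn,
      ← ENNReal.ofReal_mul hp, ← ENNReal.ofReal_mul (by have := hρ.1; positivity)]
    refine ENNReal.ofReal_le_ofReal ?_
    have h3 : 0 < 1 - r * ρ := by linarith
    have h4 : 1 - (r * ρ) ^ 2 = (1 - r * ρ) * (1 + r * ρ) := by ring
    rw [h4]
    have h5 : ρ / Real.pi * ((1 - ρ) ^ (-q) * (2 * Real.pi / ((1 - r * ρ) * (1 + r * ρ)))) =
        (2 * ((1 - ρ) ^ (-q) / (1 - r * ρ))) * (ρ / (1 + r * ρ)) := by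
      have := Real.pi_pos
      field_simp
    rw [h5]
    refine mul_le_of_le_one_right (by positivity) ?_
    rw [div_le_one (by linarith)]
    linarith [hρ.2]
  refine (setLIntegral_mono' measurableSet_Ioo key).trans ?_
  have hsub : Ioo (0 : ℝ) 1 ⊆ Ioo 0 r ∪ Ico r 1 := fun x hx => by
    rcases lt_or_ge x r with h | h
    · exact Or.inl ⟨hx.1, h⟩
    · exact Or.inr ⟨h, hx.2⟩
  refine (lintegral_mono_set hsub).trans ((lintegral_union_le _ _ _).trans ?_)
  have hA : ∫⁻ ρ in Ioo 0 r, ENNReal.ofReal (2 * ((1 - ρ) ^ (-q) / (1 - r * ρ))) ≤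
      ENNReal.ofReal (2 / q * (1 - r) ^ (-q)) := by
    calc _ ≤ ∫⁻ ρ in Ioo 0 r, ENNReal.ofReal 2 * ENNReal.ofReal ((1 - ρ) ^ (-q - 1)) := by
          refine setLIntegral_mono' measurableSet_Ioo fun ρ hρ => ?_
          rw [← ENNReal.ofReal_mul (by norm_num)]
          refine ENNReal.ofReal_le_ofReal ?_
          have h1 : 0 < 1 - ρ := by linarith [hρ.2]
          rw [Real.rpow_sub_one h1.ne']
          have := Real.rpow_nonneg h1.le (-q)
          gcongr
          nlinarith [hρ.1]
      _ ≤ ENNReal.ofReal 2 * ENNReal.ofReal ((1 - r) ^ (-q) / q) := by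
          rw [lintegral_const_mul' _ _ (by simp)]
          gcongr
          exact lintegral_one_sub_rpow_sub_one_le hq0 hz0 hz1
      _ = _ := by
          rw [← ENNReal.ofReal_mul (by norm_num)]
          congr 1
          ring
  have hB : ∫⁻ ρ in Ico r 1, ENNReal.ofReal (2 * ((1 - ρ) ^ (-q) / (1 - r * ρ))) ≤
      ENNReal.ofReal (2 / (1 - q) * (1 - r) ^ (-q)) := by
    have h1r : 0 < 1 - r := by linarith
    rw [← restrict_Ioo_eq_restrict_Ico]
    calc _ ≤ ∫⁻ ρ in Ioo r 1, ENNReal.ofReal (2 / (1 - r)) * ENNReal.ofReal ((1 - ρ) ^ (-q)) := by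
          refine setLIntegral_mono' measurableSet_Ioo fun ρ hρ => ?_
          rw [← ENNReal.ofReal_mul (by positivity)]
          refine ENNReal.ofReal_le_ofReal ?_
          have h1 : 0 < 1 - ρ := by linarith [hρ.2]
          have := Real.rpow_nonneg h1.le (-q)
          rw [div_mul_eq_mul_div, ← mul_div_assoc]
          gcongr
          nlinarith [hρ.1, hρ.2]
      _ ≤ ENNReal.ofReal (2 / (1 - r)) * ENNReal.ofReal ((1 - r) ^ (1 - q) / (1 - q)) := by
          rw [lintegral_const_mul' _ _ (by simp)]
          gcongr
          exact lintegral_one_sub_rpow_le hq1 hz1.le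
      _ = _ := by
          rw [← ENNReal.ofReal_mul (by positivity)]
          congr 1
          rw [show 1 - q = -q + 1 by ring, Real.rpow_add_one h1r.ne']
          field_simp
  refine (add_le_add hA hB).trans (le_of_eq ?_)
  have h1 : 0 ≤ (1 - r) ^ (-q) := Real.rpow_nonneg (by linarith) _
  have h2 : 0 < 1 - q := by linarith
  rw [← ENNReal.ofReal_add (by positivity) (by positivity)]
  congr 1
  ring

/-! ### Carleson squares -/

theorem carlesonSquare_subset (a : ℂ) : carlesonSquare a ⊆ unitDisc := fun _ hz => hz.1

theorem carlesonSquare_zero : carlesonSquare 0 = unitDisc := by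
  ext z
  simp [carlesonSquare]

theorem measurableSet_carlesonSquare (a : ℂ) : MeasurableSet (carlesonSquare a) := by
  by_cases ha : a = 0
  · rw [ha, carlesonSquare_zero]
    exact measurableSet_unitDisc
  · have h : carlesonSquare a = unitDisc ∩ ({z | |(z / a).arg| ≤ (1 - ‖a‖) / 2} ∩
        {z | 1 - ‖z‖ ≤ 1 - ‖a‖}) := by
      ext z
      simp only [carlesonSquare, ne_eq, ha, not_false_eq_true, true_imp_iff, mem_inter_iff]
      rfl
    rw [h]
    have hm : Measurable fun z : ℂ => |(z / a).arg| :=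
      (Complex.measurable_arg.comp (measurable_id.div_const a)).norm
    exact measurableSet_unitDisc.inter ((measurableSet_le hm measurable_const).inter
      (measurableSet_le (by fun_prop) measurable_const))

theorem lintegral_discArea_rotation (c : Circle) (u : ℂ → ℝ≥0∞) :
    ∫⁻ z, u (c * z) ∂discArea = ∫⁻ z, u z ∂discArea := by
  have h1 : MeasurePreserving (rotation c) (volume : Measure ℂ) volume :=
    (rotation c).measurePreserving
  have h2 := h1.restrict_preimage_emb (rotation c).toHomeomorph.measurableEmbedding unitDisc
  have h3 : (rotation c) ⁻¹' unitDisc = unitDisc := by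
    ext z
    rw [mem_preimage, mem_unitDisc, mem_unitDisc, LinearIsometryEquiv.norm_map]
  rw [h3] at h2
  simp only [discArea, lintegral_smul_measure]
  rw [← h2.lintegral_comp_emb (rotation c).toHomeomorph.measurableEmbedding u]
  simp [rotation_apply]

/-- Radial functions integrate over Carleson squares like over the corresponding annulus. -/
theorem lintegral_carlesonSquare_radial_le {a : ℂ} (ha : a ∈ unitDisc) {φ : ℝ → ℝ≥0∞}
    (hφ : Measurable φ) :
    ∫⁻ z in carlesonSquare a, φ ‖z‖ ∂discArea ≤
      ENNReal.ofReal (1 - ‖a‖) * ∫⁻ ρ in Ioo ‖a‖ 1, 2 * φ ρ := by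
  have ha1 : ‖a‖ < 1 := mem_unitDisc.1 ha
  have hφm : Measurable fun z : ℂ => φ ‖z‖ := hφ.comp measurable_norm
  by_cases ha0 : a = 0
  · rw [ha0, carlesonSquare_zero, norm_zero, sub_zero, ENNReal.ofReal_one, one_mul]
    refine (setLIntegral_le_lintegral _ _).trans ?_
    rw [lintegral_discArea_polar hφm]
    refine setLIntegral_mono' measurableSet_Ioo fun ρ hρ => ?_
    simp only [norm_circleMap_of_mem hρ]
    rw [setLIntegral_const, Real.volume_Ioo, mul_comm (φ ρ), ← mul_assoc,
      ← ENNReal.ofReal_mul (by have := hρ.1; positivity)]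
    gcongr
    rw [show (2 : ℝ≥0∞) = ENNReal.ofReal 2 by simp]
    refine ENNReal.ofReal_le_ofReal ?_
    have := Real.pi_pos
    field_simp
    linarith [hρ.2]
  · have hapos : 0 < ‖a‖ := norm_pos_iff.2 ha0
    obtain ⟨c, hc⟩ : ∃ c : Circle, a = c * (‖a‖ : ℂ) := by
      refine ⟨Circle.exp a.arg, ?_⟩
      rw [Circle.coe_exp, mul_comm, Complex.norm_mul_exp_arg_mul_I]
    rw [← lintegral_indicator (measurableSet_carlesonSquare a), ← lintegral_discArea_rotation c]
    set E : Set ℂ := {w | |w.arg| ≤ (1 - ‖a‖) / 2 ∧ ‖a‖ ≤ ‖w‖} with hE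
    have hEm : MeasurableSet E :=
      (measurableSet_le (Complex.measurable_arg.norm) measurable_const).inter
        (measurableSet_le measurable_const measurable_norm)
    have hle : ∀ w : ℂ, (carlesonSquare a).indicator (fun z => φ ‖z‖) (c * w) ≤
        E.indicator (fun z => φ ‖z‖) w := by
      intro w
      by_cases hw : (c : ℂ) * w ∈ carlesonSquare a
      · have hwE : w ∈ E := by
          have h2 := hw.2 ha0
          have h3 : (c : ℂ) * w / a = ((‖a‖⁻¹ : ℝ) : ℂ) * w := by
            conv_lhs => rw [hc]
            rw [mul_div_mul_left _ _ (Circle.coe_ne_zero c), Complex.ofReal_inv, div_eq_inv_mul]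
          rw [h3, Complex.arg_real_mul _ (by positivity)] at h2
          refine ⟨h2.1, ?_⟩
          have h4 := h2.2
          rw [norm_mul, Circle.norm_coe, one_mul] at h4
          linarith
        rw [indicator_of_mem hw, indicator_of_mem hwE, norm_mul, Circle.norm_coe, one_mul]
      · rw [indicator_of_notMem hw]
        exact zero_le
    refine (lintegral_mono hle).trans ?_
    rw [lintegral_discArea_polar (hφm.indicator hEm)]
    have hρle : ∀ ρ ∈ Ioo (0 : ℝ) 1, ENNReal.ofReal (ρ / Real.pi) *
        ∫⁻ θ in Ioo (-Real.pi) Real.pi, E.indicator (fun z => φ ‖z‖) (circleMap 0 ρ θ) ≤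
        (Ici ‖a‖).indicator (fun ρ => ENNReal.ofReal (1 - ‖a‖) * (2 * φ ρ)) ρ := by
      intro ρ hρ
      by_cases hρa : ‖a‖ ≤ ρ
      · rw [indicator_of_mem (by exact hρa)]
        have h5 : ∫⁻ θ in Ioo (-Real.pi) Real.pi,
            E.indicator (fun z => φ ‖z‖) (circleMap 0 ρ θ) ≤
            ∫⁻ θ, (Icc (-((1 - ‖a‖) / 2)) ((1 - ‖a‖) / 2)).indicator (fun _ => φ ρ) θ := by
          refine le_trans (setLIntegral_mono' measurableSet_Ioo fun θ hθ => ?_)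
            (setLIntegral_le_lintegral (Ioo (-Real.pi) Real.pi) _)
          by_cases hm : circleMap 0 ρ θ ∈ E
          · rw [indicator_of_mem hm, indicator_of_mem, norm_circleMap_of_mem hρ]
            have h6 := hm.1
            rw [show circleMap 0 ρ θ = ρ * (Complex.cos θ + Complex.sin θ * Complex.I) by
              simp [circleMap, Complex.exp_mul_I], Complex.arg_mul_cos_add_sin_mul_I hρ.1
              ⟨hθ.1, hθ.2.le⟩] at h6
            exact abs_le.1 h6
          · rw [indicator_of_notMem hm]
            exact zero_le
        refine (mul_le_mul_right h5 _).trans ?_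
        rw [lintegral_indicator measurableSet_Icc, setLIntegral_const, Real.volume_Icc,
          show (1 - ‖a‖) / 2 - -((1 - ‖a‖) / 2) = 1 - ‖a‖ by ring, mul_comm (φ ρ),
          mul_left_comm]
        gcongr
        rw [show (2 : ℝ≥0∞) = ENNReal.ofReal 2 by simp]
        refine ENNReal.ofReal_le_ofReal ?_
        rw [div_le_iff₀ Real.pi_pos]
        nlinarith [hρ.2, Real.pi_gt_three]
      · rw [indicator_of_notMem (by exact hρa)]
        have : ∀ θ, E.indicator (fun z => φ ‖z‖) (circleMap 0 ρ θ) = 0 := fun θ =>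
          indicator_of_notMem (fun h => hρa (by simpa [norm_circleMap_of_mem hρ] using h.2)) _
        simp [this]
    refine (setLIntegral_mono' measurableSet_Ioo hρle).trans ?_
    rw [lintegral_indicator measurableSet_Ici, Measure.restrict_restrict measurableSet_Ici,
      lintegral_const_mul' _ _ (by simp)]
    refine mul_le_mul_right ?_ _
    rw [restrict_Ioo_eq_restrict_Ico (a := ‖a‖)]
    exact lintegral_mono_set fun x hx => ⟨hx.1, hx.2.2⟩

theorem dist_le_of_mem_carlesonSquare {a z : ℂ} (ha0 : a ≠ 0) (hz : z ∈ carlesonSquare a) :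
    ‖z - a‖ ≤ 3 / 2 * (1 - ‖a‖) := by
  have hz1 : ‖z‖ < 1 := mem_unitDisc.1 hz.1
  obtain ⟨h1, h2⟩ := hz.2 ha0
  have hapos : 0 < ‖a‖ := norm_pos_iff.2 ha0
  have e1 : z - a = a * ((‖z / a‖ - 1 : ℝ) * Complex.exp ((z / a).arg * Complex.I) +
      (Complex.exp (Complex.I * (z / a).arg) - 1)) := by
    have h3 : z = a * (z / a) := by field_simp
    have h4 := Complex.norm_mul_exp_arg_mul_I (z / a)
    rw [mul_comm Complex.I]
    push_cast
    linear_combination h3 - a * h4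
  have e2 : ‖a‖ * |‖z / a‖ - 1| = |‖z‖ - ‖a‖| := by
    rw [norm_div, ← abs_of_pos hapos, ← abs_mul, abs_of_pos hapos]
    congr 1
    field_simp
  have e3 : |‖z‖ - ‖a‖| ≤ 1 - ‖a‖ := by
    rw [abs_of_nonneg (by linarith)]
    linarith
  rw [e1, norm_mul]
  calc _ ≤ ‖a‖ * (|‖z / a‖ - 1| + |(z / a).arg|) := by
        gcongr
        refine (norm_add_le _ _).trans (add_le_add ?_ ?_)
        · rw [norm_mul, Complex.norm_exp_ofReal_mul_I, mul_one, Complex.norm_real,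
            Real.norm_eq_abs]
        · exact Real.norm_exp_I_mul_ofReal_sub_one_le
    _ ≤ _ := by
        rw [mul_add, e2]
        nlinarith [abs_nonneg (z / a).arg]

/-! ### An integral operator acting on Carleson measures -/

theorem one_sub_norm_le_norm_one_sub_mul_conj {z ζ : ℂ} (hζ : ζ ∈ unitDisc) :
    1 - ‖z‖ ≤ ‖1 - z * (starRingEnd ℂ) ζ‖ := by
  have h1 : ‖z * (starRingEnd ℂ) ζ‖ ≤ ‖z‖ := by
    rw [norm_mul, RCLike.norm_conj]
    exact mul_le_of_le_one_right (norm_nonneg z) (mem_unitDisc.1 hζ).le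
  have h2 := norm_sub_norm_le (1 : ℂ) (z * (starRingEnd ℂ) ζ)
  rw [norm_one] at h2
  linarith

theorem norm_one_sub_mul_conj_comm (z ζ : ℂ) :
    ‖1 - z * (starRingEnd ℂ) ζ‖ = ‖1 - ζ * (starRingEnd ℂ) z‖ := by
  rw [← RCLike.norm_conj]
  simp [mul_comm]

theorem lintegral_carlesonSquare_kernel_le {η : ℝ} (hη0 : 0 < η) (hη1 : η < 1) :
    ∃ C : ℝ, 0 < C ∧ ∀ a ∈ unitDisc, ∀ ζ ∈ unitDisc,
      ∫⁻ z in carlesonSquare a,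
        ENNReal.ofReal ((1 - ‖z‖) ^ (η - 1) / ‖1 - z * (starRingEnd ℂ) ζ‖ ^ 2) ∂discArea ≤
      ENNReal.ofReal (C * ((1 - ‖ζ‖) ^ (η - 1) *
        ((1 - ‖a‖) / ‖1 - a * (starRingEnd ℂ) ζ‖) ^ (1 + η))) := by
  have h1η : 0 < 1 - η := by linarith
  set C₁ : ℝ := 2 / (1 - η) + 2 / η with hC₁
  have hC₁0 : 0 < C₁ := by positivity
  refine ⟨C₁ * 64 + 8 / η, by positivity, fun a ha ζ hζ => ?_⟩
  have ha1 : 0 < 1 - ‖a‖ := by linarith [mem_unitDisc.1 ha]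
  have hζ1 : 0 < 1 - ‖ζ‖ := by linarith [mem_unitDisc.1 hζ]
  set d := ‖1 - a * (starRingEnd ℂ) ζ‖ with hd
  have hdh : 1 - ‖a‖ ≤ d := one_sub_norm_le_norm_one_sub_mul_conj hζ
  have hdζ : 1 - ‖ζ‖ ≤ d := by
    rw [hd, norm_one_sub_mul_conj_comm]
    exact one_sub_norm_le_norm_one_sub_mul_conj ha
  have hd0 : 0 < d := by linarith
  have hP : 0 < (1 - ‖ζ‖) ^ (η - 1) := Real.rpow_pos_of_pos hζ1 _
  have hQ : 0 < ((1 - ‖a‖) / d) ^ (1 + η) := Real.rpow_pos_of_pos (by positivity) _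
  by_cases hcase : d ≤ 8 * (1 - ‖a‖)
  · have hFR := lintegral_boundaryKernel_le h1η (by linarith : 1 - η < 1) hζ
    have e : ∀ z : ℂ, ENNReal.ofReal ((1 - ‖z‖) ^ (η - 1) / ‖1 - z * (starRingEnd ℂ) ζ‖ ^ 2) =
        ENNReal.ofReal ((1 - ‖z‖) ^ (-(1 - η)) / ‖1 - ζ * (starRingEnd ℂ) z‖ ^ 2) := fun z => by
      rw [norm_one_sub_mul_conj_comm, neg_sub]
    simp_rw [e]
    refine (setLIntegral_le_lintegral _ _).trans (hFR.trans (ENNReal.ofReal_le_ofReal ?_))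
    rw [sub_sub_cancel, neg_sub, ← hC₁]
    have h64 : 1 ≤ 64 * ((1 - ‖a‖) / d) ^ (1 + η) := by
      have h8 : (1 / 8 : ℝ) ≤ (1 - ‖a‖) / d := by
        rw [div_le_div_iff₀ (by norm_num) hd0]
        linarith
      have h9 : (1 / 8 : ℝ) ^ (2 : ℝ) ≤ ((1 - ‖a‖) / d) ^ (1 + η) :=
        (Real.rpow_le_rpow_of_exponent_ge (by norm_num) (by norm_num) (by linarith)).trans
          (Real.rpow_le_rpow (by norm_num) h8 (by linarith))
      norm_num at h9
      linarith
    calc C₁ * (1 - ‖ζ‖) ^ (η - 1) ≤ C₁ * (1 - ‖ζ‖) ^ (η - 1) *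
          (64 * ((1 - ‖a‖) / d) ^ (1 + η)) := le_mul_of_one_le_right (by positivity) h64
      _ = C₁ * 64 * ((1 - ‖ζ‖) ^ (η - 1) * ((1 - ‖a‖) / d) ^ (1 + η)) := by ring
      _ ≤ _ := by
        gcongr
        have : 0 < 8 / η := by positivity
        linarith
  · push Not at hcase
    have ha0 : a ≠ 0 := by
      rintro rfl
      rw [hd] at hcase
      norm_num at hcase
    have hker : ∀ z ∈ carlesonSquare a,
        ENNReal.ofReal ((1 - ‖z‖) ^ (η - 1) / ‖1 - z * (starRingEnd ℂ) ζ‖ ^ 2) ≤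
        ENNReal.ofReal (4 / d ^ 2) * ENNReal.ofReal ((1 - ‖z‖) ^ (-(1 - η))) := by
      intro z hz
      have hz1 : 0 < 1 - ‖z‖ := by linarith [mem_unitDisc.1 hz.1]
      have h1 : d / 2 ≤ ‖1 - z * (starRingEnd ℂ) ζ‖ := by
        have h2 : ‖(z - a) * (starRingEnd ℂ) ζ‖ ≤ 3 / 2 * (1 - ‖a‖) := by
          rw [norm_mul, RCLike.norm_conj]
          exact (mul_le_of_le_one_right (norm_nonneg _) (mem_unitDisc.1 hζ).le).trans
            (dist_le_of_mem_carlesonSquare ha0 hz)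
        have h3 : 1 - z * (starRingEnd ℂ) ζ =
          (1 - a * (starRingEnd ℂ) ζ) - (z - a) * (starRingEnd ℂ) ζ := by ring
        have h4 := norm_sub_norm_le (1 - a * (starRingEnd ℂ) ζ) ((z - a) * (starRingEnd ℂ) ζ)
        rw [← h3] at h4
        linarith
      rw [← ENNReal.ofReal_mul (by positivity), neg_sub]
      refine ENNReal.ofReal_le_ofReal ?_
      have h5 : 0 ≤ (1 - ‖z‖) ^ (η - 1) := Real.rpow_nonneg hz1.le _
      rw [div_mul_eq_mul_div, mul_comm (4 : ℝ), mul_div_assoc, div_eq_mul_one_div]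
      refine mul_le_mul_of_nonneg_left ?_ h5
      rw [div_le_div_iff₀ (pow_pos (by linarith) 2) (by positivity)]
      nlinarith
    refine (setLIntegral_mono' (measurableSet_carlesonSquare a) hker).trans ?_
    rw [lintegral_const_mul' _ _ (by simp)]
    have hrad := lintegral_carlesonSquare_radial_le ha
      (φ := fun ρ => ENNReal.ofReal ((1 - ρ) ^ (-(1 - η)))) (by fun_prop)
    refine (mul_le_mul_right hrad _).trans ?_
    rw [lintegral_const_mul' _ _ (by simp)]
    have hpow := lintegral_one_sub_rpow_le (q := 1 - η) (r := ‖a‖) (by linarith) (by linarith)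
    refine (mul_le_mul_right (mul_le_mul_right (mul_le_mul_right hpow _) _) _).trans ?_
    rw [show (2 : ℝ≥0∞) = ENNReal.ofReal 2 by simp, ← ENNReal.ofReal_mul (by norm_num),
      ← ENNReal.ofReal_mul ha1.le, ← ENNReal.ofReal_mul (by positivity)]
    refine ENNReal.ofReal_le_ofReal ?_
    rw [sub_sub_cancel]
    have e1 : ((1 - ‖a‖) / d) ^ (1 + η) = (1 - ‖a‖) * (1 - ‖a‖) ^ η / (d * d ^ η) := by
      rw [Real.div_rpow ha1.le hd0.le, Real.rpow_one_add' ha1.le (by linarith),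
        Real.rpow_one_add' hd0.le (by linarith)]
    have e2 : 1 / (d / d ^ η) ≤ (1 - ‖ζ‖) ^ (η - 1) := by
      have h6 : (1 - ‖ζ‖) ^ (η - 1) = 1 / (1 - ‖ζ‖) ^ (1 - η) := by
        rw [← neg_sub 1 η, Real.rpow_neg hζ1.le, one_div]
      have h7 : d / d ^ η = d ^ (1 - η) := by rw [Real.rpow_sub hd0, Real.rpow_one]
      rw [h6, h7]
      have h8 : 0 < (1 - ‖ζ‖) ^ (1 - η) := Real.rpow_pos_of_pos hζ1 _
      gcongr
    have hdη : 0 < d ^ η := Real.rpow_pos_of_pos hd0 _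
    have haη : 0 < (1 - ‖a‖) ^ η := Real.rpow_pos_of_pos ha1 _
    calc 4 / d ^ 2 * ((1 - ‖a‖) * (2 * ((1 - ‖a‖) ^ η / η)))
        = 8 / η * (1 / (d / d ^ η) * ((1 - ‖a‖) / d) ^ (1 + η)) := by
          rw [e1]
          field_simp
          norm_num
      _ ≤ 8 / η * ((1 - ‖ζ‖) ^ (η - 1) * ((1 - ‖a‖) / d) ^ (1 + η)) := by gcongr
      _ ≤ _ := by
        gcongr
        have : 0 < C₁ * 64 := by positivity
        linarith

/-- The Cauchy–Schwarz inequality with a weight. -/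
theorem sq_lintegral_mul_le {α : Type*} [MeasurableSpace α] (ν : Measure α) {F k : α → ℝ≥0∞}
    (hF : AEMeasurable F ν) (hk : AEMeasurable k ν) :
    (∫⁻ x, F x * k x ∂ν) ^ 2 ≤ (∫⁻ x, F x ^ 2 * k x ∂ν) * ∫⁻ x, k x ∂ν := by
  have hs : ∀ t : ℝ≥0∞, t ^ (1 / 2 : ℝ) * t ^ (1 / 2 : ℝ) = t := fun t => by
    rw [← ENNReal.rpow_add_of_nonneg _ _ (by norm_num) (by norm_num)]
    norm_num
  have hs2 : ∀ t : ℝ≥0∞, (t ^ (1 / 2 : ℝ)) ^ 2 = t := fun t => by rw [sq, hs]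
  have hH := ENNReal.lintegral_mul_le_Lp_mul_Lq ν (Real.HolderConjugate.two_two)
    (hF.mul (hk.pow_const (1 / 2 : ℝ))) (hk.pow_const (1 / 2 : ℝ))
  simp only [Pi.mul_apply, mul_assoc, hs, ENNReal.rpow_two, mul_pow, hs2] at hH
  calc _ ≤ ((∫⁻ x, F x ^ 2 * k x ∂ν) ^ (1 / 2 : ℝ) * (∫⁻ x, k x ∂ν) ^ (1 / 2 : ℝ)) ^ 2 := by
        gcongr
    _ = _ := by rw [mul_pow, hs2, hs2]

theorem lintegral_carlesonSquare_le_of_le_integralOperator {η : ℝ} (hη0 : 0 < η) (hη1 : η < 1) :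
    ∃ C : ℝ≥0, ∀ F H : ℂ → ℝ≥0∞, AEMeasurable F discArea →
      (∀ z ∈ unitDisc, H z ≤ ENNReal.ofReal ((1 - ‖z‖) ^ η) * ∫⁻ ζ, F ζ *
        ENNReal.ofReal ((1 - ‖ζ‖) ^ (-η) / ‖1 - z * (starRingEnd ℂ) ζ‖ ^ 2) ∂discArea) →
      ∀ a ∈ unitDisc,
        ∫⁻ z in carlesonSquare a, H z ^ 2 * ENNReal.ofReal (1 / (1 - ‖z‖)) ∂discArea ≤
        C * ∫⁻ ζ, ENNReal.ofReal (((1 - ‖a‖) / ‖1 - a * (starRingEnd ℂ) ζ‖) ^ (1 + η)) *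
          (F ζ ^ 2 * ENNReal.ofReal (1 / (1 - ‖ζ‖))) ∂discArea := by
  obtain ⟨C₂, hC₂0, hC₂⟩ := lintegral_carlesonSquare_kernel_le hη0 hη1
  have h1η : 0 < 1 - η := by linarith
  set C₁ : ℝ := 2 / η + 2 / (1 - η) with hC₁
  have hC₁0 : 0 < C₁ := by positivity
  refine ⟨Real.toNNReal (C₁ * C₂), fun F H hF hH a ha => ?_⟩
  have hconj : Measurable (fun ζ : ℂ => (starRingEnd ℂ) ζ) := Complex.continuous_conj.measurable
  have hpt : ∀ z ∈ carlesonSquare a, H z ^ 2 * ENNReal.ofReal (1 / (1 - ‖z‖)) ≤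
      ∫⁻ ζ, ENNReal.ofReal (C₁ * (1 - ‖z‖) ^ (η - 1)) * (F ζ ^ 2 *
        ENNReal.ofReal ((1 - ‖ζ‖) ^ (-η) / ‖1 - z * (starRingEnd ℂ) ζ‖ ^ 2)) ∂discArea := by
    intro z hz
    have hzD := carlesonSquare_subset a hz
    have hz1 : 0 < 1 - ‖z‖ := by linarith [mem_unitDisc.1 hzD]
    have hη : 0 < (1 - ‖z‖) ^ η := Real.rpow_pos_of_pos hz1 _
    have hCS := (sq_lintegral_mul_le discArea hF
      (measurable_boundaryKernel η z).aemeasurable).trans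
      (mul_le_mul_right (lintegral_boundaryKernel_le hη0 hη1 hzD) _)
    calc H z ^ 2 * ENNReal.ofReal (1 / (1 - ‖z‖)) ≤
        (ENNReal.ofReal ((1 - ‖z‖) ^ η) * ∫⁻ ζ, F ζ *
        ENNReal.ofReal ((1 - ‖ζ‖) ^ (-η) / ‖1 - z * (starRingEnd ℂ) ζ‖ ^ 2) ∂discArea) ^ 2 *
          ENNReal.ofReal (1 / (1 - ‖z‖)) := by
          gcongr
          exact hH z hzD
      _ ≤ (ENNReal.ofReal ((1 - ‖z‖) ^ η) ^ 2 * ((∫⁻ ζ, F ζ ^ 2 *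
        ENNReal.ofReal ((1 - ‖ζ‖) ^ (-η) / ‖1 - z * (starRingEnd ℂ) ζ‖ ^ 2) ∂discArea) *
          ENNReal.ofReal (C₁ * (1 - ‖z‖) ^ (-η)))) * ENNReal.ofReal (1 / (1 - ‖z‖)) := by
          rw [mul_pow]
          gcongr
      _ = ENNReal.ofReal (C₁ * (1 - ‖z‖) ^ (η - 1)) * (∫⁻ ζ, F ζ ^ 2 *
        ENNReal.ofReal ((1 - ‖ζ‖) ^ (-η) / ‖1 - z * (starRingEnd ℂ) ζ‖ ^ 2) ∂discArea) := by
          have e : C₁ * (1 - ‖z‖) ^ (η - 1) =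
              ((1 - ‖z‖) ^ η) ^ 2 * (C₁ * (1 - ‖z‖) ^ (-η)) * (1 / (1 - ‖z‖)) := by
            rw [Real.rpow_sub_one hz1.ne', Real.rpow_neg hz1.le]
            field_simp
          have hη' : 0 < (1 - ‖z‖) ^ (-η) := Real.rpow_pos_of_pos hz1 _
          rw [e, ENNReal.ofReal_mul (q := 1 / (1 - ‖z‖)) (by positivity),
            ENNReal.ofReal_mul (p := ((1 - ‖z‖) ^ η) ^ 2) (by positivity), ENNReal.ofReal_pow hη.le]
          ring
      _ = _ := by rw [lintegral_const_mul' _ _ (by simp)]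
  refine (setLIntegral_mono' (measurableSet_carlesonSquare a) hpt).trans ?_
  have : SFinite discArea := by unfold discArea; infer_instance
  rw [lintegral_lintegral_swap]
  · rw [ENNReal.ofNNReal_toNNReal, ← lintegral_const_mul' _ _ (by simp)]
    refine lintegral_mono_ae ?_
    filter_upwards [ae_discArea_mem_unitDisc] with ζ hζ
    have hζ1 : 0 < 1 - ‖ζ‖ := by linarith [mem_unitDisc.1 hζ]
    have ha1 : 0 < 1 - ‖a‖ := by linarith [mem_unitDisc.1 ha]
    have hp : 0 < (1 - ‖ζ‖) ^ (-η) := Real.rpow_pos_of_pos hζ1 _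
    have e : ∀ z ∈ carlesonSquare a, ENNReal.ofReal (C₁ * (1 - ‖z‖) ^ (η - 1)) * (F ζ ^ 2 *
        ENNReal.ofReal ((1 - ‖ζ‖) ^ (-η) / ‖1 - z * (starRingEnd ℂ) ζ‖ ^ 2)) =
        ENNReal.ofReal (C₁ * (1 - ‖ζ‖) ^ (-η)) * F ζ ^ 2 *
        ENNReal.ofReal ((1 - ‖z‖) ^ (η - 1) / ‖1 - z * (starRingEnd ℂ) ζ‖ ^ 2) := by
      intro z hz
      have hz1 : 0 < 1 - ‖z‖ := by linarith [mem_unitDisc.1 hz.1]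
      have hp2 : 0 < (1 - ‖z‖) ^ (η - 1) := Real.rpow_pos_of_pos hz1 _
      rw [mul_left_comm, mul_comm _ (F ζ ^ 2), mul_assoc, ← ENNReal.ofReal_mul (by positivity),
        ← ENNReal.ofReal_mul (by positivity)]
      congr 2
      ring
    have hm : Measurable fun z : ℂ =>
        ENNReal.ofReal ((1 - ‖z‖) ^ (η - 1) / ‖1 - z * (starRingEnd ℂ) ζ‖ ^ 2) := by fun_prop
    rw [setLIntegral_congr_fun (measurableSet_carlesonSquare a) e, lintegral_const_mul _ hm]
    refine (mul_le_mul_right (hC₂ a ha ζ hζ) _).trans (le_of_eq ?_)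
    set T := ((1 - ‖a‖) / ‖1 - a * (starRingEnd ℂ) ζ‖) ^ (1 + η) with hT
    have hT0 : 0 ≤ T := Real.rpow_nonneg (by positivity) _
    have e2 : C₁ * (1 - ‖ζ‖) ^ (-η) * (C₂ * ((1 - ‖ζ‖) ^ (η - 1) * T)) =
        (C₁ * C₂) * (T * (1 / (1 - ‖ζ‖))) := by
      rw [Real.rpow_sub_one hζ1.ne', Real.rpow_neg hζ1.le]
      have : 0 < (1 - ‖ζ‖) ^ η := Real.rpow_pos_of_pos hζ1 _
      field_simp
    rw [mul_right_comm, ← ENNReal.ofReal_mul (by positivity), e2,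
      ENNReal.ofReal_mul (by positivity), ENNReal.ofReal_mul hT0]
    ring
  · refine AEMeasurable.mul (Measurable.aemeasurable ?_) (AEMeasurable.mul ?_
      (Measurable.aemeasurable ?_))
    · fun_prop
    · exact (hF.comp_snd).pow_const 2
    · have h2 : Measurable fun p : ℂ × ℂ => (starRingEnd ℂ) p.2 := hconj.comp measurable_snd
      fun_prop

/-! ### Carleson measures and integrals of powers of the Poisson type kernel -/

theorem abs_arg_le_of_norm_one_sub_lt {w : ℂ} {t : ℝ} (ht : t ≤ 1 / 8) (hw : ‖1 - w‖ < t) :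
    |w.arg| ≤ 4 * t := by
  have ht0 : 0 < t := (norm_nonneg _).trans_lt hw
  have hre : 0 < w.re := by
    have h1 := (Complex.abs_re_le_norm (1 - w)).trans_lt hw
    simp only [Complex.sub_re, Complex.one_re] at h1
    have := (abs_lt.1 h1).2
    linarith
  have him : |w.im| ≤ t := by
    have h1 := (Complex.abs_im_le_norm (1 - w)).trans_lt hw
    simp only [Complex.sub_im, Complex.one_im, zero_sub, abs_neg] at h1
    exact h1.le
  have hn : 7 / 8 ≤ ‖w‖ := by
    have h1 := norm_sub_norm_le (1 : ℂ) w
    rw [norm_one] at h1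
    linarith
  have harg : |w.arg| ≤ Real.pi / 2 := Complex.abs_arg_le_pi_div_two_iff.2 hre.le
  have h2 := Real.mul_abs_le_abs_sin harg
  rw [Complex.sin_arg, abs_div, abs_norm] at h2
  have h3 : |w.im| / ‖w‖ ≤ 8 / 7 * t := by
    rw [div_le_iff₀ (by linarith)]
    nlinarith
  have h4 : 2 / Real.pi * |w.arg| ≤ 8 / 7 * t := h2.trans h3
  rw [div_mul_eq_mul_div, div_le_iff₀ Real.pi_pos] at h4
  nlinarith [Real.pi_lt_four]

theorem exists_carlesonSquare_superset {a : ℂ} (ha : a ∈ unitDisc) {t : ℝ} (ht : 0 < t) :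
    ∃ b ∈ unitDisc, 1 - ‖b‖ = min (8 * t) 1 ∧
      {ζ | ζ ∈ unitDisc ∧ ‖1 - a * (starRingEnd ℂ) ζ‖ < t} ⊆ carlesonSquare b := by
  rcases le_or_gt 1 (8 * t) with h | h
  · refine ⟨0, by simp [mem_unitDisc], by simp [h], ?_⟩
    rw [carlesonSquare_zero]
    exact fun ζ hζ => hζ.1
  · rw [min_eq_left h.le]
    by_cases ha0 : a = 0
    · refine ⟨((1 - 8 * t : ℝ) : ℂ), ?_, ?_, ?_⟩
      · rw [mem_unitDisc, Complex.norm_real, Real.norm_of_nonneg (by linarith)]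
        linarith
      · rw [Complex.norm_real, Real.norm_of_nonneg (by linarith)]
        ring
      · rintro ζ ⟨-, hζ⟩
        rw [ha0, zero_mul, sub_zero, norm_one] at hζ
        linarith
    · have hapos : 0 < ‖a‖ := norm_pos_iff.2 ha0
      have hc : 0 < (1 - 8 * t) / ‖a‖ := div_pos (by linarith) hapos
      set b : ℂ := (((1 - 8 * t) / ‖a‖ : ℝ) : ℂ) * a with hb
      have hbn : ‖b‖ = 1 - 8 * t := by
        rw [hb, norm_mul, Complex.norm_real, Real.norm_of_nonneg hc.le]
        field_simp
      refine ⟨b, by rw [mem_unitDisc, hbn]; linarith, by rw [hbn]; ring, ?_⟩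
      rintro ζ ⟨hζD, hζ⟩
      refine ⟨hζD, fun hb0 => ⟨?_, ?_⟩⟩
      · have h1 : ζ / b = ((((1 - 8 * t) / ‖a‖)⁻¹ * (‖a‖ ^ 2)⁻¹ : ℝ) : ℂ) *
            (ζ * (starRingEnd ℂ) a) := by
          have h2 : a * (starRingEnd ℂ) a = ((‖a‖ ^ 2 : ℝ) : ℂ) := by
            rw [Complex.mul_conj, Complex.normSq_eq_norm_sq]
          have h3 : ((‖a‖ ^ 2 : ℝ) : ℂ) ≠ 0 := by
            simpa using ha0
          have h5 : (((1 - 8 * t) / ‖a‖ : ℝ) : ℂ) ≠ 0 := by exact_mod_cast hc.ne'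
          rw [div_eq_iff hb0, hb, Complex.ofReal_mul, Complex.ofReal_inv, Complex.ofReal_inv]
          field_simp
          rw [← h2]
          ring
        have h4 : ‖1 - ζ * (starRingEnd ℂ) a‖ < t := by
          rwa [norm_one_sub_mul_conj_comm]
        rw [h1, Complex.arg_real_mul _ (by positivity), hbn]
        have := abs_arg_le_of_norm_one_sub_lt (by linarith) h4
        linarith
      · rw [hbn]
        have := one_sub_norm_le_norm_one_sub_mul_conj (z := ζ) ha
        rw [norm_one_sub_mul_conj_comm] at this
        linarith

theorem measure_le_carlesonQuotient (ν : Measure ℂ) {b : ℂ} (hb : b ∈ unitDisc) :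
    ν (carlesonSquare b) = carlesonQuotient ν b * ENNReal.ofReal (1 - ‖b‖) := by
  have h1 : 0 < 1 - ‖b‖ := by linarith [mem_unitDisc.1 hb]
  rw [carlesonQuotient, ENNReal.div_mul_cancel (by simpa using h1) (by simp)]

theorem carlesonQuotient_le_carlesonSup (ν : Measure ℂ) {b : ℂ} (hb : b ∈ unitDisc) :
    carlesonQuotient ν b ≤ carlesonSup ν :=
  le_iSup₂ (f := fun a (_ : a ∈ unitDisc) => carlesonQuotient ν a) b hb

/-- The integral of a power of the Poisson type kernel with base point `a` is controlled by the
Carleson quotients of a dyadic chain of squares. -/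
theorem lintegral_kernel_le_tsum {η : ℝ} (hη : 0 < η) {a : ℂ} (ha : a ∈ unitDisc) :
    ∃ b : ℕ → ℂ, (∀ k, b k ∈ unitDisc ∧ 1 - ‖b k‖ ≤ 16 * 2 ^ k * (1 - ‖a‖)) ∧
      ∀ ν : Measure ℂ, ν unitDiscᶜ = 0 →
        ∫⁻ ζ, ENNReal.ofReal (((1 - ‖a‖) / ‖1 - a * (starRingEnd ℂ) ζ‖) ^ (1 + η)) ∂ν ≤
        ENNReal.ofReal (1 - ‖a‖) *
          ∑' k, ENNReal.ofReal (16 * ((2 : ℝ) ^ (-η)) ^ k) * carlesonQuotient ν (b k) := by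
  have ha1 : 0 < 1 - ‖a‖ := by linarith [mem_unitDisc.1 ha]
  set h := 1 - ‖a‖ with hh
  choose b hbD hbn hbs using fun k : ℕ =>
    exists_carlesonSquare_superset ha (t := 2 * 2 ^ k * h) (by positivity)
  refine ⟨b, fun k => ⟨hbD k, ?_⟩, fun ν hν => ?_⟩
  · rw [hbn]
    refine (min_le_left _ _).trans (le_of_eq ?_)
    ring
  set κ : ℂ → ℝ := fun ζ => ‖1 - a * (starRingEnd ℂ) ζ‖ with hκ
  have hκm : Measurable κ := by
    have : Measurable (fun ζ : ℂ => (starRingEnd ℂ) ζ) := Complex.continuous_conj.measurable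
    fun_prop
  set A : ℕ → Set ℂ := fun k => {ζ | ζ ∈ unitDisc ∧ κ ζ < 2 * 2 ^ k * h} with hA
  have hAm : ∀ k, MeasurableSet (A k) := fun k =>
    measurableSet_unitDisc.inter (measurableSet_lt hκm measurable_const)
  have hpt : ∀ ζ ∈ unitDisc, ENNReal.ofReal ((h / κ ζ) ^ (1 + η)) ≤
      ∑' k, (A k).indicator (fun _ => ENNReal.ofReal (((2 : ℝ) ^ k)⁻¹ ^ (1 + η))) ζ := by
    intro ζ hζ
    have h1 : h ≤ κ ζ := one_sub_norm_le_norm_one_sub_mul_conj hζ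
    have hx : 1 ≤ κ ζ / h := by rwa [one_le_div ha1]
    obtain ⟨k, hk1, hk2⟩ := exists_nat_pow_near hx one_lt_two
    have hmem : ζ ∈ A k := by
      refine ⟨hζ, ?_⟩
      rw [div_lt_iff₀ ha1, pow_succ] at hk2
      linarith
    refine le_trans ?_ (ENNReal.le_tsum k)
    rw [indicator_of_mem hmem]
    refine ENNReal.ofReal_le_ofReal (Real.rpow_le_rpow (by positivity) ?_ (by linarith))
    rw [← inv_div]
    gcongr
  have hae : ∀ᵐ ζ ∂ν, ζ ∈ unitDisc := by
    rw [ae_iff]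
    exact hν
  calc ∫⁻ ζ, ENNReal.ofReal ((h / κ ζ) ^ (1 + η)) ∂ν
      ≤ ∫⁻ ζ, ∑' k, (A k).indicator (fun _ => ENNReal.ofReal (((2 : ℝ) ^ k)⁻¹ ^ (1 + η))) ζ ∂ν :=
        lintegral_mono_ae (hae.mono hpt)
    _ = ∑' k, ENNReal.ofReal (((2 : ℝ) ^ k)⁻¹ ^ (1 + η)) * ν (A k) := by
        rw [lintegral_tsum fun k => (measurable_const.indicator (hAm k)).aemeasurable]
        refine tsum_congr fun k => ?_
        rw [lintegral_indicator (hAm k), setLIntegral_const]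
    _ ≤ ∑' k, ENNReal.ofReal h *
          (ENNReal.ofReal (16 * ((2 : ℝ) ^ (-η)) ^ k) * carlesonQuotient ν (b k)) := by
        refine ENNReal.tsum_le_tsum fun k => ?_
        have h2 : ν (A k) ≤ carlesonQuotient ν (b k) * ENNReal.ofReal (16 * 2 ^ k * h) := by
          refine (measure_mono (hbs k)).trans ?_
          rw [measure_le_carlesonQuotient ν (hbD k)]
          gcongr
          rw [hbn]
          refine (min_le_left _ _).trans (le_of_eq ?_)
          ring
        refine (mul_le_mul_right h2 _).trans (le_of_eq ?_)
        have e : ((2 : ℝ) ^ k)⁻¹ ^ (1 + η) * (16 * 2 ^ k * h) =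
            h * (16 * ((2 : ℝ) ^ (-η)) ^ k) := by
          rw [Real.rpow_one_add' (by positivity) (by linarith), Real.inv_rpow (by positivity),
            Real.rpow_neg (by norm_num), inv_pow, ← Real.rpow_natCast, ← Real.rpow_natCast,
            ← Real.rpow_mul (by norm_num), ← Real.rpow_mul (by norm_num), mul_comm η]
          have : (0 : ℝ) < 2 ^ (k : ℝ) := by positivity
          field_simp
        rw [mul_comm (carlesonQuotient ν (b k)), ← mul_assoc, ← mul_assoc,
          ← ENNReal.ofReal_mul (by positivity), ← ENNReal.ofReal_mul ha1.le, e]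
    _ = _ := ENNReal.tsum_mul_left

theorem tsum_ofReal_dyadic_ne_top {η : ℝ} (hη : 0 < η) :
    ∑' k : ℕ, ENNReal.ofReal (16 * ((2 : ℝ) ^ (-η)) ^ k) ≠ ∞ := by
  have h1 : (2 : ℝ) ^ (-η) < 1 := Real.rpow_lt_one_of_one_lt_of_neg (by norm_num) (by linarith)
  have hs : Summable fun k : ℕ => 16 * ((2 : ℝ) ^ (-η)) ^ k :=
    (summable_geometric_of_lt_one (by positivity) h1).mul_left 16
  exact hs.tsum_ofReal_ne_top

/-- If the values of `ν'` on Carleson squares are controlled by Poisson type integrals of `ν`, then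
the (vanishing) Carleson property passes from `ν` to `ν'`. -/
theorem carleson_of_le_lintegral_kernel {η : ℝ} (hη : 0 < η) (C₀ : ℝ≥0) :
    ∃ C : ℝ≥0, ∀ ν ν' : Measure ℂ, ν unitDiscᶜ = 0 →
      (∀ a ∈ unitDisc, ν' (carlesonSquare a) ≤ C₀ *
        ∫⁻ ζ, ENNReal.ofReal (((1 - ‖a‖) / ‖1 - a * (starRingEnd ℂ) ζ‖) ^ (1 + η)) ∂ν) →
      carlesonSup ν' ≤ C * carlesonSup ν ∧ (IsVanishingCarleson ν → IsVanishingCarleson ν') := by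
  set c : ℕ → ℝ≥0∞ := fun k => ENNReal.ofReal (16 * ((2 : ℝ) ^ (-η)) ^ k) with hc
  have hcfin : ∑' k, c k ≠ ∞ := tsum_ofReal_dyadic_ne_top hη
  refine ⟨C₀ * (∑' k, c k).toNNReal, fun ν ν' hν hle => ?_⟩
  choose! b hb hbν using fun a (ha : a ∈ unitDisc) => lintegral_kernel_le_tsum hη ha
  have hquot : ∀ a ∈ unitDisc, carlesonQuotient ν' a ≤
      C₀ * ∑' k, c k * carlesonQuotient ν (b a k) := by
    intro a ha
    have h1 : 0 < 1 - ‖a‖ := by linarith [mem_unitDisc.1 ha]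
    rw [carlesonQuotient]
    refine ENNReal.div_le_of_le_mul ((hle a ha).trans ?_)
    rw [mul_assoc]
    refine mul_le_mul_right ?_ _
    rw [mul_comm (∑' k, _)]
    exact hbν a ha ν hν
  have hsup : carlesonSup ν' ≤ (C₀ * (∑' k, c k).toNNReal : ℝ≥0) * carlesonSup ν := by
    refine iSup₂_le fun a ha => (hquot a ha).trans ?_
    rw [ENNReal.coe_mul, ENNReal.coe_toNNReal hcfin, mul_assoc, ← ENNReal.tsum_mul_right]
    refine mul_le_mul_right (ENNReal.tsum_le_tsum fun k => mul_le_mul_right ?_ _) _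
    exact carlesonQuotient_le_carlesonSup ν (hb a ha k).1
  refine ⟨hsup, fun hv => ⟨hsup.trans_lt (ENNReal.mul_lt_top ENNReal.coe_lt_top hv.1), ?_⟩⟩
  set S := carlesonSup ν with hS
  have hSfin : S ≠ ∞ := hv.1.ne
  have hmain : ∀ δ > 0, ∀ᶠ a in comap (fun a : ℂ => ‖a‖) (𝓝[<] (1 : ℝ)),
      carlesonQuotient ν' a ≤ C₀ * ((∑' k, c k) * δ + δ) := by
    intro δ hδ
    have hev := (ENNReal.tendsto_nhds_zero.1 hv.2) δ hδ
    rw [eventually_comap] at hev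
    obtain ⟨r, hr1, hr⟩ := (mem_nhdsLT_iff_exists_Ioo_subset' (zero_lt_one' ℝ)).1 hev
    have htail : Tendsto (fun i => (∑' k, c (k + i)) * S) atTop (𝓝 0) := by
      have := ENNReal.Tendsto.mul_const (b := S) (ENNReal.tendsto_sum_nat_add c hcfin)
        (Or.inr hSfin)
      simpa using this
    obtain ⟨N, hN⟩ := ((ENNReal.tendsto_nhds_zero.1 htail) δ hδ).exists
    rw [eventually_comap]
    have hr1' : r < 1 := hr1
    have hpos : 0 < (1 - r) / (16 * 2 ^ N) := div_pos (by linarith) (by positivity)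
    have hmem : Ioo (1 - (1 - r) / (16 * 2 ^ N)) 1 ∈ 𝓝[<] (1 : ℝ) :=
      Ioo_mem_nhdsLT (by linarith)
    filter_upwards [hmem] with x hx a hax
    have ha : a ∈ unitDisc := mem_unitDisc.2 (by rw [hax]; exact hx.2)
    refine (hquot a ha).trans (mul_le_mul_right ?_ _)
    rw [← Summable.sum_add_tsum_nat_add' (f := fun k => c k * carlesonQuotient ν (b a k)) (k := N)
      ENNReal.summable]
    refine add_le_add ?_ (le_trans ?_ hN)
    · refine le_trans ?_ (mul_le_mul_left (ENNReal.sum_le_tsum (Finset.range N)) _)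
      rw [Finset.sum_mul]
      refine Finset.sum_le_sum fun k hk => mul_le_mul_right ?_ _
      have hbk := hb a ha k
      suffices hlt : r < ‖b a k‖ from
        hr (show ‖b a k‖ ∈ Ioo r 1 from ⟨hlt, mem_unitDisc.1 hbk.1⟩) _ rfl
      have hkN : (2 : ℝ) ^ k ≤ 2 ^ N :=
        pow_le_pow_right₀ (by norm_num) (Finset.mem_range.1 hk).le
      have h5 : (1 - ‖a‖) * (16 * 2 ^ N) < 1 - r := by
        rw [← lt_div_iff₀ (by positivity), hax]
        linarith [hx.1]
      have h6 : 16 * 2 ^ k * (1 - ‖a‖) ≤ 16 * 2 ^ N * (1 - ‖a‖) := by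
        have : 0 ≤ 1 - ‖a‖ := by linarith [mem_unitDisc.1 ha]
        gcongr
      linarith [hbk.2]
    · rw [← ENNReal.tsum_mul_right]
      exact ENNReal.tsum_le_tsum fun k =>
        mul_le_mul_right (carlesonQuotient_le_carlesonSup ν (hb a ha _).1) _
  rw [ENNReal.tendsto_nhds_zero]
  intro ε hε
  have hlim : Tendsto (fun δ : ℝ≥0∞ => C₀ * ((∑' k, c k) * δ + δ)) (𝓝 0) (𝓝 0) := by
    have h1 : Tendsto (fun δ : ℝ≥0∞ => (∑' k, c k) * δ + δ) (𝓝 0) (𝓝 ((∑' k, c k) * 0 + 0)) :=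
      (ENNReal.Tendsto.const_mul tendsto_id (Or.inr hcfin)).add tendsto_id
    have h2 := ENNReal.Tendsto.const_mul (a := (C₀ : ℝ≥0∞)) h1 (Or.inr (by simp))
    simpa using h2
  have hex : ∃ δ > 0, C₀ * ((∑' k, c k) * δ + δ) ≤ ε := by
    have h1 := (ENNReal.tendsto_nhds_zero.1 hlim) ε hε
    obtain ⟨δ, hδ, h⟩ := ENNReal.nhds_zero_basis_Iic.mem_iff.1 h1
    exact ⟨δ, hδ, h (mem_Iic.2 le_rfl)⟩
  obtain ⟨δ, hδ, hδε⟩ := hex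
  exact (hmain δ hδ).mono fun a h => h.trans hδε

/-! ### Power series in the disc and radial weights -/

theorem summable_norm_mul_pow {f : ℂ → ℂ} {c : ℕ → ℂ}
    (hf : ∀ z ∈ unitDisc, HasSum (fun n => c n * z ^ n) (f z)) {r : ℝ} (hr0 : 0 ≤ r) (hr1 : r < 1) :
    Summable fun n => ‖c n‖ * r ^ n := by
  have h := (hf (r : ℂ) (by simpa [mem_unitDisc, abs_of_nonneg hr0] using hr1)).summable.norm
  simpa [abs_of_nonneg hr0] using h

theorem continuousOn_of_hasSum {f : ℂ → ℂ} {c : ℕ → ℂ}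
    (hf : ∀ z ∈ unitDisc, HasSum (fun n => c n * z ^ n) (f z)) : ContinuousOn f unitDisc := by
  intro z hz
  obtain ⟨r, hzr, hr1⟩ := exists_between (mem_unitDisc.1 hz)
  have hr0 : 0 ≤ r := (norm_nonneg z).trans hzr.le
  have hc : ContinuousOn (fun z => ∑' n, c n * z ^ n) (Metric.ball 0 r) := by
    refine continuousOn_tsum (fun n => by fun_prop) (summable_norm_mul_pow hf hr0 hr1) ?_
    intro n x hx
    rw [norm_mul, norm_pow]
    gcongr
    simpa using (mem_ball_zero_iff.1 hx).le
  have hmem : Metric.ball (0 : ℂ) r ∈ 𝓝 z := Metric.isOpen_ball.mem_nhds (by simpa using hzr)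
  refine ContinuousAt.continuousWithinAt ((hc.continuousAt hmem).congr ?_)
  filter_upwards [hmem] with x hx
  exact (hf x (mem_unitDisc.2 ((by simpa using hx : ‖x‖ < r).trans hr1))).tsum_eq

theorem integral_exp_int_mul_I {m : ℤ} :
    ∫ θ in Ioo (-Real.pi) Real.pi, Complex.exp (m * θ * Complex.I) =
      if m = 0 then 2 * (Real.pi : ℂ) else 0 := by
  rw [← integral_Ioc_eq_integral_Ioo, ← intervalIntegral.integral_of_le
      (by linarith [Real.pi_pos])]
  split_ifs with h
  · simp only [h, Int.cast_zero, zero_mul, Complex.exp_zero, intervalIntegral.integral_const,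
      Complex.real_smul, mul_one]
    push_cast
    ring
  · have hc : (m : ℂ) * Complex.I ≠ 0 := by simp [h]
    have e : ∀ θ : ℝ, Complex.exp (m * θ * Complex.I) = Complex.exp ((m * Complex.I) * θ) :=
      fun θ => by ring_nf
    simp_rw [e]
    rw [integral_exp_mul_complex hc, div_eq_zero_iff]
    left
    rw [sub_eq_zero, Complex.exp_eq_exp_iff_exists_int]
    refine ⟨m, ?_⟩
    push_cast
    ring

theorem integral_circle_mul_conj_pow {f : ℂ → ℂ} {c : ℕ → ℂ}
    (hf : ∀ z ∈ unitDisc, HasSum (fun n => c n * z ^ n) (f z)) {ρ : ℝ} (hρ : ρ ∈ Ioo (0 : ℝ) 1)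
    (N : ℕ) :
    ∫ θ in Ioo (-Real.pi) Real.pi,
      f (circleMap 0 ρ θ) * (starRingEnd ℂ) (circleMap 0 ρ θ) ^ N =
      2 * Real.pi * c N * ρ ^ (2 * N) := by
  set F : ℕ → ℝ → ℂ := fun n θ => c n * circleMap 0 ρ θ ^ n *
    (starRingEnd ℂ) (circleMap 0 ρ θ) ^ N with hF
  have hFn : ∀ n θ, ‖F n θ‖ = ‖c n‖ * ρ ^ n * ρ ^ N := fun n θ => by
    simp [hF, abs_of_pos hρ.1]
  have hFc : ∀ n, Continuous (F n) := fun n => by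
    have : Continuous fun θ => (starRingEnd ℂ) (circleMap 0 ρ θ) :=
      Complex.continuous_conj.comp (continuous_circleMap 0 ρ)
    fun_prop
  have hFi : ∀ n, Integrable (F n) (volume.restrict (Ioo (-Real.pi) Real.pi)) := fun n =>
    ((hFc n).integrableOn_Icc (a := -Real.pi) (b := Real.pi)).mono_set Ioo_subset_Icc_self
  have hsum := hasSum_integral_of_summable_integral_norm hFi (by
    simp_rw [hFn]
    simp only [integral_const, smul_eq_mul]
    exact ((summable_norm_mul_pow hf hρ.1.le hρ.2).mul_right _).mul_left _)
  have e1 : ∀ θ, ∑' n, F n θ = f (circleMap 0 ρ θ) *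
      (starRingEnd ℂ) (circleMap 0 ρ θ) ^ N := fun θ =>
    ((hf _ (mem_unitDisc.2 (by rw [norm_circleMap_of_mem hρ]; exact hρ.2))).mul_right _).tsum_eq
  simp_rw [e1] at hsum
  rw [← hsum.tsum_eq]
  have e2 : ∀ n, ∫ θ in Ioo (-Real.pi) Real.pi, F n θ =
      if n = N then 2 * Real.pi * c N * ρ ^ (2 * N) else 0 := by
    intro n
    have e3 : ∀ θ, F n θ = c n * ρ ^ (n + N) *
        Complex.exp (((n - N : ℤ) : ℂ) * θ * Complex.I) := fun θ => by
      simp only [hF, circleMap, zero_add, mul_pow, map_mul, Complex.conj_ofReal,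
        ← Complex.exp_conj, ← Complex.exp_nat_mul, Complex.conj_I]
      rw [show (((n - N : ℤ) : ℂ) * θ * Complex.I) =
        n * (θ * Complex.I) + N * (θ * -Complex.I) by push_cast; ring, Complex.exp_add]
      ring
    simp_rw [e3]
    rw [integral_const_mul, integral_exp_int_mul_I]
    by_cases h : n = N
    · subst h
      simp only [sub_self, if_true]
      ring
    · rw [if_neg (by omega), if_neg h, mul_zero]
  simp_rw [e2]
  rw [tsum_ite_eq N fun _ => 2 * Real.pi * c N * ρ ^ (2 * N)]

/-- Integrating a power series against an antiholomorphic monomial and a radial weight. -/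
theorem integral_mul_conj_pow_mul_radial {f : ℂ → ℂ} {c : ℕ → ℂ}
    (hf : ∀ z ∈ unitDisc, HasSum (fun n => c n * z ^ n) (f z)) {w : ℝ → ℝ}
    (hw : ContinuousOn w (Ioo 0 1)) (N : ℕ)
    (hinteg : Integrable (fun ζ => f ζ * (starRingEnd ℂ) ζ ^ N * (w ‖ζ‖ : ℂ)) discArea) :
    ∫ ζ, f ζ * (starRingEnd ℂ) ζ ^ N * (w ‖ζ‖ : ℂ) ∂discArea =
      c N * ((2 * ∫ ρ in Ioo (0 : ℝ) 1, ρ ^ (2 * N + 1) * w ρ : ℝ) : ℂ) := by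
  have hcont : ContinuousOn (fun ζ => f ζ * (starRingEnd ℂ) ζ ^ N * (w ‖ζ‖ : ℂ))
      (unitDisc \ {0}) := by
    refine (((continuousOn_of_hasSum hf).mono sdiff_subset).mul
      (Complex.continuous_conj.pow N).continuousOn).mul ?_
    refine Complex.continuous_ofReal.comp_continuousOn
      (hw.comp continuous_norm.continuousOn fun z hz => ?_)
    exact ⟨norm_pos_iff.2 hz.2, mem_unitDisc.1 hz.1⟩
  rw [integral_discArea_polar hcont hinteg]
  have e : ∀ ρ ∈ Ioo (0 : ℝ) 1, ((ρ / Real.pi : ℝ) : ℂ) * ∫ θ in Ioo (-Real.pi) Real.pi,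
      f (circleMap 0 ρ θ) * (starRingEnd ℂ) (circleMap 0 ρ θ) ^ N * (w ‖circleMap 0 ρ θ‖ : ℂ) =
      c N * ((2 * (ρ ^ (2 * N + 1) * w ρ) : ℝ) : ℂ) := by
    intro ρ hρ
    simp_rw [norm_circleMap_of_mem hρ]
    rw [integral_mul_const, integral_circle_mul_conj_pow hf hρ]
    have : (Real.pi : ℂ) ≠ 0 := by exact_mod_cast Real.pi_ne_zero
    push_cast
    field_simp
    ring
  rw [setIntegral_congr_fun measurableSet_Ioo e, integral_const_mul, integral_complex_ofReal,
    integral_const_mul]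

/-- A reproducing type formula: pairing a power series with the kernel `∑ k n (z * conj ζ) ^ n`. -/
theorem hasSum_integral_kernel {f : ℂ → ℂ} {c : ℕ → ℂ}
    (hf : ∀ z ∈ unitDisc, HasSum (fun n => c n * z ^ n) (f z)) {w : ℝ → ℝ}
    (hw : ContinuousOn w (Ioo 0 1)) (m : ℕ)
    (hinteg : Integrable (fun ζ => f ζ * (starRingEnd ℂ) ζ ^ m * (w ‖ζ‖ : ℂ)) discArea)
    {k : ℕ → ℝ} (hk : ∀ r, 0 ≤ r → r < 1 → Summable fun n => |k n| * r ^ n) {z : ℂ}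
    (hz : z ∈ unitDisc) :
    HasSum (fun n => k n * z ^ n *
        (c (n + m) * ((2 * ∫ ρ in Ioo (0 : ℝ) 1, ρ ^ (2 * (n + m) + 1) * w ρ : ℝ) : ℂ)))
      (∫ ζ, f ζ * (starRingEnd ℂ) ζ ^ m * (w ‖ζ‖ : ℂ) *
        ∑' n, (k n : ℂ) * (z * (starRingEnd ℂ) ζ) ^ n ∂discArea) := by
  set B : ℂ → ℂ := fun ζ => f ζ * (starRingEnd ℂ) ζ ^ m * (w ‖ζ‖ : ℂ) with hB
  have hD : ∀ᵐ ζ ∂discArea, ζ ∈ unitDisc := ae_discArea_mem_unitDisc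
  have hpow : ∀ n : ℕ, ∀ᵐ ζ ∂discArea, ‖(starRingEnd ℂ) ζ ^ n‖ ≤ 1 := fun n => by
    filter_upwards [hD] with ζ hζ
    rw [norm_pow, RCLike.norm_conj]
    exact pow_le_one₀ (norm_nonneg _) (mem_unitDisc.1 hζ).le
  have hcm : ∀ n : ℕ, AEStronglyMeasurable (fun ζ : ℂ => (starRingEnd ℂ) ζ ^ n) discArea :=
    fun n => (Complex.continuous_conj.pow n).aestronglyMeasurable
  have hBi : ∀ n : ℕ, Integrable (fun ζ => B ζ * (starRingEnd ℂ) ζ ^ n) discArea := fun n =>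
    hinteg.mul_bdd (c := 1) (hcm n) (hpow n)
  set F : ℕ → ℂ → ℂ := fun n ζ => k n * z ^ n * (B ζ * (starRingEnd ℂ) ζ ^ n) with hF
  have hFi : ∀ n, Integrable (F n) discArea := fun n => (hBi n).const_mul _
  have hFs : Summable fun n => ∫ ζ, ‖F n ζ‖ ∂discArea := by
    refine Summable.of_nonneg_of_le (fun n => integral_nonneg fun ζ => norm_nonneg _) (fun n => ?_)
      ((hk ‖z‖ (norm_nonneg z) (mem_unitDisc.1 hz)).mul_right (∫ ζ, ‖B ζ‖ ∂discArea))
    rw [← integral_const_mul]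
    refine integral_mono_ae (hFi n).norm (hinteg.norm.const_mul _) ?_
    filter_upwards [hpow n] with ζ hζ
    simp only [hF, norm_mul, norm_pow, Complex.norm_real, Real.norm_eq_abs]
    rw [norm_pow] at hζ
    have h1 : ‖B ζ‖ * ‖(starRingEnd ℂ) ζ‖ ^ n ≤ ‖B ζ‖ := mul_le_of_le_one_right (norm_nonneg _) hζ
    gcongr
  have hmain := hasSum_integral_of_summable_integral_norm hFi hFs
  have e1 : ∀ ζ, ∑' n, F n ζ = B ζ * ∑' n, (k n : ℂ) * (z * (starRingEnd ℂ) ζ) ^ n := fun ζ => by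
    rw [← tsum_mul_left]
    refine tsum_congr fun n => ?_
    simp only [hF, mul_pow]
    ring
  simp_rw [e1] at hmain
  refine (funext fun n => ?_ : (fun n => (k n : ℂ) * z ^ n * (c (n + m) *
    ((2 * ∫ ρ in Ioo (0 : ℝ) 1, ρ ^ (2 * (n + m) + 1) * w ρ : ℝ) : ℂ))) =
      fun n => ∫ ζ, F n ζ ∂discArea) ▸ hmain
  simp only [hF]
  rw [integral_const_mul]
  congr 1
  have e2 : ∀ ζ, B ζ * (starRingEnd ℂ) ζ ^ n =
      f ζ * (starRingEnd ℂ) ζ ^ (n + m) * (w ‖ζ‖ : ℂ) := fun ζ => by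
    simp only [hB]
    ring
  have h3 := hBi n
  simp_rw [e2] at h3 ⊢
  exact (integral_mul_conj_pow_mul_radial hf hw (n + m) h3).symm

/-- Two summations by parts. -/
theorem norm_tsum_mul_pow_le_of_second_differences {b B : ℕ → ℝ} {w : ℂ} (hw : ‖w‖ < 1)
    (hb : Summable fun n => |b n| * ‖w‖ ^ n) (h0 : |b 0| ≤ B 0) (h1 : |b 1 - 2 * b 0| ≤ B 1)
    (h2 : ∀ n, |b (n + 2) - 2 * b (n + 1) + b n| ≤ B (n + 2))
    (hB : Summable fun n => B n * ‖w‖ ^ n) :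
    ‖∑' n, (b n : ℂ) * w ^ n‖ ≤ (∑' n, B n * ‖w‖ ^ n) / ‖1 - w‖ ^ 2 := by
  have hw1 : 0 < ‖1 - w‖ := by
    have := norm_sub_norm_le (1 : ℂ) w
    rw [norm_one] at this
    linarith
  have hs : Summable fun n => (b n : ℂ) * w ^ n := by
    refine Summable.of_norm ?_
    simpa using hb
  have hs1 := (summable_nat_add_iff 1).2 hs
  have hs2 := (summable_nat_add_iff 2).2 hs
  set S := ∑' n, (b n : ℂ) * w ^ n with hS
  have eS2 : S = b 0 + b 1 * w + ∑' n, (b (n + 2) : ℂ) * w ^ (n + 2) := by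
    rw [hS, ← hs.sum_add_tsum_nat_add 2]
    simp [Finset.sum_range_succ]
  have eS1 : S = b 0 + ∑' n, (b (n + 1) : ℂ) * w ^ (n + 1) := by
    rw [hS, ← hs.sum_add_tsum_nat_add 1]
    simp
  have hmain : (1 - w) ^ 2 * S = b 0 + (b 1 - 2 * b 0) * w +
      ∑' n, ((b (n + 2) - 2 * b (n + 1) + b n : ℝ) : ℂ) * w ^ (n + 2) := by
    have e : ∀ n, ((b (n + 2) - 2 * b (n + 1) + b n : ℝ) : ℂ) * w ^ (n + 2) =
        (b (n + 2) : ℂ) * w ^ (n + 2) - 2 * w * ((b (n + 1) : ℂ) * w ^ (n + 1)) +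
          w ^ 2 * ((b n : ℂ) * w ^ n) := fun n => by
      push_cast
      ring
    simp_rw [e]
    rw [Summable.tsum_add (hs2.sub (hs1.mul_left _)) (hs.mul_left _),
      Summable.tsum_sub hs2 (hs1.mul_left _), tsum_mul_left, tsum_mul_left, ← hS]
    linear_combination eS2 - 2 * w * eS1
  have hB2 := (summable_nat_add_iff 2).2 hB
  have htail : ‖∑' n, ((b (n + 2) - 2 * b (n + 1) + b n : ℝ) : ℂ) * w ^ (n + 2)‖ ≤
      ∑' n, B (n + 2) * ‖w‖ ^ (n + 2) := by
    refine tsum_of_norm_bounded hB2.hasSum fun n => ?_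
    rw [norm_mul, norm_pow, Complex.norm_real, Real.norm_eq_abs]
    gcongr
    exact h2 n
  rw [le_div_iff₀ (by positivity), mul_comm, ← norm_pow, ← norm_mul, hmain,
    ← hB.sum_add_tsum_nat_add 2]
  refine (norm_add_le _ _).trans (add_le_add ?_ htail)
  simp only [Finset.sum_range_succ, Finset.range_zero, Finset.sum_empty, pow_zero, pow_one,
    mul_one, zero_add]
  refine (norm_add_le _ _).trans (add_le_add ?_ ?_)
  · rw [Complex.norm_real, Real.norm_eq_abs]
    exact h0
  · rw [norm_mul, show ((b 1 : ℂ) - 2 * b 0) = ((b 1 - 2 * b 0 : ℝ) : ℂ) by push_cast; ring,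
      Complex.norm_real, Real.norm_eq_abs]
    gcongr

/-! ### Tails and moments of radial weights -/

namespace IsRadialWeight

variable {μ : ℝ → ℝ}

theorem integrableOn_Ico (hμ : IsRadialWeight μ) {r : ℝ} (hr : 0 ≤ r) :
    IntegrableOn μ (Ico r 1) :=
  hμ.integrable.mono_set (Ico_subset_Ico_left hr)

theorem tail_nonneg (hμ : IsRadialWeight μ) {r : ℝ} (hr : 0 ≤ r) : 0 ≤ weightTail μ r :=
  setIntegral_nonneg measurableSet_Ico fun s hs => hμ.nonneg s ⟨hr.trans hs.1, hs.2⟩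

theorem tail_anti (hμ : IsRadialWeight μ) {r s : ℝ} (hr : 0 ≤ r) (hrs : r ≤ s) :
    weightTail μ s ≤ weightTail μ r := by
  refine setIntegral_mono_set (hμ.integrableOn_Ico hr) ?_ (Ico_subset_Ico_left hrs).eventuallyLE
  filter_upwards [ae_restrict_mem measurableSet_Ico] with x hx
  exact hμ.nonneg x ⟨hr.trans hx.1, hx.2⟩

theorem tail_pos' (hμ : IsRadialWeight μ) {r : ℝ} (hr : r ∈ Ico (0 : ℝ) 1) :
    0 < weightTail μ r := by
  have h1 : (1 + r) / 2 ∈ Ioo (0 : ℝ) 1 := ⟨by linarith [hr.1], by linarith [hr.2]⟩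
  exact (hμ.tail_pos _ h1).trans_le (hμ.tail_anti hr.1 (by linarith [hr.2]))

theorem continuousOn_tail (hμ : IsRadialWeight μ) : ContinuousOn (weightTail μ) (Icc 0 1) := by
  have h1 : ∀ r ∈ Icc (0 : ℝ) 1, weightTail μ r = (∫ s in (0 : ℝ)..1, μ s) - ∫ s in (0 : ℝ)..r, μ s := by
    intro r hr
    have hi : IntervalIntegrable μ volume 0 1 := by
      rw [intervalIntegrable_iff_integrableOn_Ico_of_le zero_le_one]
      exact hμ.integrable
    rw [intervalIntegral.integral_interval_sub_left hi
      (hi.mono_set (by rw [uIcc_of_le hr.1, uIcc_of_le zero_le_one]; exact Icc_subset_Icc_right hr.2)),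
      intervalIntegral.integral_of_le hr.2, weightTail, integral_Ico_eq_integral_Ioo,
      integral_Ioc_eq_integral_Ioo]
  refine ContinuousOn.congr ?_ h1
  refine continuousOn_const.sub ?_
  have := intervalIntegral.continuousOn_primitive_interval (f := μ) (μ := volume) (a := 0) (b := 1) (by
    rw [uIcc_of_le zero_le_one, integrableOn_Icc_iff_integrableOn_Ico]
    exact hμ.integrable)
  rwa [uIcc_of_le zero_le_one] at this

theorem integrableOn_pow_mul (hμ : IsRadialWeight μ) (k : ℕ) :
    IntegrableOn (fun s => s ^ k * μ s) (Ico 0 1) := by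
  refine Integrable.bdd_mul (c := 1) hμ.integrable (by fun_prop) ?_
  filter_upwards [ae_restrict_mem measurableSet_Ico] with s hs
  rw [norm_pow, Real.norm_of_nonneg hs.1]
  exact pow_le_one₀ hs.1 hs.2.le

theorem pow_mul_tail_le_moment (hμ : IsRadialWeight μ) {ρ : ℝ} (hρ : 0 ≤ ρ) (k : ℕ) :
    ρ ^ k * weightTail μ ρ ≤ weightMoment μ k := by
  calc ρ ^ k * weightTail μ ρ = ∫ s in Ico ρ 1, ρ ^ k * μ s := (integral_const_mul _ _).symm
    _ ≤ ∫ s in Ico ρ 1, s ^ k * μ s := by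
        refine setIntegral_mono_on ((hμ.integrableOn_Ico hρ).const_mul _)
          ((hμ.integrableOn_pow_mul k).mono_set (Ico_subset_Ico_left hρ)) measurableSet_Ico ?_
        intro s hs
        have := hμ.nonneg s ⟨hρ.trans hs.1, hs.2⟩
        have h1 := hs.1
        gcongr
    _ ≤ _ := by
        refine setIntegral_mono_set (hμ.integrableOn_pow_mul k) ?_
          (Ico_subset_Ico_left hρ).eventuallyLE
        filter_upwards [ae_restrict_mem measurableSet_Ico] with x hx
        exact mul_nonneg (pow_nonneg hx.1 _) (hμ.nonneg x hx)

theorem moment_pos (hμ : IsRadialWeight μ) (k : ℕ) : 0 < weightMoment μ k := by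
  have h1 : (1 / 2 : ℝ) ∈ Ioo (0 : ℝ) 1 := ⟨by norm_num, by norm_num⟩
  exact (mul_pos (by positivity) (hμ.tail_pos _ h1)).trans_le
    (hμ.pow_mul_tail_le_moment (ρ := 1 / 2) (by norm_num) k)

theorem moment_anti (hμ : IsRadialWeight μ) {j k : ℕ} (hjk : j ≤ k) :
    weightMoment μ k ≤ weightMoment μ j := by
  refine setIntegral_mono_on (hμ.integrableOn_pow_mul k) (hμ.integrableOn_pow_mul j)
    measurableSet_Ico fun s hs => ?_
  have := hμ.nonneg s hs
  exact mul_le_mul_of_nonneg_right (pow_le_pow_of_le_one hs.1 hs.2.le hjk) this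

/-- The moments in terms of the tail integrals. -/
theorem moment_succ (hμ : IsRadialWeight μ) (k : ℕ) :
    weightMoment μ (k + 1) = (k + 1) * ∫ u in Ioo (0 : ℝ) 1, u ^ k * weightTail μ u := by
  set P : ℝ × ℝ → ℝ := fun p => {p : ℝ × ℝ | p.2 ≤ p.1}.indicator
    (fun p => (k + 1) * p.2 ^ k * μ p.1) p with hP
  have hE : MeasurableSet {p : ℝ × ℝ | p.2 ≤ p.1} := measurableSet_le measurable_snd measurable_fst
  have hμ' : Integrable μ (volume.restrict (Ioo 0 1)) := hμ.integrable.mono_set Ioo_subset_Ico_self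
  have hPi : Integrable P ((volume.restrict (Ioo 0 1)).prod (volume.restrict (Ioo 0 1))) := by
    refine Integrable.indicator ?_ hE
    have h1 : Integrable (fun u : ℝ => ((k : ℝ) + 1) * u ^ k) (volume.restrict (Ioo 0 1)) :=
      ((by fun_prop : Continuous fun u : ℝ => ((k : ℝ) + 1) * u ^ k).integrableOn_Icc
        (a := 0) (b := 1)).mono_set Ioo_subset_Icc_self
    refine (hμ'.mul_prod h1).congr (ae_of_all _ fun p => ?_)
    simp only
    ring
  have hswap := integral_integral_swap (f := fun s u => P (s, u)) hPi
  have hL : ∫ s in Ioo (0 : ℝ) 1, ∫ u in Ioo (0 : ℝ) 1, P (s, u) = weightMoment μ (k + 1) := by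
    rw [weightMoment, integral_Ico_eq_integral_Ioo]
    refine setIntegral_congr_fun measurableSet_Ioo fun s hs => ?_
    have e1 : ∀ u, P (s, u) = (Iic s).indicator (fun u => (k + 1) * u ^ k * μ s) u := fun u => by
      by_cases h : u ≤ s
      · simp [hP, indicator, h]
      · simp [hP, indicator, h]
    simp_rw [e1]
    rw [integral_indicator measurableSet_Iic, Measure.restrict_restrict measurableSet_Iic,
      show Iic s ∩ Ioo (0 : ℝ) 1 = Ioc 0 s by
        ext x
        simp only [mem_inter_iff, mem_Iic, mem_Ioo, mem_Ioc]
        exact ⟨fun h => ⟨h.2.1, h.1⟩, fun h => ⟨h.2, h.1, h.2.trans_lt hs.2⟩⟩,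
      integral_mul_const, integral_const_mul, ← intervalIntegral.integral_of_le hs.1.le,
      integral_pow]
    have : (k : ℝ) + 1 ≠ 0 := by positivity
    field_simp
    simp
  have hR : ∫ u in Ioo (0 : ℝ) 1, ∫ s in Ioo (0 : ℝ) 1, P (s, u) =
      (k + 1) * ∫ u in Ioo (0 : ℝ) 1, u ^ k * weightTail μ u := by
    rw [← integral_const_mul]
    refine setIntegral_congr_fun measurableSet_Ioo fun u hu => ?_
    have e1 : ∀ s, P (s, u) = (Ici u).indicator (fun s => (k + 1) * u ^ k * μ s) s := fun s => by
      by_cases h : u ≤ s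
      · simp [hP, indicator, h]
      · simp [hP, indicator, h]
    simp_rw [e1]
    rw [integral_indicator measurableSet_Ici, Measure.restrict_restrict measurableSet_Ici,
      show Ici u ∩ Ioo (0 : ℝ) 1 = Ico u 1 by
        ext x
        simp only [mem_inter_iff, mem_Ici, mem_Ioo, mem_Ico]
        exact ⟨fun h => ⟨h.1, h.2.2⟩, fun h => ⟨h.1, hu.1.trans_le h.1, h.2⟩⟩,
      integral_const_mul, weightTail]
    ring
  rw [← hL, hswap, hR]

end IsRadialWeight

/-! ### Taylor coefficients and the fractional derivative -/

theorem hasSum_taylorCoeff {g : ℂ → ℂ} (hg : IsAnalyticOnDisc g) {z : ℂ} (hz : z ∈ unitDisc) :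
    HasSum (fun n => taylorCoeff g n * z ^ n) (g z) := by
  have h := Complex.hasSum_taylorSeries_on_ball (c := 0) (r := 1) hg hz
  have e : (fun n => taylorCoeff g n * z ^ n) =
      fun n => ((n.factorial : ℂ))⁻¹ • (z - 0) ^ n • iteratedDeriv n g 0 := by
    funext n
    simp only [taylorCoeff, sub_zero, smul_eq_mul]
    ring
  rwa [e]

theorem taylorCoeff_deriv (g : ℂ → ℂ) (n : ℕ) :
    taylorCoeff (deriv g) n = (n + 1) * taylorCoeff g (n + 1) := by
  rw [taylorCoeff, taylorCoeff, iteratedDeriv_succ', Nat.factorial_succ]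
  have : (n.factorial : ℂ) ≠ 0 := by exact_mod_cast n.factorial_ne_zero
  have h2 : (n : ℂ) + 1 ≠ 0 := by exact_mod_cast n.succ_ne_zero
  push_cast
  field_simp

theorem taylorCoeff_zero (g : ℂ → ℂ) : taylorCoeff g 0 = g 0 := by simp [taylorCoeff]

theorem isAnalyticOnDisc_deriv {g : ℂ → ℂ} (hg : IsAnalyticOnDisc g) :
    IsAnalyticOnDisc (deriv g) :=
  DifferentiableOn.deriv hg Metric.isOpen_ball

theorem inv_moment_mul_pow_le {μ : ℝ → ℝ} (hμ : IsRadialWeight μ) {r : ℝ} (hr0 : 0 ≤ r)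
    (hr1 : r < 1) (n : ℕ) :
    r ^ n / weightMoment μ (2 * (n + 1) + 1) ≤
      4 / weightTail μ ((3 + r) / 4) * (1 - (1 - r) / 2) ^ n := by
  set ρ := (3 + r) / 4 with hρ
  have hρ1 : ρ ∈ Ico (0 : ℝ) 1 := ⟨by positivity, by rw [hρ]; linarith⟩
  have ht := hμ.tail_pos' hρ1
  have hm := hμ.pow_mul_tail_le_moment hρ1.1 (2 * (n + 1) + 1)
  have hρ0 : 0 < ρ := by positivity
  have h1 : r ≤ ρ ^ 2 * (1 - (1 - r) / 2) := by
    rw [hρ]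
    nlinarith [mul_nonneg hr0 hr0, mul_nonneg hr0 (sub_nonneg.2 hr1.le),
      mul_nonneg (mul_nonneg hr0 hr0) (sub_nonneg.2 hr1.le), sq_nonneg (1 - r)]
  have h2 : r ^ n ≤ (ρ ^ 2) ^ n * (1 - (1 - r) / 2) ^ n := by
    rw [← mul_pow]
    exact pow_le_pow_left₀ hr0 h1 n
  have hx : 0 ≤ (1 - (1 - r) / 2) ^ n := pow_nonneg (by linarith) n
  have h34 : (3 / 4 : ℝ) ^ 3 ≤ ρ ^ 3 := pow_le_pow_left₀ (by norm_num) (by rw [hρ]; linarith) 3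
  rw [div_le_iff₀ (hμ.moment_pos _)]
  calc r ^ n ≤ (ρ ^ 2) ^ n * (1 - (1 - r) / 2) ^ n := h2
    _ ≤ (ρ ^ 2) ^ n * (1 - (1 - r) / 2) ^ n * (4 * ρ ^ 3) :=
        le_mul_of_one_le_right (by positivity) (by linarith)
    _ = 4 / weightTail μ ρ * (1 - (1 - r) / 2) ^ n *
          (ρ ^ (2 * (n + 1) + 1) * weightTail μ ρ) := by
        rw [show 2 * (n + 1) + 1 = 2 * n + 3 by ring, pow_add, pow_mul ρ]
        field_simp
    _ ≤ _ := by gcongr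

theorem hasSum_fracDeriv {μ : ℝ → ℝ} (hμ : IsRadialWeight μ) {g : ℂ → ℂ}
    (hg : IsAnalyticOnDisc g) {z : ℂ} (hz : z ∈ unitDisc) :
    HasSum (fun n => taylorCoeff g n / (weightMoment μ (2 * n + 1) : ℂ) * z ^ n)
      (fracDeriv μ g z) := by
  refine Summable.hasSum (Summable.of_norm ?_)
  have hz1 := mem_unitDisc.1 hz
  have hz0 := norm_nonneg z
  have hs := (summable_norm_mul_pow (fun z hz => hasSum_taylorCoeff hg hz)
    (r := 1 - (1 - ‖z‖) / 2) (by linarith) (by linarith)).mul_left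
      (4 / weightTail μ ((3 + ‖z‖) / 4))
  refine Summable.of_nonneg_of_le (fun n => norm_nonneg _) (fun n => ?_) hs
  rw [norm_mul, norm_div, norm_pow, Complex.norm_real, Real.norm_of_nonneg (hμ.moment_pos _).le,
    div_mul_eq_mul_div, mul_div_assoc, mul_left_comm]
  refine mul_le_mul_of_nonneg_left (le_trans ?_ (inv_moment_mul_pow_le hμ hz0 hz1 n))
    (norm_nonneg _)
  have := hμ.moment_pos (2 * (n + 1) + 1)
  have := hμ.moment_anti (show 2 * n + 1 ≤ 2 * (n + 1) + 1 by omega)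
  gcongr

theorem fracDeriv_zero (μ : ℝ → ℝ) (g : ℂ → ℂ) :
    fracDeriv μ g 0 = g 0 / (weightMoment μ 1 : ℂ) := by
  rw [fracDeriv, tsum_eq_single 0 fun n hn => by simp [hn], taylorCoeff_zero]
  simp

/-! ### Domination of the `BMOA` norm for every radial weight -/

theorem discArea_univ : discArea univ = 1 := by
  rw [discArea, Measure.smul_apply, Measure.restrict_apply_univ, unitDisc, Complex.volume_ball,
    smul_eq_mul]
  simp only [ENNReal.ofReal_one, one_pow, one_mul]
  rw [show (NNReal.pi : ℝ≥0∞) = ENNReal.ofReal Real.pi by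
    rw [← NNReal.coe_real_pi, ENNReal.ofReal_coe_nnreal]]
  exact ENNReal.inv_mul_cancel (by simp [Real.pi_pos]) (by simp)

theorem withDensity_discArea_compl (u : ℂ → ℝ≥0∞) : discArea.withDensity u unitDiscᶜ = 0 := by
  refine withDensity_absolutelyContinuous _ _ ?_
  have := ae_discArea_mem_unitDisc
  rwa [ae_iff] at this

theorem measure_univ_le_carlesonSup {ν : Measure ℂ} (hν : ν unitDiscᶜ = 0) :
    ν univ ≤ carlesonSup ν := by
  have h0 : (0 : ℂ) ∈ unitDisc := by simp [mem_unitDisc]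
  have h1 := measure_le_carlesonQuotient ν h0
  rw [norm_zero, sub_zero, ENNReal.ofReal_one, mul_one, carlesonSquare_zero] at h1
  calc ν univ ≤ ν unitDisc + ν unitDiscᶜ := by
        rw [← union_compl_self unitDisc]
        exact measure_union_le _ _
    _ = carlesonQuotient ν 0 := by rw [hν, add_zero, h1]
    _ ≤ _ := carlesonQuotient_le_carlesonSup ν h0

theorem sq_lintegral_le_withDensity_univ {F : ℂ → ℝ≥0∞} (hF : AEMeasurable F discArea) :
    (∫⁻ ζ, F ζ ∂discArea) ^ 2 ≤
      discArea.withDensity (fun ζ => F ζ ^ 2 * ENNReal.ofReal (1 / (1 - ‖ζ‖))) univ := by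
  have hm1 : Measurable fun ζ : ℂ => ENNReal.ofReal (1 / (1 - ‖ζ‖)) := by fun_prop
  have hm2 : Measurable fun ζ : ℂ => ENNReal.ofReal (1 - ‖ζ‖) := by fun_prop
  have hCS := sq_lintegral_mul_le discArea (hF.mul hm1.aemeasurable) hm2.aemeasurable
  have hmul : ∀ᵐ ζ ∂discArea, ENNReal.ofReal (1 / (1 - ‖ζ‖)) * ENNReal.ofReal (1 - ‖ζ‖) = 1 := by
    filter_upwards [ae_discArea_mem_unitDisc] with ζ hζ
    have h1 : 0 < 1 - ‖ζ‖ := by linarith [mem_unitDisc.1 hζ]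
    rw [← ENNReal.ofReal_mul (by positivity), one_div_mul_cancel h1.ne', ENNReal.ofReal_one]
  have e1 : ∫⁻ ζ, F ζ ∂discArea = ∫⁻ ζ, (F * fun ζ : ℂ => ENNReal.ofReal (1 / (1 - ‖ζ‖))) ζ *
      ENNReal.ofReal (1 - ‖ζ‖) ∂discArea := by
    refine lintegral_congr_ae ?_
    filter_upwards [hmul] with ζ hζ
    rw [Pi.mul_apply, mul_assoc, hζ, mul_one]
  rw [e1]
  refine hCS.trans ?_
  rw [withDensity_apply _ MeasurableSet.univ, Measure.restrict_univ]
  have e2 : ∫⁻ ζ, (F * fun ζ : ℂ => ENNReal.ofReal (1 / (1 - ‖ζ‖))) ζ ^ 2 *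
      ENNReal.ofReal (1 - ‖ζ‖) ∂discArea =
      ∫⁻ ζ, F ζ ^ 2 * ENNReal.ofReal (1 / (1 - ‖ζ‖)) ∂discArea := by
    refine lintegral_congr_ae ?_
    filter_upwards [hmul] with ζ hζ
    rw [Pi.mul_apply, mul_pow, sq (ENNReal.ofReal _), mul_assoc, mul_assoc, hζ, mul_one]
  have e3 : ∫⁻ ζ : ℂ, ENNReal.ofReal (1 - ‖ζ‖) ∂discArea ≤ 1 := by
    calc _ ≤ ∫⁻ _ : ℂ, 1 ∂discArea := lintegral_mono fun ζ => by
          rw [← ENNReal.ofReal_one]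
          exact ENNReal.ofReal_le_ofReal (by linarith [norm_nonneg ζ])
      _ = 1 := by rw [lintegral_one, discArea_univ]
  rw [e2]
  exact mul_le_of_le_one_right zero_le e3

theorem carleson_of_le_integralOperator {η : ℝ} (hη0 : 0 < η) (hη1 : η < 1) (A A' : ℝ≥0) :
    ∃ C : ℝ≥0, ∀ (F H : ℂ → ℝ≥0∞) (ν' : Measure ℂ), AEMeasurable F discArea →
      (∀ z ∈ unitDisc, H z ≤ A * (ENNReal.ofReal ((1 - ‖z‖) ^ η) * ∫⁻ ζ, F ζ *
        ENNReal.ofReal ((1 - ‖ζ‖) ^ (-η) / ‖1 - z * (starRingEnd ℂ) ζ‖ ^ 2) ∂discArea)) →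
      (∀ a ∈ unitDisc, ν' (carlesonSquare a) ≤
        A' * ∫⁻ z in carlesonSquare a, H z ^ 2 * ENNReal.ofReal (1 / (1 - ‖z‖)) ∂discArea) →
      carlesonSup ν' ≤ C * carlesonSup
        (discArea.withDensity fun ζ => F ζ ^ 2 * ENNReal.ofReal (1 / (1 - ‖ζ‖))) ∧
      (IsVanishingCarleson
        (discArea.withDensity fun ζ => F ζ ^ 2 * ENNReal.ofReal (1 / (1 - ‖ζ‖))) →
        IsVanishingCarleson ν') := by
  obtain ⟨C₁, hC₁⟩ := lintegral_carlesonSquare_le_of_le_integralOperator hη0 hη1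
  obtain ⟨C, hC⟩ := carleson_of_le_lintegral_kernel hη0 (A' * (C₁ * A ^ 2))
  refine ⟨C, fun F H ν' hF hH hν' => hC _ _ (withDensity_discArea_compl _) fun a ha => ?_⟩
  have h1 := hC₁ (fun ζ => A * F ζ) H (hF.const_mul _) (fun z hz => (hH z hz).trans_eq (by
    rw [mul_left_comm, ← lintegral_const_mul' _ _ (by simp)]
    simp only [mul_assoc])) a ha
  refine (hν' a ha).trans ?_
  rw [ENNReal.coe_mul, mul_assoc]
  refine mul_le_mul_right (h1.trans_eq ?_) _
  have hm : AEMeasurable (fun ζ => F ζ ^ 2 * ENNReal.ofReal (1 / (1 - ‖ζ‖))) discArea :=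
    (hF.pow_const 2).mul (by fun_prop : Measurable fun ζ : ℂ =>
      ENNReal.ofReal (1 / (1 - ‖ζ‖))).aemeasurable
  have hconj : Measurable (fun ζ : ℂ => (starRingEnd ℂ) ζ) := Complex.continuous_conj.measurable
  rw [lintegral_withDensity_eq_lintegral_mul₀ hm (by fun_prop), ENNReal.coe_mul, mul_assoc,
    ← lintegral_const_mul' ((A ^ 2 : ℝ≥0) : ℝ≥0∞) _ ENNReal.coe_ne_top]
  congr 1
  refine lintegral_congr fun ζ => ?_
  simp only [Pi.mul_apply]
  push_cast
  ring

theorem div_rpow_le_rpow_mul_rpow_neg {x y v η : ℝ} (hx : 0 < x) (hy : 0 < y) (hyv : y ≤ v)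
    (hη : 0 < η) : (x / v) ^ η ≤ x ^ η * y ^ (-η) := by
  rw [Real.div_rpow hx.le (hy.le.trans hyv), Real.rpow_neg hy.le, ← div_eq_mul_inv]
  have h1 : 0 < y ^ η := Real.rpow_pos_of_pos hy _
  have h2 : 0 < x ^ η := Real.rpow_pos_of_pos hx _
  gcongr

theorem norm_mul_conj_lt {z ζ : ℂ} (hz : z ∈ unitDisc) (hζ : ζ ∈ unitDisc) :
    ‖z * (starRingEnd ℂ) ζ‖ < 1 := by
  rw [norm_mul, RCLike.norm_conj]
  exact mul_lt_one_of_nonneg_of_lt_one_left (norm_nonneg _) (mem_unitDisc.1 hz)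
    (mem_unitDisc.1 hζ).le

theorem norm_mul_conj_le_left {z ζ : ℂ} (hζ : ζ ∈ unitDisc) :
    ‖z * (starRingEnd ℂ) ζ‖ ≤ ‖z‖ := by
  rw [norm_mul, RCLike.norm_conj]
  exact mul_le_of_le_one_right (norm_nonneg _) (mem_unitDisc.1 hζ).le

theorem norm_mul_conj_le_right {z ζ : ℂ} (hz : z ∈ unitDisc) :
    ‖z * (starRingEnd ℂ) ζ‖ ≤ ‖ζ‖ := by
  rw [norm_mul, RCLike.norm_conj]
  exact mul_le_of_le_one_left (norm_nonneg _) (mem_unitDisc.1 hz).le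

theorem summable_quadratic_mul_pow {r : ℝ} (hr0 : 0 ≤ r) (hr1 : r < 1) :
    Summable fun n : ℕ => |((n : ℝ) + 1) * (2 * n + 3)| * r ^ n := by
  have hr : ‖r‖ < 1 := by rwa [Real.norm_of_nonneg hr0]
  have h2 := (summable_pow_mul_geometric_of_norm_lt_one 2 hr).mul_left 2
  have h1 := (summable_pow_mul_geometric_of_norm_lt_one 1 hr).mul_left 5
  have h0 := (summable_pow_mul_geometric_of_norm_lt_one 0 hr).mul_left 3
  refine ((h2.add h1).add h0).congr fun n => ?_
  rw [abs_of_nonneg (by positivity)]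
  ring

theorem norm_tsum_quadratic_le {w : ℂ} (hw : ‖w‖ < 1) :
    ‖∑' n : ℕ, (((n + 1) * (2 * n + 3) : ℝ) : ℂ) * w ^ n‖ ≤ 4 / (1 - ‖w‖) / ‖1 - w‖ ^ 2 := by
  have h := norm_tsum_mul_pow_le_of_second_differences
    (b := fun n : ℕ => ((n : ℝ) + 1) * (2 * n + 3)) (B := fun _ => 4) hw
    (summable_quadratic_mul_pow (norm_nonneg w) hw) (by norm_num) (by norm_num)
    (fun n => by
      refine le_of_eq ?_
      push_cast
      rw [show ((n : ℝ) + 2 + 1) * (2 * (n + 2) + 3) - 2 * ((n + 1 + 1) * (2 * (n + 1) + 3)) +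
        (n + 1) * (2 * n + 3) = 4 by ring]
      norm_num)
    ((summable_geometric_of_lt_one (norm_nonneg w) hw).mul_left 4)
  rwa [tsum_mul_left, tsum_geometric_of_lt_one (norm_nonneg w) hw, ← div_eq_mul_inv] at h

theorem continuousOn_tail_norm {μ : ℝ → ℝ} (hμ : IsRadialWeight μ) :
    ContinuousOn (fun z : ℂ => weightTail μ ‖z‖) unitDisc :=
  hμ.continuousOn_tail.comp continuous_norm.continuousOn fun z hz =>
    ⟨norm_nonneg z, (mem_unitDisc.1 hz).le⟩

theorem continuousOn_fracDeriv {μ : ℝ → ℝ} (hμ : IsRadialWeight μ) {g : ℂ → ℂ}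
    (hg : IsAnalyticOnDisc g) : ContinuousOn (fracDeriv μ g) unitDisc :=
  continuousOn_of_hasSum fun _ hz => hasSum_fracDeriv hμ hg hz

theorem aemeasurable_discArea_of_continuousOn {β : Type*} [TopologicalSpace β]
    [MeasurableSpace β] [BorelSpace β] {u : ℂ → β} (hu : ContinuousOn u unitDisc) :
    AEMeasurable u discArea :=
  (hu.aemeasurable measurableSet_unitDisc).mono_ac
    (Measure.smul_absolutelyContinuous)

theorem bmoaWeightMeasure_eq {μ : ℝ → ℝ} (hμ : IsRadialWeight μ) (g : ℂ → ℂ) :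
    bmoaWeightMeasure μ g = discArea.withDensity fun ζ =>
      (‖fracDeriv μ g ζ‖ₑ * ENNReal.ofReal (weightTail μ ‖ζ‖)) ^ 2 *
        ENNReal.ofReal (1 / (1 - ‖ζ‖)) := by
  refine withDensity_congr_ae ?_
  filter_upwards [ae_discArea_mem_unitDisc] with ζ hζ
  have h1 := hμ.tail_nonneg (norm_nonneg ζ)
  rw [mul_pow, mul_assoc, ← ENNReal.ofReal_pow h1, ← ENNReal.ofReal_mul (by positivity),
    mul_one_div]

section

variable {μ : ℝ → ℝ} {g : ℂ → ℂ}

theorem aemeasurable_fracDeriv_mul_tail (hμ : IsRadialWeight μ) (hg : IsAnalyticOnDisc g) :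
    AEMeasurable (fun ζ => ‖fracDeriv μ g ζ‖ₑ * ENNReal.ofReal (weightTail μ ‖ζ‖)) discArea :=
  (aemeasurable_discArea_of_continuousOn (continuousOn_fracDeriv hμ hg)).enorm.mul
    (aemeasurable_discArea_of_continuousOn (continuousOn_tail_norm hμ)).ennreal_ofReal

theorem lintegral_fracDeriv_mul_tail_lt_top (hμ : IsRadialWeight μ) (hg : IsAnalyticOnDisc g)
    (hfin : bmoaWeightMeasure μ g univ < ∞) :
    ∫⁻ ζ, ‖fracDeriv μ g ζ‖ₑ * ENNReal.ofReal (weightTail μ ‖ζ‖) ∂discArea < ∞ := by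
  have h := sq_lintegral_le_withDensity_univ (aemeasurable_fracDeriv_mul_tail hμ hg)
  rw [← bmoaWeightMeasure_eq hμ] at h
  by_contra hcon
  rw [not_lt_top_iff.1 hcon] at h
  simp at h
  exact hfin.ne h

theorem enorm_apply_zero_le (hμ : IsRadialWeight μ) (hg : IsAnalyticOnDisc g)
    (hfin : bmoaWeightMeasure μ g univ < ∞) :
    ‖g 0‖ₑ ≤ ENNReal.ofReal (weightMoment μ 1 / weightMoment μ 2) *
      ∫⁻ ζ, ‖fracDeriv μ g ζ‖ₑ * ENNReal.ofReal (weightTail μ ‖ζ‖) ∂discArea := by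
  have hlt := lintegral_fracDeriv_mul_tail_lt_top hμ hg hfin
  have e0 : ∀ ζ : ℂ, ‖fracDeriv μ g ζ * (starRingEnd ℂ) ζ ^ 0 * (weightTail μ ‖ζ‖ : ℂ)‖ₑ =
      ‖fracDeriv μ g ζ‖ₑ * ENNReal.ofReal (weightTail μ ‖ζ‖) := fun ζ => by
    rw [pow_zero, mul_one, enorm_mul]
    congr 1
    rw [← ofReal_norm, Complex.norm_real, Real.norm_of_nonneg (hμ.tail_nonneg (norm_nonneg ζ))]
  have hinteg : Integrable (fun ζ => fracDeriv μ g ζ * (starRingEnd ℂ) ζ ^ 0 *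
      (weightTail μ ‖ζ‖ : ℂ)) discArea := by
    refine ⟨AEMeasurable.aestronglyMeasurable ?_, ?_⟩
    · refine aemeasurable_discArea_of_continuousOn ?_
      exact ((continuousOn_fracDeriv hμ hg).mul (Complex.continuous_conj.pow 0).continuousOn).mul
        (Complex.continuous_ofReal.comp_continuousOn (continuousOn_tail_norm hμ))
    · rw [HasFiniteIntegral]
      simp_rw [e0]
      exact hlt
  have hrep := integral_mul_conj_pow_mul_radial (fun z hz => hasSum_fracDeriv hμ hg hz)
    (hμ.continuousOn_tail.mono Ioo_subset_Icc_self) 0 hinteg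
  have hm2 : 2 * ∫ ρ in Ioo (0 : ℝ) 1, ρ ^ (2 * 0 + 1) * weightTail μ ρ = weightMoment μ 2 := by
    rw [hμ.moment_succ 1]
    norm_num
  rw [hm2, taylorCoeff_zero] at hrep
  have hp1 := hμ.moment_pos 1
  have hp2 := hμ.moment_pos 2
  have hc1 : (weightMoment μ 1 : ℂ) ≠ 0 := by exact_mod_cast hp1.ne'
  have hc2 : (weightMoment μ 2 : ℂ) ≠ 0 := by exact_mod_cast hp2.ne'
  have hg0 : g 0 = ((weightMoment μ 1 / weightMoment μ 2 : ℝ) : ℂ) *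
      ∫ ζ, fracDeriv μ g ζ * (starRingEnd ℂ) ζ ^ 0 * (weightTail μ ‖ζ‖ : ℂ) ∂discArea := by
    rw [hrep, mul_zero, zero_add]
    push_cast
    field_simp
  rw [hg0, enorm_mul]
  gcongr
  · rw [← ofReal_norm, Complex.norm_real, Real.norm_of_nonneg (by positivity)]
  · refine (enorm_integral_le_lintegral_enorm _).trans_eq ?_
    simp_rw [e0]

theorem enorm_deriv_mul_le (hμ : IsRadialWeight μ) (hg : IsAnalyticOnDisc g)
    (hfin : bmoaWeightMeasure μ g univ < ∞) {z : ℂ} (hz : z ∈ unitDisc) :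
    ‖deriv g z‖ₑ * ENNReal.ofReal (1 - ‖z‖) ≤ (2 : ℝ≥0) *
      (ENNReal.ofReal ((1 - ‖z‖) ^ (1 / 2 : ℝ)) *
      ∫⁻ ζ, ‖fracDeriv μ g ζ‖ₑ * ENNReal.ofReal (weightTail μ ‖ζ‖) *
        ENNReal.ofReal ((1 - ‖ζ‖) ^ (-(1 / 2 : ℝ)) / ‖1 - z * (starRingEnd ℂ) ζ‖ ^ 2) ∂discArea) := by
  have hlt := lintegral_fracDeriv_mul_tail_lt_top hμ hg hfin
  have hz1 : 0 < 1 - ‖z‖ := by linarith [mem_unitDisc.1 hz]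
  set w : ℝ → ℝ := fun ρ => weightTail μ ρ / ρ with hw
  have hwc : ContinuousOn w (Ioo 0 1) :=
    (hμ.continuousOn_tail.mono Ioo_subset_Icc_self).div continuousOn_id fun x hx => hx.1.ne'
  set B : ℂ → ℂ := fun ζ => fracDeriv μ g ζ * (starRingEnd ℂ) ζ ^ 1 * (w ‖ζ‖ : ℂ) with hB
  have eB : ∀ ζ : ℂ, ‖B ζ‖ₑ ≤ ‖fracDeriv μ g ζ‖ₑ * ENNReal.ofReal (weightTail μ ‖ζ‖) := fun ζ => by
    rw [hB]
    simp only
    rw [pow_one, mul_assoc, enorm_mul]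
    gcongr
    rw [← ofReal_norm, norm_mul, RCLike.norm_conj, Complex.norm_real]
    refine ENNReal.ofReal_le_ofReal ?_
    have ht := hμ.tail_nonneg (norm_nonneg ζ)
    rw [hw, Real.norm_of_nonneg (by positivity)]
    by_cases h : ‖ζ‖ = 0
    · rw [h, zero_mul]
      exact hμ.tail_nonneg le_rfl
    · simp only
      rw [mul_div_cancel₀ _ h]
  have hinteg : Integrable B discArea := by
    refine ⟨?_, ?_⟩
    · have hc : ContinuousOn B (unitDisc \ {0}) := by
        refine (((continuousOn_fracDeriv hμ hg).mono sdiff_subset).mul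
          (Complex.continuous_conj.pow 1).continuousOn).mul
          (Complex.continuous_ofReal.comp_continuousOn
            (hwc.comp continuous_norm.continuousOn fun z hz => ?_))
        exact ⟨norm_pos_iff.2 hz.2, mem_unitDisc.1 hz.1⟩
      have h1 := hc.aestronglyMeasurable (μ := volume)
        (measurableSet_unitDisc.diff (measurableSet_singleton 0))
      rw [Measure.restrict_congr_set (sdiff_null_ae_eq_self (by simp))] at h1
      exact h1.mono_ac Measure.smul_absolutelyContinuous
    · exact (lintegral_mono eB).trans_lt hlt
  have hrep := (hasSum_integral_kernel (fun z hz => hasSum_fracDeriv hμ hg hz) hwc 1 hinteg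
    (k := fun n => ((n : ℝ) + 1) * (2 * n + 3))
    (fun r h0 h1 => summable_quadratic_mul_pow h0 h1) hz)
  have hder := (hasSum_taylorCoeff (isAnalyticOnDisc_deriv hg) hz).mul_left 2
  have heq : 2 * deriv g z = ∫ ζ, B ζ *
      ∑' n : ℕ, (((n + 1) * (2 * n + 3) : ℝ) : ℂ) * (z * (starRingEnd ℂ) ζ) ^ n ∂discArea := by
    refine hder.unique ((funext fun n => ?_ : _ = fun n =>
      2 * (taylorCoeff (deriv g) n * z ^ n)) ▸ hrep)
    have hmom : 2 * ∫ ρ in Ioo (0 : ℝ) 1, ρ ^ (2 * (n + 1) + 1) * w ρ =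
        2 * (weightMoment μ (2 * (n + 1) + 1) / (2 * n + 3)) := by
      rw [hμ.moment_succ (2 * (n + 1))]
      have h3 : (2 * (n : ℝ) + 3) ≠ 0 := by positivity
      rw [show (((2 * (n + 1) : ℕ) : ℝ) + 1) = 2 * n + 3 by push_cast; ring,
        mul_div_cancel_left₀ _ h3]
      congr 1
      refine setIntegral_congr_fun measurableSet_Ioo fun ρ hρ => ?_
      have := hρ.1.ne'
      simp only [hw]
      rw [pow_succ]
      field_simp
    have hp : (weightMoment μ (2 * (n + 1) + 1) : ℂ) ≠ 0 := by
      exact_mod_cast (hμ.moment_pos _).ne'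
    have h3 : (n : ℂ) * 2 + 3 ≠ 0 := by
      have : (n : ℝ) * 2 + 3 ≠ 0 := by positivity
      exact_mod_cast this
    rw [hmom, taylorCoeff_deriv]
    push_cast
    rw [mul_comm (2 : ℂ) n]
    field_simp
  have hD := ae_discArea_mem_unitDisc
  have hker : ∀ ζ ∈ unitDisc, ENNReal.ofReal (1 - ‖z‖) * ‖B ζ *
      ∑' n : ℕ, (((n + 1) * (2 * n + 3) : ℝ) : ℂ) * (z * (starRingEnd ℂ) ζ) ^ n‖ₑ ≤
      ENNReal.ofReal (4 * (1 - ‖z‖) ^ (1 / 2 : ℝ)) *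
      (‖fracDeriv μ g ζ‖ₑ * ENNReal.ofReal (weightTail μ ‖ζ‖) *
        ENNReal.ofReal ((1 - ‖ζ‖) ^ (-(1 / 2 : ℝ)) / ‖1 - z * (starRingEnd ℂ) ζ‖ ^ 2)) := by
    intro ζ hζ
    have hζ1 : 0 < 1 - ‖ζ‖ := by linarith [mem_unitDisc.1 hζ]
    have hlt1 := norm_mul_conj_lt hz hζ
    have hv : 0 < 1 - ‖z * (starRingEnd ℂ) ζ‖ := by linarith
    have hzv : 1 - ‖z‖ ≤ 1 - ‖z * (starRingEnd ℂ) ζ‖ := by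
      linarith [norm_mul_conj_le_left (z := z) hζ]
    have hζv : 1 - ‖ζ‖ ≤ 1 - ‖z * (starRingEnd ℂ) ζ‖ := by
      linarith [norm_mul_conj_le_right (ζ := ζ) hz]
    have hκ : 0 < ‖1 - z * (starRingEnd ℂ) ζ‖ :=
      hz1.trans_le (one_sub_norm_le_norm_one_sub_mul_conj hζ)
    have hpz : 0 < (1 - ‖z‖) ^ (1 / 2 : ℝ) := Real.rpow_pos_of_pos hz1 _
    have hpζ : 0 < (1 - ‖ζ‖) ^ (-(1 / 2 : ℝ)) := Real.rpow_pos_of_pos hζ1 _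
    have hK := norm_tsum_quadratic_le hlt1
    rw [enorm_mul, mul_left_comm, mul_left_comm (ENNReal.ofReal (4 * _))]
    refine mul_le_mul' (eB ζ) ?_
    rw [← ofReal_norm, ← ENNReal.ofReal_mul hz1.le, ← ENNReal.ofReal_mul (by positivity)]
    refine ENNReal.ofReal_le_ofReal ?_
    calc _ ≤ (1 - ‖z‖) * (4 / (1 - ‖z * (starRingEnd ℂ) ζ‖) / ‖1 - z * (starRingEnd ℂ) ζ‖ ^ 2) := by
          gcongr
      _ = 4 * ((1 - ‖z‖) / (1 - ‖z * (starRingEnd ℂ) ζ‖)) / ‖1 - z * (starRingEnd ℂ) ζ‖ ^ 2 := by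
          ring
      _ ≤ 4 * ((1 - ‖z‖) ^ (1 / 2 : ℝ) * (1 - ‖ζ‖) ^ (-(1 / 2 : ℝ))) /
            ‖1 - z * (starRingEnd ℂ) ζ‖ ^ 2 := by
          gcongr
          refine le_trans ?_ (div_rpow_le_rpow_mul_rpow_neg hz1 hζ1 hζv (by norm_num))
          exact Real.self_le_rpow_of_le_one (by positivity) ((div_le_one hv).2 hzv) (by norm_num)
      _ = _ := by ring
  have h2 : ENNReal.ofReal (1 - ‖z‖) * ‖2 * deriv g z‖ₑ ≤
      ENNReal.ofReal (4 * (1 - ‖z‖) ^ (1 / 2 : ℝ)) *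
      ∫⁻ ζ, ‖fracDeriv μ g ζ‖ₑ * ENNReal.ofReal (weightTail μ ‖ζ‖) *
        ENNReal.ofReal ((1 - ‖ζ‖) ^ (-(1 / 2 : ℝ)) / ‖1 - z * (starRingEnd ℂ) ζ‖ ^ 2) ∂discArea := by
    rw [heq]
    refine (mul_le_mul_right (enorm_integral_le_lintegral_enorm _) _).trans ?_
    rw [← lintegral_const_mul' _ _ ENNReal.ofReal_ne_top,
      ← lintegral_const_mul' _ _ ENNReal.ofReal_ne_top]
    exact lintegral_mono_ae (hD.mono hker)
  have e2 : ‖2 * deriv g z‖ₑ = 2 * ‖deriv g z‖ₑ := by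
    rw [enorm_mul]
    congr 1
    rw [← ofReal_norm]
    simp
  have e4 : ENNReal.ofReal (4 * (1 - ‖z‖) ^ (1 / 2 : ℝ)) =
      2 * (2 * ENNReal.ofReal ((1 - ‖z‖) ^ (1 / 2 : ℝ))) := by
    rw [ENNReal.ofReal_mul (by norm_num), ← mul_assoc]
    congr 1
    norm_num
  rw [e2, e4, mul_left_comm, mul_assoc, mul_assoc] at h2
  have h5 := (ENNReal.mul_le_mul_iff_right (by norm_num) (by norm_num)).1 h2
  rw [mul_comm]
  exact_mod_cast h5

end

theorem bmoaMeasure_carlesonSquare_le {g : ℂ → ℂ} (a : ℂ) :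
    bmoaMeasure g (carlesonSquare a) ≤ (2 : ℝ≥0) * ∫⁻ z in carlesonSquare a,
      (‖deriv g z‖ₑ * ENNReal.ofReal (1 - ‖z‖)) ^ 2 * ENNReal.ofReal (1 / (1 - ‖z‖)) ∂discArea := by
  rw [bmoaMeasure, withDensity_apply _ (measurableSet_carlesonSquare a),
    ← lintegral_const_mul' _ _ (by simp)]
  refine setLIntegral_mono' (measurableSet_carlesonSquare a) fun z hz => ?_
  have hz1 : 0 < 1 - ‖z‖ := by linarith [mem_unitDisc.1 hz.1]
  rw [mul_pow, ← ENNReal.ofReal_pow hz1.le, mul_assoc (‖deriv g z‖ₑ ^ 2), mul_left_comm,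
    ← ENNReal.ofReal_mul (by positivity), ENNReal.coe_ofNat,
    show (2 : ℝ≥0∞) = ENNReal.ofReal 2 by simp,
    ← ENNReal.ofReal_mul (p := 2) (by norm_num)]
  refine mul_le_mul_right (ENNReal.ofReal_le_ofReal ?_) _
  have : (1 - ‖z‖) ^ 2 * (1 / (1 - ‖z‖)) = 1 - ‖z‖ := by field_simp
  rw [this]
  nlinarith [norm_nonneg z, mem_unitDisc.1 hz.1]

theorem bmoaWeightMeasure_compl (μ : ℝ → ℝ) (g : ℂ → ℂ) :
    bmoaWeightMeasure μ g unitDiscᶜ = 0 := withDensity_discArea_compl _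

theorem bmoaMeasure_compl (g : ℂ → ℂ) : bmoaMeasure g unitDiscᶜ = 0 :=
  withDensity_discArea_compl _

theorem exists_carlesonSup_bmoaMeasure_le {μ : ℝ → ℝ} (hμ : IsRadialWeight μ) :
    ∃ C : ℝ≥0, ∀ g, IsAnalyticOnDisc g → IsCarleson (bmoaWeightMeasure μ g) →
      carlesonSup (bmoaMeasure g) ≤ C * carlesonSup (bmoaWeightMeasure μ g) ∧
      (IsVanishingCarleson (bmoaWeightMeasure μ g) → IsVanishingCarleson (bmoaMeasure g)) := by
  obtain ⟨C, hC⟩ := carleson_of_le_integralOperator (η := 1 / 2) (by norm_num) (by norm_num) 2 2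
  refine ⟨C, fun g hg hcar => ?_⟩
  have hfin : bmoaWeightMeasure μ g univ < ∞ :=
    (measure_univ_le_carlesonSup (bmoaWeightMeasure_compl μ g)).trans_lt hcar
  rw [bmoaWeightMeasure_eq hμ]
  exact hC _ (fun z => ‖deriv g z‖ₑ * ENNReal.ofReal (1 - ‖z‖)) _
    (aemeasurable_fracDeriv_mul_tail hμ hg) (fun z hz => enorm_deriv_mul_le hμ hg hfin hz)
    fun a _ => bmoaMeasure_carlesonSquare_le a

theorem weightVMOA_subset_VMOA {μ : ℝ → ℝ} (hμ : IsRadialWeight μ) : weightVMOA μ ⊆ VMOA := by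
  obtain ⟨C, hC⟩ := exists_carlesonSup_bmoaMeasure_le hμ
  exact fun g hg => ⟨hg.1, (hC g hg.1 hg.2.1).2 hg.2⟩

theorem bmoaNorm_dominatedOn {μ : ℝ → ℝ} (hμ : IsRadialWeight μ) :
    DominatedOn {g | IsAnalyticOnDisc g} bmoaNorm (bmoaWeightNorm μ) := by
  obtain ⟨C, hC⟩ := exists_carlesonSup_bmoaMeasure_le hμ
  set q : ℝ≥0 := Real.toNNReal (weightMoment μ 1 / weightMoment μ 2) with hq
  set A : ℝ≥0 := q ^ 2 + C + 1 with hA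
  have hA0 : 0 < A := by positivity
  refine ⟨A ^ (1 / 2 : ℝ), NNReal.rpow_pos hA0, fun g hg => ?_⟩
  have hg : IsAnalyticOnDisc g := hg
  rw [bmoaNorm, bmoaWeightNorm, ENNReal.coe_rpow_of_nonneg _ (by norm_num),
    ← ENNReal.mul_rpow_of_nonneg _ _ (by norm_num)]
  refine ENNReal.rpow_le_rpow ?_ (by norm_num)
  by_cases hcar : IsCarleson (bmoaWeightMeasure μ g)
  · have hle := measure_univ_le_carlesonSup (bmoaWeightMeasure_compl μ g)
    have hfin : bmoaWeightMeasure μ g univ < ∞ := hle.trans_lt hcar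
    have h1 := (hC g hg hcar).1
    have h2 : ‖g 0‖ₑ ^ 2 ≤ (q : ℝ≥0∞) ^ 2 * carlesonSup (bmoaWeightMeasure μ g) := by
      calc ‖g 0‖ₑ ^ 2 ≤ (ENNReal.ofReal (weightMoment μ 1 / weightMoment μ 2) *
          ∫⁻ ζ, ‖fracDeriv μ g ζ‖ₑ * ENNReal.ofReal (weightTail μ ‖ζ‖) ∂discArea) ^ 2 := by
            gcongr
            exact enorm_apply_zero_le hμ hg hfin
        _ ≤ _ := by
            rw [mul_pow]
            refine mul_le_mul_right (le_trans ?_ hle) _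
            rw [bmoaWeightMeasure_eq hμ]
            exact sq_lintegral_le_withDensity_univ (aemeasurable_fracDeriv_mul_tail hμ hg)
    refine (add_le_add h2 h1).trans ?_
    rw [← add_mul]
    gcongr
    rw [hA]
    push_cast
    exact le_self_add
  · rw [IsCarleson, not_lt_top_iff] at hcar
    rw [hcar, ENNReal.mul_top (by exact_mod_cast hA0.ne')]
    exact le_top

/-! ### Consequences of the doubling conditions -/

theorem one_sub_mul_pow_le {s : ℝ} (hs : s ∈ Ico (0 : ℝ) 1) (n : ℕ) :
    s ^ n * (1 - s) ≤ 1 / (n + 1) := by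
  have h1 : ∑ j ∈ Finset.range (n + 1), s ^ n ≤ ∑ j ∈ Finset.range (n + 1), s ^ j :=
    Finset.sum_le_sum fun j hj => pow_le_pow_of_le_one hs.1 hs.2.le
      (Nat.lt_succ_iff.1 (Finset.mem_range.1 hj))
  rw [Finset.sum_const, Finset.card_range, nsmul_eq_mul] at h1
  have h2 := geom_sum_mul_neg s (n + 1)
  have h3 : 0 ≤ s ^ (n + 1) := pow_nonneg hs.1 _
  have h4 : 0 ≤ 1 - s := by linarith [hs.2]
  rw [le_div_iff₀ (by positivity)]
  push_cast at h1
  nlinarith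

namespace IsRadialWeight

variable {μ : ℝ → ℝ}

theorem exists_tail_le_rpow (hμ : IsRadialWeight μ) (h : IsLowerDoubling μ) :
    ∃ η C : ℝ, 0 < η ∧ η < 1 ∧ 0 < C ∧ ∀ s t : ℝ, 0 ≤ s → s ≤ t → t < 1 →
      weightTail μ t ≤ C * ((1 - t) / (1 - s)) ^ η * weightTail μ s := by
  obtain ⟨K, C', hK, hC', hd⟩ := h
  have hlogK : 0 < Real.log K := Real.log_pos hK
  have hlogC : 0 < Real.log C' := Real.log_pos hC'
  have hK0 : 0 < K := by linarith
  set η := min (1 / 2) (Real.log C' / Real.log K) with hη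
  have hη0 : 0 < η := lt_min (by norm_num) (by positivity)
  have hKη : K ^ η ≤ C' := by
    rw [← Real.log_le_log_iff (by positivity) (by linarith), Real.log_rpow hK0]
    have := min_le_right (1 / 2) (Real.log C' / Real.log K)
    rw [← hη, le_div_iff₀ hlogK] at this
    exact this
  have hKη0 : 0 < K ^ η := by positivity
  refine ⟨η, K ^ η, hη0, (min_le_left _ _).trans_lt (by norm_num), hKη0, fun s t hs hst ht => ?_⟩
  have hs1 : 0 < 1 - s := by linarith
  have ht1 : 0 < 1 - t := by linarith
  have hiter : ∀ n : ℕ, (K ^ η) ^ n * weightTail μ (1 - (1 - s) / K ^ n) ≤ weightTail μ s := by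
    intro n
    induction n with
    | zero => simp
    | succ n ih =>
      have hKn : 1 ≤ K ^ n := one_le_pow₀ hK.le
      have h1 : (1 - s) / K ^ n ≤ 1 - s := div_le_self hs1.le hKn
      have h2 : 0 < (1 - s) / K ^ n := by positivity
      have h3 := hd (1 - (1 - s) / K ^ n) ⟨by linarith, by linarith⟩
      rw [sub_sub_cancel, div_div, ← pow_succ] at h3
      have h4 : 0 ≤ weightTail μ (1 - (1 - s) / K ^ (n + 1)) := by
        refine hμ.tail_nonneg ?_
        have : (1 - s) / K ^ (n + 1) ≤ 1 - s := div_le_self hs1.le (one_le_pow₀ hK.le)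
        linarith
      calc (K ^ η) ^ (n + 1) * weightTail μ (1 - (1 - s) / K ^ (n + 1))
          = (K ^ η) ^ n * (K ^ η * weightTail μ (1 - (1 - s) / K ^ (n + 1))) := by ring
        _ ≤ (K ^ η) ^ n * (C' * weightTail μ (1 - (1 - s) / K ^ (n + 1))) := by gcongr
        _ ≤ (K ^ η) ^ n * weightTail μ (1 - (1 - s) / K ^ n) := by gcongr
        _ ≤ _ := ih
  obtain ⟨n, hn1, hn2⟩ := exists_nat_pow_near
    (show 1 ≤ (1 - s) / (1 - t) by rw [one_le_div ht1]; linarith) hK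
  have hle : weightTail μ t ≤ weightTail μ (1 - (1 - s) / K ^ n) := by
    refine hμ.tail_anti ?_ ?_
    · have : (1 - s) / K ^ n ≤ 1 - s := div_le_self hs1.le (one_le_pow₀ hK.le)
      linarith
    · have : 1 - t ≤ (1 - s) / K ^ n := by
        rw [le_div_iff₀ (by positivity)]
        rw [le_div_iff₀ ht1] at hn1
        linarith
      linarith
  have hpow : 1 ≤ K ^ η * ((1 - t) / (1 - s)) ^ η * (K ^ η) ^ n := by
    have h1 : 1 ≤ K * ((1 - t) / (1 - s)) * K ^ n := by
      rw [div_lt_iff₀ ht1, pow_succ] at hn2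
      rw [mul_div_assoc', div_mul_eq_mul_div, one_le_div hs1]
      linarith
    have h2 := Real.one_le_rpow h1 hη0.le
    rw [Real.mul_rpow (by positivity) (by positivity), Real.mul_rpow (by positivity) (by positivity),
      ← Real.rpow_natCast, ← Real.rpow_mul hK0.le, mul_comm (n : ℝ), Real.rpow_mul hK0.le,
      Real.rpow_natCast] at h2
    exact h2
  have hpos : 0 ≤ K ^ η * ((1 - t) / (1 - s)) ^ η := by positivity
  calc weightTail μ t ≤ (K ^ η * ((1 - t) / (1 - s)) ^ η * (K ^ η) ^ n) * weightTail μ t :=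
        le_mul_of_one_le_left (hμ.tail_nonneg (hs.trans hst)) hpow
    _ ≤ (K ^ η * ((1 - t) / (1 - s)) ^ η) * ((K ^ η) ^ n * weightTail μ (1 - (1 - s) / K ^ n)) := by
        rw [mul_assoc]
        gcongr
    _ ≤ _ := by gcongr; exact hiter n

theorem integrableOn_pow_mul_tail (hμ : IsRadialWeight μ) (n : ℕ) :
    IntegrableOn (fun u => u ^ n * weightTail μ u) (Icc 0 1) :=
  ((continuous_pow n).continuousOn.mul hμ.continuousOn_tail).integrableOn_Icc

theorem exists_moment_le (hμ : IsRadialWeight μ) (h : IsUpperDoubling μ) :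
    ∃ C : ℝ, 1 ≤ C ∧ ∀ n : ℕ, weightMoment μ (n + 1) ≤ C * weightMoment μ (2 * n + 1) := by
  obtain ⟨C, hC, hd⟩ := h
  refine ⟨max 1 (2 * C), le_max_left _ _, fun n => ?_⟩
  have hsub : ∫ u in (0 : ℝ)..1, u ^ n * weightTail μ ((1 + u) / 2) =
      2 * ∫ v in (1 / 2 : ℝ)..1, (2 * v - 1) ^ n * weightTail μ v := by
    have := intervalIntegral.integral_comp_div_add (a := 0) (b := 1)
      (fun v => (2 * v - 1) ^ n * weightTail μ v) (c := 2) (by norm_num) (1 / 2)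
    norm_num at this
    rw [← this]
    refine intervalIntegral.integral_congr fun u _ => ?_
    rw [show (1 + u) / 2 = u / 2 + 1 / 2 by ring]
    ring
  have hI1 : IntervalIntegrable (fun u => u ^ n * weightTail μ u) volume 0 1 :=
    (intervalIntegrable_iff_integrableOn_Icc_of_le zero_le_one).2 (hμ.integrableOn_pow_mul_tail n)
  have hc2 : ContinuousOn (fun u => u ^ n * weightTail μ ((1 + u) / 2)) (Icc 0 1) := by
    refine (continuous_pow n).continuousOn.mul (hμ.continuousOn_tail.comp (by fun_prop) ?_)
    intro u hu
    exact ⟨by linarith [hu.1], by linarith [hu.2]⟩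
  have hI2 : IntervalIntegrable (fun u => u ^ n * weightTail μ ((1 + u) / 2)) volume 0 1 :=
    (intervalIntegrable_iff_integrableOn_Icc_of_le zero_le_one).2 hc2.integrableOn_Icc
  have hsubset : Icc (1 / 2 : ℝ) 1 ⊆ Icc 0 1 := Icc_subset_Icc_left (by norm_num)
  have hI3 : IntervalIntegrable (fun v => (2 * v - 1) ^ n * weightTail μ v) volume (1 / 2) 1 := by
    refine (intervalIntegrable_iff_integrableOn_Icc_of_le (by norm_num)).2 ?_
    exact ((by fun_prop : Continuous fun v : ℝ => (2 * v - 1) ^ n).continuousOn.mul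
      (hμ.continuousOn_tail.mono hsubset)).integrableOn_Icc
  have hI4 : IntervalIntegrable (fun v => v ^ (2 * n) * weightTail μ v) volume (1 / 2) 1 :=
    (intervalIntegrable_iff_integrableOn_Icc_of_le (by norm_num)).2
      ((hμ.integrableOn_pow_mul_tail (2 * n)).mono_set hsubset)
  have hI5 : IntervalIntegrable (fun v => v ^ (2 * n) * weightTail μ v) volume 0 1 :=
    (intervalIntegrable_iff_integrableOn_Icc_of_le zero_le_one).2
      (hμ.integrableOn_pow_mul_tail (2 * n))
  have e : ∀ k : ℕ, ∫ u in Ioo (0 : ℝ) 1, u ^ k * weightTail μ u =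
      ∫ u in (0 : ℝ)..1, u ^ k * weightTail μ u := fun k => by
    rw [intervalIntegral.integral_of_le zero_le_one, integral_Ioc_eq_integral_Ioo]
  have h1 : ∫ u in (0 : ℝ)..1, u ^ n * weightTail μ u ≤
      C * ∫ u in (0 : ℝ)..1, u ^ n * weightTail μ ((1 + u) / 2) := by
    rw [← intervalIntegral.integral_const_mul]
    refine intervalIntegral.integral_mono_on_of_le_Ioo zero_le_one hI1 (hI2.const_mul _) ?_
    intro u hu
    have := hd u ⟨hu.1.le, hu.2⟩
    have h0 : 0 ≤ u ^ n := pow_nonneg hu.1.le _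
    nlinarith
  have h2 : ∫ v in (1 / 2 : ℝ)..1, (2 * v - 1) ^ n * weightTail μ v ≤
      ∫ v in (1 / 2 : ℝ)..1, v ^ (2 * n) * weightTail μ v := by
    refine intervalIntegral.integral_mono_on (by norm_num) hI3 hI4 fun v hv => ?_
    have ht := hμ.tail_nonneg (show 0 ≤ v by linarith [hv.1])
    rw [pow_mul]
    refine mul_le_mul_of_nonneg_right (pow_le_pow_left₀ (by linarith [hv.1]) ?_ n) ht
    nlinarith [sq_nonneg (v - 1)]
  have h3 : ∫ v in (1 / 2 : ℝ)..1, v ^ (2 * n) * weightTail μ v ≤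
      ∫ v in (0 : ℝ)..1, v ^ (2 * n) * weightTail μ v := by
    refine intervalIntegral.integral_mono_interval (by norm_num) (by norm_num) le_rfl ?_ hI5
    filter_upwards [ae_restrict_mem measurableSet_Ioc] with v hv
    exact mul_nonneg (pow_nonneg hv.1.le _) (hμ.tail_nonneg hv.1.le)
  have hpos : 0 ≤ ∫ v in (0 : ℝ)..1, v ^ (2 * n) * weightTail μ v :=
    intervalIntegral.integral_nonneg zero_le_one fun v hv =>
      mul_nonneg (pow_nonneg hv.1 _) (hμ.tail_nonneg hv.1)
  rw [hμ.moment_succ n, hμ.moment_succ (2 * n), e, e]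
  push_cast
  set J := ∫ v in (0 : ℝ)..1, v ^ (2 * n) * weightTail μ v
  have hn : (0 : ℝ) ≤ n := Nat.cast_nonneg n
  calc ((n : ℝ) + 1) * ∫ u in (0 : ℝ)..1, u ^ n * weightTail μ u
      ≤ (n + 1) * (C * (2 * J)) := by
        gcongr
        refine h1.trans ?_
        rw [hsub]
        gcongr
        exact h2.trans h3
    _ ≤ 2 * C * ((2 * n + 1) * J) := by
        nlinarith [mul_nonneg hn (mul_nonneg hC.le hpos)]
    _ ≤ _ := by
        gcongr
        exact le_max_right _ _

theorem moment_sub (hμ : IsRadialWeight μ) (n : ℕ) :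
    weightMoment μ (2 * n + 1) - weightMoment μ (2 * (n + 1) + 1) =
    ∫ s in Ico (0 : ℝ) 1, s ^ (2 * n + 1) * (1 - s ^ 2) * μ s := by
  rw [weightMoment, weightMoment, ← integral_sub (hμ.integrableOn_pow_mul _)
    (hμ.integrableOn_pow_mul _)]
  refine integral_congr_ae (ae_of_all _ fun s => ?_)
  simp only
  ring

theorem moment_second_difference (hμ : IsRadialWeight μ) (n : ℕ) :
    weightMoment μ (2 * n + 1) - 2 * weightMoment μ (2 * (n + 1) + 1) +
      weightMoment μ (2 * (n + 2) + 1) =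
    ∫ s in Ico (0 : ℝ) 1, s ^ (2 * n + 1) * (1 - s ^ 2) ^ 2 * μ s := by
  have hi := hμ.integrableOn_pow_mul
  have h1 : IntegrableOn (fun s => s ^ (2 * n + 1) * μ s - 2 * (s ^ (2 * (n + 1) + 1) * μ s))
      (Ico 0 1) := (hi _).sub ((hi _).const_mul 2)
  rw [weightMoment, weightMoment, weightMoment, ← integral_const_mul,
    ← integral_sub (hi _) ((hi _).const_mul 2), ← integral_add h1 (hi _)]
  refine integral_congr_ae (ae_of_all _ fun s => ?_)
  simp only
  ring

theorem moment_sub_le (hμ : IsRadialWeight μ) {C : ℝ}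
    (hC : ∀ n : ℕ, weightMoment μ (n + 1) ≤ C * weightMoment μ (2 * n + 1)) (n : ℕ) :
    weightMoment μ (2 * n + 1) - weightMoment μ (2 * (n + 1) + 1) ≤
      2 * C * weightMoment μ (2 * n + 1) / (n + 1) := by
  rw [hμ.moment_sub n]
  have h1 : ∫ s in Ico (0 : ℝ) 1, s ^ (2 * n + 1) * (1 - s ^ 2) * μ s ≤
      2 / (n + 1) * weightMoment μ (n + 1) := by
    rw [weightMoment, ← integral_const_mul]
    refine integral_mono_of_nonneg ?_ ((hμ.integrableOn_pow_mul (n + 1)).const_mul _) ?_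
    · filter_upwards [ae_restrict_mem measurableSet_Ico] with s hs
      have := hμ.nonneg s hs
      have h2 : 0 ≤ 1 - s ^ 2 := by nlinarith [hs.1, hs.2]
      have := hs.1
      simp only [Pi.zero_apply]
      positivity
    · filter_upwards [ae_restrict_mem measurableSet_Ico] with s hs
      have h0 := hμ.nonneg s hs
      rw [← mul_assoc]
      refine mul_le_mul_of_nonneg_right ?_ h0
      have h2 := one_sub_mul_pow_le hs n
      have h3 : 0 ≤ s ^ (n + 1) := pow_nonneg hs.1 _
      calc s ^ (2 * n + 1) * (1 - s ^ 2) = s ^ (n + 1) * (1 + s) * (s ^ n * (1 - s)) := by ring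
        _ ≤ s ^ (n + 1) * 2 * (1 / (n + 1)) := by
            have := hs.2
            have := mul_nonneg (pow_nonneg hs.1 n) (sub_nonneg.2 hs.2.le)
            gcongr
            linarith
        _ = _ := by ring
  refine h1.trans ?_
  calc 2 / ((n : ℝ) + 1) * weightMoment μ (n + 1) ≤
        2 / ((n : ℝ) + 1) * (C * weightMoment μ (2 * n + 1)) := by
        gcongr
        exact hC n
    _ = _ := by ring

theorem moment_second_difference_le (hμ : IsRadialWeight μ) {C : ℝ}
    (hC : ∀ n : ℕ, weightMoment μ (n + 1) ≤ C * weightMoment μ (2 * n + 1)) (n : ℕ) :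
    weightMoment μ (2 * n + 1) - 2 * weightMoment μ (2 * (n + 1) + 1) +
      weightMoment μ (2 * (n + 2) + 1) ≤ 16 * C * weightMoment μ (2 * n + 1) / (n + 1) ^ 2 := by
  rw [hμ.moment_second_difference n]
  have h1 : ∫ s in Ico (0 : ℝ) 1, s ^ (2 * n + 1) * (1 - s ^ 2) ^ 2 * μ s ≤
      16 / (n + 1) ^ 2 * weightMoment μ (n + 1) := by
    rw [weightMoment, ← integral_const_mul]
    refine integral_mono_of_nonneg ?_ ((hμ.integrableOn_pow_mul (n + 1)).const_mul _) ?_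
    · filter_upwards [ae_restrict_mem measurableSet_Ico] with s hs
      have := hμ.nonneg s hs
      have := hs.1
      simp only [Pi.zero_apply]
      positivity
    · filter_upwards [ae_restrict_mem measurableSet_Ico] with s hs
      have h0 := hμ.nonneg s hs
      rw [← mul_assoc]
      refine mul_le_mul_of_nonneg_right ?_ h0
      have h3 : 0 ≤ s ^ (n + 1) := pow_nonneg hs.1 _
      have h2 : s ^ n * (1 - s) ^ 2 ≤ 4 / (n + 1) ^ 2 := by
        set m := n / 2 with hm
        have h5 : s ^ n ≤ (s ^ m) ^ 2 := by
          rw [← pow_mul]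
          exact pow_le_pow_of_le_one hs.1 hs.2.le (by omega)
        have h6 := one_sub_mul_pow_le hs m
        have h7 : ((n : ℝ) + 1) / 2 ≤ m + 1 := by
          have : n + 1 ≤ 2 * (m + 1) := by omega
          have : ((n + 1 : ℕ) : ℝ) ≤ ((2 * (m + 1) : ℕ) : ℝ) := by exact_mod_cast this
          push_cast at this
          linarith
        have h8 : 0 ≤ s ^ m * (1 - s) := mul_nonneg (pow_nonneg hs.1 m) (sub_nonneg.2 hs.2.le)
        calc s ^ n * (1 - s) ^ 2 ≤ (s ^ m) ^ 2 * (1 - s) ^ 2 := by gcongr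
          _ = (s ^ m * (1 - s)) ^ 2 := by ring
          _ ≤ (1 / (((n : ℝ) + 1) / 2)) ^ 2 := by
              refine pow_le_pow_left₀ h8 (h6.trans ?_) 2
              gcongr
          _ = _ := by field_simp; norm_num
      have h9 : 0 ≤ s ^ n * (1 - s) ^ 2 := mul_nonneg (pow_nonneg hs.1 n) (sq_nonneg _)
      calc s ^ (2 * n + 1) * (1 - s ^ 2) ^ 2 =
            s ^ (n + 1) * (1 + s) ^ 2 * (s ^ n * (1 - s) ^ 2) := by ring
        _ ≤ s ^ (n + 1) * 4 * (4 / (n + 1) ^ 2) := by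
            have : (1 + s) ^ 2 ≤ 4 := by nlinarith [hs.1, hs.2]
            gcongr
        _ = _ := by ring
  refine h1.trans ?_
  calc 16 / ((n : ℝ) + 1) ^ 2 * weightMoment μ (n + 1) ≤
        16 / ((n : ℝ) + 1) ^ 2 * (C * weightMoment μ (2 * n + 1)) := by
        gcongr
        exact hC n
    _ = _ := by ring

end IsRadialWeight

/-- The second differences of `x ↦ x (x + 1) / m x` in terms of those of `m`. -/
theorem abs_second_difference_quadratic_div_le {m₁ m₂ m₃ x C : ℝ} (hx : 2 ≤ x) (hC : 1 ≤ C)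
    (h₃ : 0 < m₃) (h₁₂ : m₂ ≤ m₁) (h₂₃ : m₃ ≤ m₂) (hE : m₁ ≤ C * m₂)
    (hd : m₁ - m₂ ≤ 2 * C * m₁ / x) (hd' : m₂ - m₃ ≤ 2 * C * m₁ / x)
    (h0 : 0 ≤ m₁ - 2 * m₂ + m₃) (hdd : m₁ - 2 * m₂ + m₃ ≤ 16 * C * m₁ / x ^ 2) :
    |(x + 2) * (x + 3) / m₃ - 2 * ((x + 1) * (x + 2) / m₂) + x * (x + 1) / m₁| ≤
      150 * C ^ 3 / m₃ := by
  have h₂ : 0 < m₂ := by linarith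
  have h₁ : 0 < m₁ := by linarith
  have hx0 : 0 < x := by linarith
  have hC0 : 0 < C := by linarith
  have key : (x + 2) * (x + 3) / m₃ - 2 * ((x + 1) * (x + 2) / m₂) + x * (x + 1) / m₁ =
      (x + 2) * (x + 3) * (((m₁ - m₂) * (m₁ - m₃) - (m₁ - 2 * m₂ + m₃) * m₁) / (m₁ * m₂ * m₃)) +
        4 * (x + 2) * ((m₁ - m₂) / (m₁ * m₂)) + 2 / m₁ := by
    field_simp
    ring
  have hA : |((m₁ - m₂) * (m₁ - m₃) - (m₁ - 2 * m₂ + m₃) * m₁) / (m₁ * m₂ * m₃)| ≤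
      24 * C ^ 3 / (x ^ 2 * m₃) := by
    rw [abs_div, abs_of_pos (by positivity : 0 < m₁ * m₂ * m₃),
      div_le_div_iff₀ (by positivity) (by positivity)]
    have hnum : |(m₁ - m₂) * (m₁ - m₃) - (m₁ - 2 * m₂ + m₃) * m₁| ≤
        24 * C ^ 2 * m₁ ^ 2 / x ^ 2 := by
      have h5 : (m₁ - m₂) * (m₁ - m₃) ≤ 2 * C * m₁ / x * (4 * C * m₁ / x) := by
        refine mul_le_mul hd ?_ (by linarith) (by positivity)
        rw [show 4 * C * m₁ / x = 2 * C * m₁ / x + 2 * C * m₁ / x by ring]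
        linarith
      have h6 : (m₁ - 2 * m₂ + m₃) * m₁ ≤ 16 * C * m₁ / x ^ 2 * m₁ := by gcongr
      have h7 : 0 ≤ (m₁ - m₂) * (m₁ - m₃) := mul_nonneg (by linarith) (by linarith)
      have h8 : 0 ≤ (m₁ - 2 * m₂ + m₃) * m₁ := mul_nonneg h0 h₁.le
      have h9 : 2 * C * m₁ / x * (4 * C * m₁ / x) + 16 * C * m₁ / x ^ 2 * m₁ ≤
          24 * C ^ 2 * m₁ ^ 2 / x ^ 2 := by
        have : 2 * C * m₁ / x * (4 * C * m₁ / x) + 16 * C * m₁ / x ^ 2 * m₁ =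
          (8 * C ^ 2 + 16 * C) * m₁ ^ 2 / x ^ 2 := by
          field_simp
          ring
        rw [this]
        gcongr
        nlinarith
      rw [abs_le]
      constructor <;> nlinarith
    calc _ ≤ 24 * C ^ 2 * m₁ ^ 2 / x ^ 2 * (x ^ 2 * m₃) := by gcongr
      _ = 24 * C ^ 2 * (m₁ * m₃) * m₁ := by
          field_simp
      _ ≤ 24 * C ^ 2 * (m₁ * m₃) * (C * m₂) := by gcongr
      _ = _ := by ring
  have hB : 0 ≤ (m₁ - m₂) / (m₁ * m₂) := div_nonneg (by linarith) (by positivity)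
  have hB' : (m₁ - m₂) / (m₁ * m₂) ≤ 2 * C / (x * m₃) := by
    calc (m₁ - m₂) / (m₁ * m₂) ≤ 2 * C * m₁ / x / (m₁ * m₂) := by gcongr
      _ = 2 * C / (x * m₂) := by field_simp
      _ ≤ _ := by gcongr
  have hC3 : C ≤ C ^ 3 := by nlinarith [sq_nonneg C, mul_nonneg hC0.le (sub_nonneg.2 hC)]
  have hC31 : 1 ≤ C ^ 3 := by linarith
  rw [key]
  refine (abs_add_three _ _ _).trans ?_
  have t1 : |(x + 2) * (x + 3) *
      (((m₁ - m₂) * (m₁ - m₃) - (m₁ - 2 * m₂ + m₃) * m₁) / (m₁ * m₂ * m₃))| ≤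
      120 * C ^ 3 / m₃ := by
    rw [abs_mul, abs_of_pos (by positivity : 0 < (x + 2) * (x + 3))]
    calc _ ≤ (5 * x ^ 2) * (24 * C ^ 3 / (x ^ 2 * m₃)) :=
          mul_le_mul (by nlinarith) hA (abs_nonneg _) (by positivity)
      _ = _ := by
          field_simp
          norm_num
  have t2 : |4 * (x + 2) * ((m₁ - m₂) / (m₁ * m₂))| ≤ 16 * C ^ 3 / m₃ := by
    rw [abs_of_nonneg (by positivity)]
    calc _ ≤ 4 * (2 * x) * (2 * C / (x * m₃)) := by
          gcongr
          linarith
      _ = 16 * C / m₃ := by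
          field_simp
          norm_num
      _ ≤ _ := by gcongr
  have t3 : |2 / m₁| ≤ 2 * C ^ 3 / m₃ := by
    rw [abs_of_pos (by positivity)]
    have : m₃ ≤ m₁ := by linarith
    gcongr
    linarith
  calc _ ≤ 120 * C ^ 3 / m₃ + 16 * C ^ 3 / m₃ + 2 * C ^ 3 / m₃ := by gcongr
    _ = 138 * C ^ 3 / m₃ := by ring
    _ ≤ _ := by
        gcongr
        norm_num

theorem summable_quadratic_div_moment {μ : ℝ → ℝ} (hμ : IsRadialWeight μ) {r : ℝ} (hr0 : 0 ≤ r)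
    (hr1 : r < 1) : Summable fun n : ℕ =>
      |((n : ℝ) + 2) * (n + 3) / weightMoment μ (2 * (n + 1) + 1)| * r ^ n := by
  have hx0 : (0 : ℝ) ≤ 1 - (1 - r) / 2 := by linarith
  have hx : ‖1 - (1 - r) / 2‖ < 1 := by
    rw [Real.norm_of_nonneg hx0]
    linarith
  have s2 := (summable_pow_mul_geometric_of_norm_lt_one 2 hx)
  have s1 := (summable_pow_mul_geometric_of_norm_lt_one 1 hx).mul_left 5
  have s0 := (summable_pow_mul_geometric_of_norm_lt_one 0 hx).mul_left 6
  refine Summable.of_nonneg_of_le (fun n => by positivity) (fun n => ?_)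
    (((s2.add s1).add s0).mul_left (4 / weightTail μ ((3 + r) / 4)))
  have hn : (0 : ℝ) ≤ ((n : ℝ) + 2) * (n + 3) := by positivity
  have := mul_le_mul_of_nonneg_left (inv_moment_mul_pow_le hμ hr0 hr1 n) hn
  rw [abs_of_nonneg (div_nonneg hn (hμ.moment_pos _).le)]
  calc _ = ((n : ℝ) + 2) * (n + 3) * (r ^ n / weightMoment μ (2 * (n + 1) + 1)) := by ring
    _ ≤ _ := this
    _ = _ := by ring

/-- The kernel representing the fractional derivative through the derivative. -/
theorem exists_norm_tsum_kernel_le {μ : ℝ → ℝ} (hμ : IsRadialWeight μ) (h : IsUpperDoubling μ) :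
    ∃ C : ℝ, 0 < C ∧ ∀ w : ℂ, ‖w‖ < 1 →
      ‖∑' n : ℕ, (((n + 2) * (n + 3) / weightMoment μ (2 * (n + 1) + 1) : ℝ) : ℂ) * w ^ n‖ ≤
        C / ((1 - ‖w‖) * weightTail μ ‖w‖) / ‖1 - w‖ ^ 2 := by
  obtain ⟨C, hC1, hC⟩ := hμ.exists_moment_le h
  obtain ⟨D, hD0, hD⟩ := h
  refine ⟨150 * C ^ 3 * (8 * D ^ 2), by positivity, fun w hw => ?_⟩
  have hw0 := norm_nonneg w
  set A : ℕ → ℝ := fun n => 1 / weightMoment μ (2 * (n + 1) + 1) with hA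
  have hM : ∀ n, 0 < weightMoment μ n := hμ.moment_pos
  have hA0 : ∀ n, 0 < A n := fun n => one_div_pos.2 (hM _)
  have hle : ∀ n, A n * ‖w‖ ^ n ≤
      4 / weightTail μ ((3 + ‖w‖) / 4) * (1 - (1 - ‖w‖) / 2) ^ n := fun n => by
    rw [hA]
    simp only
    rw [one_div_mul_eq_div]
    exact inv_moment_mul_pow_le hμ hw0 hw n
  have hgeo : HasSum (fun n : ℕ => (1 - (1 - ‖w‖) / 2) ^ n) (2 / (1 - ‖w‖)) := by
    have := hasSum_geometric_of_lt_one (r := 1 - (1 - ‖w‖) / 2) (by linarith) (by linarith)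
    rwa [sub_sub_cancel, inv_div] at this
  have hAs : Summable fun n => A n * ‖w‖ ^ n :=
    Summable.of_nonneg_of_le (fun n => mul_nonneg (hA0 n).le (pow_nonneg hw0 n)) hle
      (hgeo.summable.mul_left _)
  have hAt : ∑' n, A n * ‖w‖ ^ n ≤ 8 * D ^ 2 / ((1 - ‖w‖) * weightTail μ ‖w‖) := by
    refine (hAs.tsum_le_tsum hle (hgeo.summable.mul_left _)).trans ?_
    rw [tsum_mul_left, hgeo.tsum_eq]
    have t0 := hμ.tail_pos' (r := ‖w‖) ⟨hw0, hw⟩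
    have t1 := hμ.tail_pos' (r := (3 + ‖w‖) / 4) ⟨by linarith, by linarith⟩
    have d1 := hD ‖w‖ ⟨hw0, hw⟩
    have d2 := hD ((1 + ‖w‖) / 2) ⟨by linarith, by linarith⟩
    rw [show (1 + (1 + ‖w‖) / 2) / 2 = (3 + ‖w‖) / 4 by ring] at d2
    have d3 : weightTail μ ‖w‖ ≤ D ^ 2 * weightTail μ ((3 + ‖w‖) / 4) := by nlinarith
    have hw1 : 0 < 1 - ‖w‖ := by linarith
    rw [div_mul_div_comm, div_le_div_iff₀ (by positivity) (by positivity)]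
    nlinarith
  have hbs := summable_quadratic_div_moment hμ hw0 hw
  have hmain := norm_tsum_mul_pow_le_of_second_differences
    (b := fun n : ℕ => ((n : ℝ) + 2) * (n + 3) / weightMoment μ (2 * (n + 1) + 1))
    (B := fun n => 150 * C ^ 3 * A n) hw hbs ?_ ?_ ?_ ?_
  · refine hmain.trans ?_
    gcongr
    simp_rw [mul_assoc (150 * C ^ 3)]
    rw [tsum_mul_left, mul_div_assoc (150 * C ^ 3)]
    gcongr
  · have hC3 : 1 ≤ C ^ 3 := one_le_pow₀ hC1
    have := hM 3
    simp only [hA]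
    norm_num
    rw [abs_of_pos (by positivity), ← div_eq_mul_inv]
    gcongr
    linarith
  · have hC3 : 1 ≤ C ^ 3 := one_le_pow₀ hC1
    have h3 := hM 3
    have h5 := hM 5
    have h35 := hμ.moment_anti (show 3 ≤ 5 by norm_num)
    simp only [hA]
    norm_num
    have e1 : 6 / weightMoment μ 3 ≤ 6 / weightMoment μ 5 := by gcongr
    have e0 : 0 < 6 / weightMoment μ 3 := by positivity
    have e2 : 12 / weightMoment μ 5 = 2 * (6 / weightMoment μ 5) := by ring
    have e3 : 12 / weightMoment μ 5 ≤ 150 * C ^ 3 * (weightMoment μ 5)⁻¹ := by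
      rw [← div_eq_mul_inv]
      gcongr
      linarith
    rw [abs_le]
    constructor <;> linarith
  · intro n
    have hn : (0 : ℝ) ≤ n := Nat.cast_nonneg n
    have k := abs_second_difference_quadratic_div_le
      (m₁ := weightMoment μ (2 * (n + 1) + 1)) (m₂ := weightMoment μ (2 * (n + 2) + 1))
      (m₃ := weightMoment μ (2 * (n + 3) + 1)) (x := (n : ℝ) + 2) (C := C) (by linarith) hC1 (hM _)
      (hμ.moment_anti (by omega)) (hμ.moment_anti (by omega))
      ((hμ.moment_anti (by omega)).trans (hC (n + 2)))
      (by
        have := hμ.moment_sub_le hC (n + 1)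
        push_cast at this
        rwa [show (n : ℝ) + 1 + 1 = n + 2 by ring] at this)
      (by
        have h1 := hμ.moment_sub_le hC (n + 2)
        have h2 := hμ.moment_anti (show 2 * (n + 1) + 1 ≤ 2 * (n + 2) + 1 by omega)
        have h3 := hM (2 * (n + 1) + 1)
        refine h1.trans ?_
        push_cast
        exact div_le_div₀ (by positivity) (mul_le_mul_of_nonneg_left h2 (by positivity))
          (by linarith) (by linarith))
      (by
        rw [hμ.moment_second_difference (n + 1)]
        refine setIntegral_nonneg measurableSet_Ico fun s hs => ?_
        have := hμ.nonneg s hs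
        have := hs.1
        positivity)
      (by
        have := hμ.moment_second_difference_le hC (n + 1)
        push_cast at this
        rwa [show (n : ℝ) + 1 + 1 = n + 2 by ring] at this)
    simp only [hA]
    rw [mul_one_div]
    push_cast
    convert k using 2
    ring_nf
  · simp_rw [mul_assoc (150 * C ^ 3)]
    exact hAs.mul_left _

/-! ### Doubling weights: the fractional derivative is controlled by the derivative -/

theorem carlesonSup_le_of_quotient_le {ν ν' : Measure ℂ} {A B : ℝ≥0} {q : ℝ} (hq : 0 < q)
    (hle : ∀ a ∈ unitDisc, carlesonQuotient ν' a ≤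
      A * carlesonQuotient ν a + B * ENNReal.ofReal ((1 - ‖a‖) ^ q)) :
    carlesonSup ν' ≤ A * carlesonSup ν + B := by
  refine iSup₂_le fun a ha => (hle a ha).trans ?_
  refine add_le_add (mul_le_mul_right (carlesonQuotient_le_carlesonSup ν ha) _) ?_
  refine mul_le_of_le_one_right zero_le ?_
  rw [ENNReal.ofReal_le_one]
  have := mem_unitDisc.1 ha
  exact Real.rpow_le_one (by linarith) (by linarith [norm_nonneg a]) hq.le

theorem IsVanishingCarleson.of_quotient_le {ν ν' : Measure ℂ} {A B : ℝ≥0} {q : ℝ} (hq : 0 < q)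
    (hν : IsVanishingCarleson ν)
    (hle : ∀ a ∈ unitDisc, carlesonQuotient ν' a ≤
      A * carlesonQuotient ν a + B * ENNReal.ofReal ((1 - ‖a‖) ^ q)) :
    IsVanishingCarleson ν' := by
  refine ⟨(carlesonSup_le_of_quotient_le hq hle).trans_lt ?_, ?_⟩
  · exact ENNReal.add_lt_top.2 ⟨ENNReal.mul_lt_top ENNReal.coe_lt_top hν.1, ENNReal.coe_lt_top⟩
  · have hn : Tendsto (fun a : ℂ => ‖a‖) (comap (fun a : ℂ => ‖a‖) (𝓝[<] (1 : ℝ))) (𝓝[<] 1) :=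
      tendsto_comap
    have h1 : Tendsto (fun x : ℝ => ENNReal.ofReal ((1 - x) ^ q)) (𝓝[<] 1) (𝓝 0) := by
      have hc : Continuous fun x : ℝ => ENNReal.ofReal ((1 - x) ^ q) :=
        ENNReal.continuous_ofReal.comp
          ((continuous_const.sub continuous_id).rpow_const fun x => Or.inr hq.le)
      have := (hc.tendsto 1).mono_left (nhdsWithin_le_nhds (s := Iio 1))
      simpa [Real.zero_rpow hq.ne'] using this
    have h2 := (ENNReal.Tendsto.const_mul (a := (A : ℝ≥0∞)) hν.2
      (Or.inr ENNReal.coe_ne_top)).add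
      (ENNReal.Tendsto.const_mul (a := (B : ℝ≥0∞)) (h1.comp hn) (Or.inr ENNReal.coe_ne_top))
    rw [mul_zero, mul_zero, add_zero] at h2
    refine tendsto_of_tendsto_of_tendsto_of_le_of_le' tendsto_const_nhds h2
      (Eventually.of_forall fun _ => zero_le) ?_
    filter_upwards [hn.eventually self_mem_nhdsWithin] with a ha
    exact hle a (mem_unitDisc.2 ha)

theorem two_mul_integral_pow_mul_one_sub_sq (n : ℕ) :
    2 * ∫ ρ in Ioo (0 : ℝ) 1, ρ ^ (2 * n + 1) * (1 - ρ ^ 2) ^ 2 =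
      2 / (((n : ℝ) + 1) * (n + 2) * (n + 3)) := by
  rw [← integral_Ioc_eq_integral_Ioo, ← intervalIntegral.integral_of_le zero_le_one]
  have e : ∀ ρ : ℝ, ρ ^ (2 * n + 1) * (1 - ρ ^ 2) ^ 2 =
      ρ ^ (2 * n + 1) - 2 * ρ ^ (2 * n + 3) + ρ ^ (2 * n + 5) := fun ρ => by ring
  simp_rw [e]
  rw [intervalIntegral.integral_add (by apply Continuous.intervalIntegrable; fun_prop)
      (by apply Continuous.intervalIntegrable; fun_prop),
    intervalIntegral.integral_sub (by apply Continuous.intervalIntegrable; fun_prop)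
      (by apply Continuous.intervalIntegrable; fun_prop),
    intervalIntegral.integral_const_mul, integral_pow, integral_pow, integral_pow]
  have h1 : (n : ℝ) + 1 ≠ 0 := by positivity
  have h2 : (n : ℝ) + 2 ≠ 0 := by positivity
  have h3 : (n : ℝ) + 3 ≠ 0 := by positivity
  push_cast
  rw [show 2 * (n : ℝ) + 1 + 1 = 2 * (n + 1) by ring, show 2 * (n : ℝ) + 3 + 1 = 2 * (n + 2) by ring,
    show 2 * (n : ℝ) + 5 + 1 = 2 * (n + 3) by ring]
  simp
  field_simp
  ring

theorem continuousOn_deriv_of_isAnalyticOnDisc {g : ℂ → ℂ} (hg : IsAnalyticOnDisc g) :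
    ContinuousOn (deriv g) unitDisc :=
  (isAnalyticOnDisc_deriv hg).continuousOn

theorem aemeasurable_deriv_mul {g : ℂ → ℂ} (hg : IsAnalyticOnDisc g) :
    AEMeasurable (fun ζ => ‖deriv g ζ‖ₑ * ENNReal.ofReal (1 - ‖ζ‖)) discArea :=
  (aemeasurable_discArea_of_continuousOn (continuousOn_deriv_of_isAnalyticOnDisc hg)).enorm.mul
    (by fun_prop)

theorem withDensity_deriv_le_bmoaMeasure (g : ℂ → ℂ) :
    (discArea.withDensity fun ζ => (‖deriv g ζ‖ₑ * ENNReal.ofReal (1 - ‖ζ‖)) ^ 2 *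
      ENNReal.ofReal (1 / (1 - ‖ζ‖))) ≤ bmoaMeasure g := by
  refine withDensity_mono ?_
  filter_upwards [ae_discArea_mem_unitDisc] with z hz
  have hz1 : 0 < 1 - ‖z‖ := by linarith [mem_unitDisc.1 hz]
  rw [mul_pow, ← ENNReal.ofReal_pow hz1.le, mul_assoc, ← ENNReal.ofReal_mul (by positivity)]
  refine mul_le_mul_right (ENNReal.ofReal_le_ofReal ?_) _
  have : (1 - ‖z‖) ^ 2 * (1 / (1 - ‖z‖)) = 1 - ‖z‖ := by field_simp
  rw [this]
  nlinarith [norm_nonneg z]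

theorem carlesonQuotient_mono {ν ν' : Measure ℂ} (h : ν ≤ ν') (a : ℂ) :
    carlesonQuotient ν a ≤ carlesonQuotient ν' a :=
  ENNReal.div_le_div_right (h _) _

theorem carlesonSup_mono {ν ν' : Measure ℂ} (h : ν ≤ ν') : carlesonSup ν ≤ carlesonSup ν' :=
  iSup₂_mono fun a _ => carlesonQuotient_mono h a

theorem IsVanishingCarleson.mono {ν ν' : Measure ℂ} (h : ν ≤ ν') (hν' : IsVanishingCarleson ν') :
    IsVanishingCarleson ν :=
  ⟨(carlesonSup_mono h).trans_lt hν'.1, tendsto_of_tendsto_of_tendsto_of_le_of_le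
    tendsto_const_nhds hν'.2 (fun _ => zero_le) (carlesonQuotient_mono h)⟩

section

variable {μ : ℝ → ℝ} {g : ℂ → ℂ}

theorem lintegral_deriv_mul_lt_top (hg : IsAnalyticOnDisc g) (hfin : bmoaMeasure g univ < ∞) :
    ∫⁻ ζ, ‖deriv g ζ‖ₑ * ENNReal.ofReal (1 - ‖ζ‖) ∂discArea < ∞ := by
  have h := (sq_lintegral_le_withDensity_univ (aemeasurable_deriv_mul hg)).trans
    (withDensity_deriv_le_bmoaMeasure g univ)
  by_contra hcon
  rw [not_lt_top_iff.1 hcon] at h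
  simp at h
  exact hfin.ne h

theorem enorm_deriv_mul_weight_le (g : ℂ → ℂ) {ζ : ℂ} (hζ : ζ ∈ unitDisc) :
    ‖deriv g ζ * (starRingEnd ℂ) ζ ^ 0 * (((1 - ‖ζ‖ ^ 2) ^ 2 : ℝ) : ℂ)‖ₑ ≤
      ‖deriv g ζ‖ₑ * ENNReal.ofReal (1 - ‖ζ‖) * ENNReal.ofReal (4 * (1 - ‖ζ‖)) := by
  have hζ1 : 0 < 1 - ‖ζ‖ := by linarith [mem_unitDisc.1 hζ]
  have h0 := norm_nonneg ζ
  rw [pow_zero, mul_one, enorm_mul, mul_assoc, ← ENNReal.ofReal_mul hζ1.le]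
  gcongr
  rw [← ofReal_norm, Complex.norm_real, Real.norm_of_nonneg (by positivity)]
  refine ENNReal.ofReal_le_ofReal ?_
  have : (1 - ‖ζ‖ ^ 2) ^ 2 = (1 - ‖ζ‖) ^ 2 * (1 + ‖ζ‖) ^ 2 := by ring
  have h2 : (1 + ‖ζ‖) ^ 2 ≤ 4 := by nlinarith
  rw [this]
  nlinarith [sq_nonneg (1 - ‖ζ‖)]

theorem two_mul_fracDeriv_sub (hμ : IsRadialWeight μ) (hg : IsAnalyticOnDisc g)
    (hfin : bmoaMeasure g univ < ∞) {z : ℂ} (hz : z ∈ unitDisc) :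
    2 * (fracDeriv μ g z - fracDeriv μ g 0) = z * ∫ ζ, deriv g ζ * (starRingEnd ℂ) ζ ^ 0 *
      (((1 - ‖ζ‖ ^ 2) ^ 2 : ℝ) : ℂ) * ∑' n : ℕ, (((n + 2) * (n + 3) /
        weightMoment μ (2 * (n + 1) + 1) : ℝ) : ℂ) * (z * (starRingEnd ℂ) ζ) ^ n ∂discArea := by
  have hinteg : Integrable (fun ζ => deriv g ζ * (starRingEnd ℂ) ζ ^ 0 *
      (((1 - ‖ζ‖ ^ 2) ^ 2 : ℝ) : ℂ)) discArea := by
    refine ⟨AEMeasurable.aestronglyMeasurable ?_, ?_⟩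
    · refine aemeasurable_discArea_of_continuousOn ?_
      refine ((continuousOn_deriv_of_isAnalyticOnDisc hg).mul
        (Complex.continuous_conj.pow 0).continuousOn).mul (Continuous.continuousOn ?_)
      fun_prop
    · have h4 : ∫⁻ ζ, ‖deriv g ζ‖ₑ * ENNReal.ofReal (1 - ‖ζ‖) * ENNReal.ofReal 4 ∂discArea < ∞ := by
        rw [lintegral_mul_const' _ _ ENNReal.ofReal_ne_top]
        exact ENNReal.mul_lt_top (lintegral_deriv_mul_lt_top hg hfin) ENNReal.ofReal_lt_top
      refine (lintegral_mono_ae (ae_discArea_mem_unitDisc.mono fun ζ hζ =>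
        (enorm_deriv_mul_weight_le g hζ).trans ?_)).trans_lt h4
      gcongr
      linarith [norm_nonneg ζ]
  have hrep := (hasSum_integral_kernel (w := fun ρ => (1 - ρ ^ 2) ^ 2)
    (fun z hz => hasSum_taylorCoeff (isAnalyticOnDisc_deriv hg) hz)
    (Continuous.continuousOn (by fun_prop)) 0 hinteg
    (k := fun n => ((n : ℝ) + 2) * (n + 3) / weightMoment μ (2 * (n + 1) + 1))
    (fun r h0 h1 => summable_quadratic_div_moment hμ h0 h1) hz).mul_left z
  have hfr := ((hasSum_nat_add_iff' 1).2 (hasSum_fracDeriv hμ hg hz)).mul_left 2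
  rw [Finset.sum_range_one, taylorCoeff_zero, pow_zero, mul_one] at hfr
  rw [fracDeriv_zero]
  refine hfr.unique ((funext fun n => ?_ : _ = fun n : ℕ => 2 * (taylorCoeff g (n + 1) /
    (weightMoment μ (2 * (n + 1) + 1) : ℂ) * z ^ (n + 1))) ▸ hrep)
  have hp : (weightMoment μ (2 * (n + 1) + 1) : ℂ) ≠ 0 := by
    exact_mod_cast (hμ.moment_pos _).ne'
  have h1 : (n : ℂ) + 1 ≠ 0 := by exact_mod_cast (by positivity : (n : ℝ) + 1 ≠ 0)
  have h2 : (n : ℂ) + 2 ≠ 0 := by exact_mod_cast (by positivity : (n : ℝ) + 2 ≠ 0)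
  have h3 : (n : ℂ) + 3 ≠ 0 := by exact_mod_cast (by positivity : (n : ℝ) + 3 ≠ 0)
  rw [add_zero, two_mul_integral_pow_mul_one_sub_sq, taylorCoeff_deriv]
  push_cast
  field_simp
  ring

theorem enorm_fracDeriv_sub_mul_le (hμ : IsRadialWeight μ) (hg : IsAnalyticOnDisc g)
    (hfin : bmoaMeasure g univ < ∞) {η C C' : ℝ} (hη0 : 0 < η) (hC : 0 < C) (hC' : 0 < C')
    (hK : ∀ w : ℂ, ‖w‖ < 1 →
      ‖∑' n : ℕ, (((n + 2) * (n + 3) / weightMoment μ (2 * (n + 1) + 1) : ℝ) : ℂ) * w ^ n‖ ≤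
        C / ((1 - ‖w‖) * weightTail μ ‖w‖) / ‖1 - w‖ ^ 2)
    (hT : ∀ s t : ℝ, 0 ≤ s → s ≤ t → t < 1 →
      weightTail μ t ≤ C' * ((1 - t) / (1 - s)) ^ η * weightTail μ s) {z : ℂ} (hz : z ∈ unitDisc) :
    ‖fracDeriv μ g z - fracDeriv μ g 0‖ₑ * ENNReal.ofReal (weightTail μ ‖z‖) ≤
      (Real.toNNReal (4 * C * C') : ℝ≥0∞) * (ENNReal.ofReal ((1 - ‖z‖) ^ η) *
      ∫⁻ ζ, ‖deriv g ζ‖ₑ * ENNReal.ofReal (1 - ‖ζ‖) *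
        ENNReal.ofReal ((1 - ‖ζ‖) ^ (-η) / ‖1 - z * (starRingEnd ℂ) ζ‖ ^ 2) ∂discArea) := by
  have hz1 : 0 < 1 - ‖z‖ := by linarith [mem_unitDisc.1 hz]
  have hker : ∀ ζ ∈ unitDisc, ENNReal.ofReal (weightTail μ ‖z‖) * ‖deriv g ζ *
      (starRingEnd ℂ) ζ ^ 0 * (((1 - ‖ζ‖ ^ 2) ^ 2 : ℝ) : ℂ) * ∑' n : ℕ, (((n + 2) * (n + 3) /
        weightMoment μ (2 * (n + 1) + 1) : ℝ) : ℂ) * (z * (starRingEnd ℂ) ζ) ^ n‖ₑ ≤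
      ENNReal.ofReal (4 * C * C' * (1 - ‖z‖) ^ η) *
      (‖deriv g ζ‖ₑ * ENNReal.ofReal (1 - ‖ζ‖) *
        ENNReal.ofReal ((1 - ‖ζ‖) ^ (-η) / ‖1 - z * (starRingEnd ℂ) ζ‖ ^ 2)) := by
    intro ζ hζ
    have hζ1 : 0 < 1 - ‖ζ‖ := by linarith [mem_unitDisc.1 hζ]
    have hlt1 := norm_mul_conj_lt hz hζ
    set v := ‖z * (starRingEnd ℂ) ζ‖ with hvdef
    have hv : 0 < 1 - v := by linarith
    have hzv : v ≤ ‖z‖ := norm_mul_conj_le_left (z := z) hζ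
    have hζv : 1 - ‖ζ‖ ≤ 1 - v := by
      linarith [norm_mul_conj_le_right (ζ := ζ) hz]
    have hκ : 0 < ‖1 - z * (starRingEnd ℂ) ζ‖ :=
      hz1.trans_le (one_sub_norm_le_norm_one_sub_mul_conj hζ)
    have hpz : 0 < (1 - ‖z‖) ^ η := Real.rpow_pos_of_pos hz1 _
    have hpζ : 0 < (1 - ‖ζ‖) ^ (-η) := Real.rpow_pos_of_pos hζ1 _
    have hv0 : 0 ≤ v := norm_nonneg _
    have htv := hμ.tail_pos' (r := v) ⟨hv0, hlt1⟩
    have htz := hμ.tail_nonneg (norm_nonneg z)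
    have hd := div_rpow_le_rpow_mul_rpow_neg hz1 hζ1 hζv hη0
    rw [enorm_mul, mul_left_comm, mul_left_comm (ENNReal.ofReal (4 * C * C' * _))]
    refine (mul_le_mul_left (enorm_deriv_mul_weight_le g hζ) _).trans ?_
    rw [mul_assoc]
    refine mul_le_mul_right ?_ _
    rw [← ofReal_norm, ← ENNReal.ofReal_mul htz, ← ENNReal.ofReal_mul (by positivity),
      ← ENNReal.ofReal_mul (by positivity)]
    refine ENNReal.ofReal_le_ofReal ?_
    calc _ ≤ 4 * (1 - ‖ζ‖) * ((C' * ((1 - ‖z‖) / (1 - v)) ^ η * weightTail μ v) *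
            (C / ((1 - v) * weightTail μ v) / ‖1 - z * (starRingEnd ℂ) ζ‖ ^ 2)) := by
          have a1 := hT v ‖z‖ hv0 hzv (by linarith)
          have a2 := hK _ hlt1
          have a3 : 0 ≤ C' * ((1 - ‖z‖) / (1 - v)) ^ η * weightTail μ v := htz.trans a1
          gcongr
      _ = 4 * C * C' * ((1 - ‖ζ‖) / (1 - v)) * ((1 - ‖z‖) / (1 - v)) ^ η /
            ‖1 - z * (starRingEnd ℂ) ζ‖ ^ 2 := by
          field_simp
      _ ≤ 4 * C * C' * 1 * ((1 - ‖z‖) ^ η * (1 - ‖ζ‖) ^ (-η)) /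
            ‖1 - z * (starRingEnd ℂ) ζ‖ ^ 2 := by
          have := (div_le_one hv).2 hζv
          gcongr
      _ = _ := by ring
  have h2 : ENNReal.ofReal (weightTail μ ‖z‖) *
      ‖2 * (fracDeriv μ g z - fracDeriv μ g 0)‖ₑ ≤
      ENNReal.ofReal (4 * C * C' * (1 - ‖z‖) ^ η) *
      ∫⁻ ζ, ‖deriv g ζ‖ₑ * ENNReal.ofReal (1 - ‖ζ‖) *
        ENNReal.ofReal ((1 - ‖ζ‖) ^ (-η) / ‖1 - z * (starRingEnd ℂ) ζ‖ ^ 2) ∂discArea := by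
    rw [two_mul_fracDeriv_sub hμ hg hfin hz, enorm_mul]
    have hzle : ‖z‖ₑ ≤ 1 := by
      rw [← ofReal_norm, ENNReal.ofReal_le_one]
      linarith
    refine (mul_le_mul_right (mul_le_of_le_one_left' hzle) _).trans ?_
    refine (mul_le_mul_right (enorm_integral_le_lintegral_enorm _) _).trans ?_
    rw [← lintegral_const_mul' _ _ ENNReal.ofReal_ne_top,
      ← lintegral_const_mul' _ _ ENNReal.ofReal_ne_top]
    exact lintegral_mono_ae (ae_discArea_mem_unitDisc.mono hker)
  have e2 : ‖fracDeriv μ g z - fracDeriv μ g 0‖ₑ ≤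
      ‖2 * (fracDeriv μ g z - fracDeriv μ g 0)‖ₑ := by
    rw [enorm_mul, ← ofReal_norm (2 : ℂ)]
    refine le_mul_of_one_le_left' ?_
    simp
  rw [mul_comm]
  refine (mul_le_mul_right e2 _).trans (h2.trans_eq ?_)
  rw [ENNReal.ofReal_mul (by positivity), mul_assoc]
  rfl

theorem lintegral_carlesonSquare_tail_sq_le (hμ : IsRadialWeight μ) {η C' : ℝ} (hη0 : 0 < η)
    (hC' : 0 < C') (hT : ∀ s t : ℝ, 0 ≤ s → s ≤ t → t < 1 →
      weightTail μ t ≤ C' * ((1 - t) / (1 - s)) ^ η * weightTail μ s) {a : ℂ} (ha : a ∈ unitDisc) :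
    ∫⁻ z in carlesonSquare a,
      ENNReal.ofReal (weightTail μ ‖z‖) ^ 2 * ENNReal.ofReal (1 / (1 - ‖z‖)) ∂discArea ≤
      ENNReal.ofReal (1 - ‖a‖) * (ENNReal.ofReal ((C' * weightTail μ 0) ^ 2 / η) *
        ENNReal.ofReal ((1 - ‖a‖) ^ (2 * η))) := by
  have h0 := hμ.tail_nonneg le_rfl
  have ha1 := mem_unitDisc.1 ha
  have hpt : ∀ z ∈ carlesonSquare a, ENNReal.ofReal (weightTail μ ‖z‖) ^ 2 *
      ENNReal.ofReal (1 / (1 - ‖z‖)) ≤ ENNReal.ofReal ((C' * weightTail μ 0) ^ 2) *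
        ENNReal.ofReal ((1 - ‖z‖) ^ (-(1 - 2 * η))) := by
    intro z hz
    have hz1 : 0 < 1 - ‖z‖ := by linarith [mem_unitDisc.1 hz.1]
    have ht := hT 0 ‖z‖ le_rfl (norm_nonneg z) (by linarith)
    have htz := hμ.tail_nonneg (norm_nonneg z)
    rw [sub_zero, div_one] at ht
    rw [← ENNReal.ofReal_pow htz, ← ENNReal.ofReal_mul (by positivity),
      ← ENNReal.ofReal_mul (by positivity)]
    refine ENNReal.ofReal_le_ofReal ?_
    rw [show -(1 - 2 * η) = η + η - 1 by ring, Real.rpow_sub_one hz1.ne', Real.rpow_add hz1]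
    calc _ ≤ (C' * (1 - ‖z‖) ^ η * weightTail μ 0) ^ 2 * (1 / (1 - ‖z‖)) := by gcongr
      _ = _ := by ring
  refine (setLIntegral_mono' (measurableSet_carlesonSquare a) hpt).trans ?_
  rw [lintegral_const_mul' _ _ ENNReal.ofReal_ne_top]
  refine (mul_le_mul_right (lintegral_carlesonSquare_radial_le ha
    (φ := fun ρ => ENNReal.ofReal ((1 - ρ) ^ (-(1 - 2 * η)))) (by fun_prop)) _).trans ?_
  rw [lintegral_const_mul' _ _ (by simp), mul_left_comm]
  refine mul_le_mul_right ?_ _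
  refine (mul_le_mul_right (mul_le_mul_right
    (lintegral_one_sub_rpow_le (by linarith) ha1.le) _) _).trans_eq ?_
  rw [sub_sub_cancel, show (2 : ℝ≥0∞) = ENNReal.ofReal 2 by simp,
    ← ENNReal.ofReal_mul (by norm_num), ← ENNReal.ofReal_mul (by positivity),
    ← ENNReal.ofReal_mul (by positivity)]
  congr 1
  field_simp

theorem exists_carlesonSup_bmoaWeightMeasure_le (hμ : IsRadialWeight μ) (h : IsRadialDoubling μ) :
    ∃ C : ℝ≥0, ∀ g, IsAnalyticOnDisc g → IsCarleson (bmoaMeasure g) →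
      carlesonSup (bmoaWeightMeasure μ g) ≤ C * (‖g 0‖ₑ ^ 2 + carlesonSup (bmoaMeasure g)) ∧
      (IsVanishingCarleson (bmoaMeasure g) → IsVanishingCarleson (bmoaWeightMeasure μ g)) := by
  obtain ⟨C, hC0, hK⟩ := exists_norm_tsum_kernel_le hμ h.1
  obtain ⟨η, C', hη0, hη1, hC', hT⟩ := hμ.exists_tail_le_rpow h.2
  obtain ⟨D, hD⟩ := carleson_of_le_integralOperator hη0 hη1 (Real.toNNReal (4 * C * C')) 1
  set E : ℝ≥0 := Real.toNNReal ((C' * weightTail μ 0) ^ 2 / η) with hE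
  set M : ℝ≥0 := Real.toNNReal (weightMoment μ 1) with hM
  have hM0 : M ≠ 0 := by simpa [hM] using hμ.moment_pos 1
  refine ⟨2 * D + 2 * E / M ^ 2, fun g hg hcar => ?_⟩
  have hfin : bmoaMeasure g univ < ∞ :=
    (measure_univ_le_carlesonSup (bmoaMeasure_compl g)).trans_lt hcar
  set ν₁ : Measure ℂ := discArea.withDensity fun z =>
    (‖fracDeriv μ g z - fracDeriv μ g 0‖ₑ * ENNReal.ofReal (weightTail μ ‖z‖)) ^ 2 *
      ENNReal.ofReal (1 / (1 - ‖z‖)) with hν₁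
  obtain ⟨hs, hv⟩ := hD (fun ζ => ‖deriv g ζ‖ₑ * ENNReal.ofReal (1 - ‖ζ‖))
    (fun z => ‖fracDeriv μ g z - fracDeriv μ g 0‖ₑ * ENNReal.ofReal (weightTail μ ‖z‖)) ν₁
    (aemeasurable_deriv_mul hg)
    (fun z hz => enorm_fracDeriv_sub_mul_le hμ hg hfin hη0 hC0 hC' hK hT hz) fun a _ => by
      rw [hν₁, withDensity_apply _ (measurableSet_carlesonSquare a)]
      simp
  set B : ℝ≥0 := 2 * ‖fracDeriv μ g 0‖₊ ^ 2 * E with hB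
  have hq : ∀ a ∈ unitDisc, carlesonQuotient (bmoaWeightMeasure μ g) a ≤
      (2 : ℝ≥0) * carlesonQuotient ν₁ a + B * ENNReal.ofReal ((1 - ‖a‖) ^ (2 * η)) := by
    intro a ha
    have ha1 : 0 < 1 - ‖a‖ := by linarith [mem_unitDisc.1 ha]
    have hpos : ENNReal.ofReal (1 - ‖a‖) ≠ 0 := by simpa using ha1
    rw [carlesonQuotient, ENNReal.div_le_iff hpos ENNReal.ofReal_ne_top, add_mul, mul_assoc,
      ← measure_le_carlesonQuotient ν₁ ha, bmoaWeightMeasure_eq hμ,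
      withDensity_apply _ (measurableSet_carlesonSquare a), hν₁,
      withDensity_apply _ (measurableSet_carlesonSquare a)]
    have hpt : ∀ z, (‖fracDeriv μ g z‖ₑ * ENNReal.ofReal (weightTail μ ‖z‖)) ^ 2 *
        ENNReal.ofReal (1 / (1 - ‖z‖)) ≤
        (2 : ℝ≥0) * ((‖fracDeriv μ g z - fracDeriv μ g 0‖ₑ * ENNReal.ofReal (weightTail μ ‖z‖)) ^ 2 *
          ENNReal.ofReal (1 / (1 - ‖z‖))) + (2 * ‖fracDeriv μ g 0‖ₑ ^ 2) *
          (ENNReal.ofReal (weightTail μ ‖z‖) ^ 2 * ENNReal.ofReal (1 / (1 - ‖z‖))) := by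
      intro z
      have h1 : ‖fracDeriv μ g z‖ₑ ^ 2 ≤ 2 * ‖fracDeriv μ g z - fracDeriv μ g 0‖ₑ ^ 2 +
          2 * ‖fracDeriv μ g 0‖ₑ ^ 2 := by
        have h3 : ‖fracDeriv μ g z‖ ^ 2 ≤ 2 * ‖fracDeriv μ g z - fracDeriv μ g 0‖ ^ 2 +
          2 * ‖fracDeriv μ g 0‖ ^ 2 := by
          have h4 := norm_le_norm_sub_add (fracDeriv μ g z) (fracDeriv μ g 0)
          nlinarith [norm_nonneg (fracDeriv μ g z), sq_nonneg
            (‖fracDeriv μ g z - fracDeriv μ g 0‖ - ‖fracDeriv μ g 0‖)]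
        have h5 := ENNReal.ofReal_le_ofReal h3
        rwa [ENNReal.ofReal_add (by positivity) (by positivity), ENNReal.ofReal_mul (by norm_num),
          ENNReal.ofReal_mul (by norm_num), ENNReal.ofReal_pow (norm_nonneg _),
          ENNReal.ofReal_pow (norm_nonneg _), ENNReal.ofReal_pow (norm_nonneg _), ofReal_norm,
          ofReal_norm, ofReal_norm, ENNReal.ofReal_ofNat] at h5
      calc _ = ‖fracDeriv μ g z‖ₑ ^ 2 * (ENNReal.ofReal (weightTail μ ‖z‖) ^ 2 *
            ENNReal.ofReal (1 / (1 - ‖z‖))) := by rw [mul_pow, mul_assoc]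
        _ ≤ _ := mul_le_mul_left h1 _
        _ = _ := by
            push_cast
            ring
    refine (lintegral_mono hpt).trans ?_
    have hm : AEMeasurable (fun z : ℂ => ENNReal.ofReal (weightTail μ ‖z‖) ^ 2 *
        ENNReal.ofReal (1 / (1 - ‖z‖))) discArea :=
      ((aemeasurable_discArea_of_continuousOn
        (continuousOn_tail_norm hμ)).ennreal_ofReal.pow_const 2).mul (by fun_prop)
    rw [lintegral_add_right' _ (hm.restrict.const_mul _), lintegral_const_mul' _ _ ENNReal.coe_ne_top,
      lintegral_const_mul' _ _ (ENNReal.mul_ne_top (by simp) (by simp))]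
    refine add_le_add le_rfl ?_
    refine (mul_le_mul_right (lintegral_carlesonSquare_tail_sq_le hμ hη0 hC' hT ha) _).trans_eq ?_
    rw [hB]
    push_cast
    rw [show ENNReal.ofReal ((C' * weightTail μ 0) ^ 2 / η) = (E : ℝ≥0∞) from rfl,
      show (‖fracDeriv μ g 0‖₊ : ℝ≥0∞) = ‖fracDeriv μ g 0‖ₑ from rfl]
    ring
  have hle := withDensity_deriv_le_bmoaMeasure g
  constructor
  · have hfr : ‖fracDeriv μ g 0‖ₑ ^ 2 = ‖g 0‖ₑ ^ 2 / (M : ℝ≥0∞) ^ 2 := by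
      have hMn : M = ‖(weightMoment μ 1 : ℂ)‖₊ := by
        rw [← NNReal.coe_inj, hM, Real.coe_toNNReal _ (hμ.moment_pos 1).le, coe_nnnorm,
          Complex.norm_real, Real.norm_of_nonneg (hμ.moment_pos 1).le]
      rw [fracDeriv_zero, ← enorm_pow, div_pow, enorm_eq_nnnorm, nnnorm_div, nnnorm_pow, nnnorm_pow,
        ← hMn, ENNReal.coe_div (pow_ne_zero 2 hM0)]
      push_cast
      rfl
    refine (carlesonSup_le_of_quotient_le (by positivity) hq).trans ?_
    have hs' := hs.trans (mul_le_mul_right (carlesonSup_mono hle) _)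
    rw [hB]
    push_cast
    rw [show (‖fracDeriv μ g 0‖₊ : ℝ≥0∞) = ‖fracDeriv μ g 0‖ₑ from rfl, hfr,
      ENNReal.coe_div (pow_ne_zero 2 hM0)]
    push_cast
    calc _ ≤ 2 * (D * carlesonSup (bmoaMeasure g)) + 2 * (‖g 0‖ₑ ^ 2 / (M : ℝ≥0∞) ^ 2) * E := by
          gcongr
      _ = 2 * D * carlesonSup (bmoaMeasure g) + 2 * E / (M : ℝ≥0∞) ^ 2 * ‖g 0‖ₑ ^ 2 := by
          simp only [div_eq_mul_inv]
          ring
      _ ≤ (2 * D + 2 * E / (M : ℝ≥0∞) ^ 2) * carlesonSup (bmoaMeasure g) +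
          (2 * D + 2 * E / (M : ℝ≥0∞) ^ 2) * ‖g 0‖ₑ ^ 2 := by
          gcongr
          · exact le_self_add
          · exact le_add_self
      _ = _ := by ring
  · exact fun hvan => (hv (hvan.mono hle)).of_quotient_le (by positivity) hq

theorem VMOA_subset_weightVMOA (hμ : IsRadialWeight μ) (h : IsRadialDoubling μ) :
    VMOA ⊆ weightVMOA μ := by
  obtain ⟨C, hC⟩ := exists_carlesonSup_bmoaWeightMeasure_le hμ h
  exact fun g hg => ⟨hg.1, (hC g hg.1 hg.2.1).2 hg.2⟩

theorem bmoaWeightNorm_dominatedOn (hμ : IsRadialWeight μ) (h : IsRadialDoubling μ) :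
    DominatedOn {g | IsAnalyticOnDisc g} (bmoaWeightNorm μ) bmoaNorm := by
  obtain ⟨C, hC⟩ := exists_carlesonSup_bmoaWeightMeasure_le hμ h
  refine ⟨(C + 1) ^ (1 / 2 : ℝ), NNReal.rpow_pos (by positivity), fun g hg => ?_⟩
  rw [bmoaNorm, bmoaWeightNorm, ENNReal.coe_rpow_of_nonneg _ (by norm_num),
    ← ENNReal.mul_rpow_of_nonneg _ _ (by norm_num)]
  refine ENNReal.rpow_le_rpow ?_ (by norm_num)
  by_cases hcar : IsCarleson (bmoaMeasure g)
  · refine (hC g hg hcar).1.trans ?_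
    gcongr
    exact_mod_cast le_self_add
  · rw [IsCarleson, not_lt_top_iff] at hcar
    rw [hcar, add_top, ENNReal.mul_top (by positivity)]
    exact le_top

end

/-! ### Testing on monomials -/

theorem isAnalyticOnDisc_pow (n : ℕ) : IsAnalyticOnDisc fun z => z ^ n :=
  (differentiable_pow n).differentiableOn

theorem fracDeriv_pow (μ : ℝ → ℝ) (n : ℕ) (z : ℂ) :
    fracDeriv μ (fun w => w ^ n) z = z ^ n / (weightMoment μ (2 * n + 1) : ℂ) := by
  have hn : ((n.factorial : ℕ) : ℂ) ≠ 0 := by exact_mod_cast n.factorial_ne_zero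
  rw [fracDeriv, tsum_eq_single n fun k hk => ?_]
  · rw [taylorCoeff, iteratedDeriv_fun_pow_zero, if_pos rfl, div_self hn]
    ring
  · rw [taylorCoeff, iteratedDeriv_fun_pow_zero, if_neg hk]
    simp

theorem carlesonQuotient_bmoaMeasure_pow_le (n : ℕ) {a : ℂ} (ha : a ∈ unitDisc) :
    carlesonQuotient (bmoaMeasure fun z => z ^ (n + 1)) a ≤ ∫⁻ ρ in Ioo ‖a‖ 1,
      ENNReal.ofReal (2 * (n + 1) ^ 2 * (ρ ^ (2 * n) * (1 - ρ ^ 2))) := by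
  have ha1 : 0 < 1 - ‖a‖ := by linarith [mem_unitDisc.1 ha]
  have hpos : ENNReal.ofReal (1 - ‖a‖) ≠ 0 := by simpa using ha1
  rw [carlesonQuotient, ENNReal.div_le_iff' hpos ENNReal.ofReal_ne_top, bmoaMeasure,
    withDensity_apply _ (measurableSet_carlesonSquare a)]
  have e : ∀ z : ℂ, ‖deriv (fun z : ℂ => z ^ (n + 1)) z‖ₑ ^ 2 * ENNReal.ofReal (1 - ‖z‖ ^ 2) =
      ENNReal.ofReal (((n : ℝ) + 1) ^ 2 * (‖z‖ ^ (2 * n) * (1 - ‖z‖ ^ 2))) := fun z => by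
    rw [deriv_pow_field, ← ofReal_norm, ← ENNReal.ofReal_pow (norm_nonneg _),
      ← ENNReal.ofReal_mul (by positivity)]
    congr 1
    rw [norm_mul, norm_pow, Complex.norm_natCast, Nat.add_sub_cancel]
    push_cast
    ring
  simp_rw [e]
  refine (lintegral_carlesonSquare_radial_le ha (φ := fun ρ =>
    ENNReal.ofReal (((n : ℝ) + 1) ^ 2 * (ρ ^ (2 * n) * (1 - ρ ^ 2)))) (by fun_prop)).trans_eq ?_
  congr 1
  refine lintegral_congr fun ρ => ?_
  rw [show (2 : ℝ≥0∞) = ENNReal.ofReal 2 by simp, ← ENNReal.ofReal_mul (by norm_num), mul_assoc]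

theorem pow_mem_VMOA (n : ℕ) : (fun z : ℂ => z ^ (n + 1)) ∈ VMOA := by
  refine ⟨isAnalyticOnDisc_pow _, IsVanishingCarleson.of_quotient_le (ν := 0) (A := 0)
    (B := 2 * (n + 1) ^ 2) one_pos ⟨?_, ?_⟩ fun a ha =>
      (carlesonQuotient_bmoaMeasure_pow_le n ha).trans ?_⟩
  · simp [IsCarleson, carlesonSup, carlesonQuotient]
  · have : carlesonQuotient 0 = fun _ => 0 := funext fun a => by simp [carlesonQuotient]
    rw [this]
    exact tendsto_const_nhds
  · rw [ENNReal.coe_zero, zero_mul, zero_add, Real.rpow_one]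
    calc _ ≤ ∫⁻ ρ in Ioo ‖a‖ 1, ((2 * (n + 1) ^ 2 : ℝ≥0) : ℝ≥0∞) := by
          refine setLIntegral_mono' measurableSet_Ioo fun ρ hρ => ?_
          rw [← ENNReal.ofReal_coe_nnreal]
          refine ENNReal.ofReal_le_ofReal ?_
          have h0 : 0 ≤ ρ := (norm_nonneg a).trans hρ.1.le
          have h1 := pow_le_one₀ (n := 2 * n) h0 hρ.2.le
          have h2 : ρ ^ (2 * n) * (1 - ρ ^ 2) ≤ 1 :=
            mul_le_one₀ h1 (by nlinarith [hρ.2]) (by nlinarith)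
          push_cast
          exact mul_le_of_le_one_right (by positivity) h2
      _ = _ := by
          rw [setLIntegral_const, Real.volume_Ioo]

theorem bmoaNorm_pow_le (n : ℕ) : bmoaNorm (fun z => z ^ (n + 1)) ≤ 2 := by
  have hs : carlesonSup (bmoaMeasure fun z => z ^ (n + 1)) ≤ 4 := by
    refine iSup₂_le fun a ha => (carlesonQuotient_bmoaMeasure_pow_le n ha).trans ?_
    refine (lintegral_mono_set (Ioo_subset_Ioo_left (norm_nonneg a))).trans ?_
    have hinteg : IntegrableOn (fun ρ : ℝ => 2 * ((n : ℝ) + 1) ^ 2 * (ρ ^ (2 * n) * (1 - ρ ^ 2)))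
        (Ioo 0 1) :=
      ((Continuous.integrableOn_Icc (by fun_prop)).mono_set Ioo_subset_Icc_self)
    rw [← ofReal_integral_eq_lintegral_ofReal hinteg ?_]
    · rw [← ENNReal.ofReal_ofNat]
      refine ENNReal.ofReal_le_ofReal ?_
      rw [← integral_Ioc_eq_integral_Ioo, ← intervalIntegral.integral_of_le zero_le_one,
        intervalIntegral.integral_const_mul]
      have e : ∀ ρ : ℝ, ρ ^ (2 * n) * (1 - ρ ^ 2) = ρ ^ (2 * n) - ρ ^ (2 * n + 2) :=
        fun ρ => by ring
      simp_rw [e]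
      rw [intervalIntegral.integral_sub (by apply Continuous.intervalIntegrable; fun_prop)
        (by apply Continuous.intervalIntegrable; fun_prop), integral_pow, integral_pow]
      have hn : (0 : ℝ) ≤ n := Nat.cast_nonneg n
      simp
      rw [inv_eq_one_div, inv_eq_one_div, div_sub_div _ _ (by positivity) (by positivity),
        mul_div_assoc', div_le_iff₀ (by positivity)]
      nlinarith
    · filter_upwards [ae_restrict_mem measurableSet_Ioo] with ρ hρ
      have h0 := hρ.1
      have : 0 ≤ 1 - ρ ^ 2 := by nlinarith [hρ.2]
      simp only [Pi.zero_apply]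
      positivity
  rw [bmoaNorm]
  refine (ENNReal.rpow_le_rpow (z := 1 / 2) (y := 4) ?_ (by norm_num)).trans_eq ?_
  · simpa using hs
  · rw [show (4 : ℝ≥0∞) = 2 ^ (2 : ℝ) by norm_num, ← ENNReal.rpow_mul]
    norm_num

theorem lintegral_tail_sq_le_carlesonSup {μ : ℝ → ℝ} (hμ : IsRadialWeight μ) (n : ℕ) :
    ∫⁻ ρ in Ioo (0 : ℝ) 1, ENNReal.ofReal (ρ ^ (2 * n + 1) * weightTail μ ρ ^ 2 / (1 - ρ)) ≤
      ENNReal.ofReal (weightMoment μ (2 * n + 1) ^ 2) *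
        carlesonSup (bmoaWeightMeasure μ fun z => z ^ n) := by
  have hM := hμ.moment_pos (2 * n + 1)
  refine le_trans ?_ (mul_le_mul_right (measure_univ_le_carlesonSup
    (bmoaWeightMeasure_compl μ _)) _)
  rw [bmoaWeightMeasure, withDensity_apply _ MeasurableSet.univ, Measure.restrict_univ,
    ← lintegral_const_mul' _ _ ENNReal.ofReal_ne_top]
  set T : ℝ → ℝ := fun r => weightTail μ (max 0 (min r 1)) with hT
  have hTc : Continuous T := hμ.continuousOn_tail.comp_continuous (by fun_prop) fun r =>
    ⟨le_max_left _ _, max_le zero_le_one (min_le_right _ _)⟩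
  have hTe : ∀ r, 0 ≤ r → r < 1 → T r = weightTail μ r := fun r h0 h1 => by
    simp only [hT]
    rw [min_eq_left h1.le, max_eq_right h0]
  have e : ∀ z ∈ unitDisc, ENNReal.ofReal (weightMoment μ (2 * n + 1) ^ 2) *
      (‖fracDeriv μ (fun w => w ^ n) z‖ₑ ^ 2 *
        ENNReal.ofReal (weightTail μ ‖z‖ ^ 2 / (1 - ‖z‖))) =
      ENNReal.ofReal (‖z‖ ^ (2 * n) * T ‖z‖ ^ 2 / (1 - ‖z‖)) := fun z hz => by
    rw [hTe _ (norm_nonneg z) (mem_unitDisc.1 hz), fracDeriv_pow, ← ofReal_norm,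
      ← ENNReal.ofReal_pow (norm_nonneg _), ← ENNReal.ofReal_mul (by positivity),
      ← ENNReal.ofReal_mul (by positivity), norm_div, Complex.norm_real,
      Real.norm_of_nonneg hM.le, norm_pow]
    congr 1
    field_simp
    ring
  rw [lintegral_congr_ae (ae_discArea_mem_unitDisc.mono e),
    lintegral_discArea_polar (by fun_prop)]
  refine setLIntegral_mono' measurableSet_Ioo fun ρ hρ => ?_
  simp_rw [norm_circleMap_of_mem hρ]
  have h0 := hρ.1
  have h1 : 0 < 1 - ρ := by linarith [hρ.2]
  have hp := Real.pi_pos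
  rw [setLIntegral_const, Real.volume_Ioo, hTe ρ hρ.1.le hρ.2,
    ← ENNReal.ofReal_mul (by positivity), ← ENNReal.ofReal_mul (by positivity)]
  refine ENNReal.ofReal_le_ofReal ?_
  calc _ ≤ 2 * (ρ ^ (2 * n + 1) * weightTail μ ρ ^ 2 / (1 - ρ)) := by
        have : 0 ≤ ρ ^ (2 * n + 1) * weightTail μ ρ ^ 2 / (1 - ρ) := by positivity
        linarith
    _ = _ := by
        field_simp
        ring

theorem exists_lintegral_tail_sq_le {μ : ℝ → ℝ} (hμ : IsRadialWeight μ)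
    (h : DominatedOn VMOA (bmoaWeightNorm μ) bmoaNorm) :
    ∃ C : ℝ, 0 < C ∧ ∀ n : ℕ, ∫⁻ ρ in Ioo (0 : ℝ) 1,
      ENNReal.ofReal (ρ ^ (2 * n + 3) * weightTail μ ρ ^ 2 / (1 - ρ)) ≤
        ENNReal.ofReal (C * weightMoment μ (2 * n + 3) ^ 2) := by
  obtain ⟨C, hC, hd⟩ := h
  refine ⟨(C * 2) ^ 2, by positivity, fun n => ?_⟩
  have h1 := (hd _ (pow_mem_VMOA n)).trans (mul_le_mul_right (bmoaNorm_pow_le n) _)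
  have h2 : carlesonSup (bmoaWeightMeasure μ fun z => z ^ (n + 1)) ≤ (C * 2) ^ 2 := by
    have h3 := ENNReal.rpow_le_rpow h1 (z := 2) (by norm_num)
    rw [bmoaWeightNorm, ← ENNReal.rpow_mul] at h3
    norm_num at h3
    exact h3
  refine (lintegral_tail_sq_le_carlesonSup hμ (n + 1)).trans ?_
  rw [mul_comm (((C : ℝ) * 2) ^ 2), ENNReal.ofReal_mul (by positivity)]
  refine mul_le_mul_right (h2.trans_eq ?_) _
  rw [ENNReal.ofReal_pow (by positivity), ENNReal.ofReal_mul (by positivity)]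
  simp

section

variable {μ : ℝ → ℝ} {C : ℝ}

theorem pow_mul_tail_sq_mul_log_le (hμ : IsRadialWeight μ)
    (h : ∀ n : ℕ, ∫⁻ ρ in Ioo (0 : ℝ) 1,
      ENNReal.ofReal (ρ ^ (2 * n + 3) * weightTail μ ρ ^ 2 / (1 - ρ)) ≤
        ENNReal.ofReal (C * weightMoment μ (2 * n + 3) ^ 2)) (hC : 0 < C) (n : ℕ) {a b : ℝ}
    (ha : 0 ≤ a) (hab : a ≤ b) (hb : b < 1) :
    a ^ (2 * n + 3) * weightTail μ b ^ 2 * Real.log ((1 - a) / (1 - b)) ≤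
      C * weightMoment μ (2 * n + 3) ^ 2 := by
  rw [← ENNReal.ofReal_le_ofReal_iff (by positivity)]
  refine le_trans ?_ (h n)
  have hinteg : IntegrableOn (fun ρ : ℝ => a ^ (2 * n + 3) * weightTail μ b ^ 2 * (1 - ρ)⁻¹)
      (Ioo a b) := by
    refine (ContinuousOn.integrableOn_Icc (ContinuousOn.mul continuousOn_const
      (ContinuousOn.inv₀ (by fun_prop) fun ρ hρ => ?_))).mono_set Ioo_subset_Icc_self
    linarith [hρ.2]
  have e : a ^ (2 * n + 3) * weightTail μ b ^ 2 * Real.log ((1 - a) / (1 - b)) =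
      ∫ ρ in Ioo a b, a ^ (2 * n + 3) * weightTail μ b ^ 2 * (1 - ρ)⁻¹ := by
    rw [integral_const_mul, ← integral_Ioc_eq_integral_Ioo, ← intervalIntegral.integral_of_le hab,
      intervalIntegral.integral_comp_sub_left (fun x : ℝ => x⁻¹),
      integral_inv_of_pos (by linarith) (by linarith)]
  rw [e, ofReal_integral_eq_lintegral_ofReal hinteg]
  · refine (setLIntegral_mono' measurableSet_Ioo fun ρ hρ => ?_).trans
      (lintegral_mono_set (Ioo_subset_Ioo ha hb.le))
    refine ENNReal.ofReal_le_ofReal ?_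
    have h1 : 0 < 1 - ρ := by linarith [hρ.2]
    have h2 : 0 ≤ ρ := ha.trans hρ.1.le
    have h3 := hμ.tail_anti h2 hρ.2.le
    have h4 := hμ.tail_nonneg (h2.trans hρ.2.le)
    rw [div_eq_mul_inv]
    have h5 := hρ.1.le
    gcongr
  · filter_upwards [ae_restrict_mem measurableSet_Ioo] with ρ hρ
    have h1 : 0 < 1 - ρ := by linarith [hρ.2]
    simp only [Pi.zero_apply]
    positivity

theorem tail_mul_pow_le_of_testing (hμ : IsRadialWeight μ)
    (h : ∀ n : ℕ, ∫⁻ ρ in Ioo (0 : ℝ) 1,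
      ENNReal.ofReal (ρ ^ (2 * n + 3) * weightTail μ ρ ^ 2 / (1 - ρ)) ≤
        ENNReal.ofReal (C * weightMoment μ (2 * n + 3) ^ 2)) (hC : 0 < C) (m : ℕ) {ρ : ℝ}
    (hρ : ρ ∈ Ioo (0 : ℝ) 1) :
    ρ ^ (6 * (m + 1) + 2) * weightTail μ ρ ≤
      Real.sqrt (3 * C) * weightMoment μ (8 * (m + 1) + 1) := by
  obtain ⟨σ, hσ0, rfl⟩ : ∃ σ : ℝ, 0 < σ ∧ σ ^ 2 = ρ :=
    ⟨Real.sqrt ρ, Real.sqrt_pos.2 hρ.1, Real.sq_sqrt hρ.1.le⟩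
  have hσ1 : σ < 1 := by nlinarith [hρ.2]
  have hM := hμ.moment_pos (8 * (m + 1) + 1)
  have h2 : σ ^ 3 ≤ σ ^ 2 := pow_le_pow_of_le_one hσ0.le hσ1.le (by norm_num)
  have h1 := pow_mul_tail_sq_mul_log_le hμ h hC (4 * m + 3) (a := σ ^ 3) (b := σ ^ 2)
    (by positivity) h2 hρ.2
  rw [show 2 * (4 * m + 3) + 3 = 8 * (m + 1) + 1 by ring] at h1
  have h3 : 0 < 1 - σ ^ 2 := by linarith [hρ.2]
  have h4 : 0 < 1 - σ ^ 3 := by linarith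
  have hl : σ ^ 2 / 3 ≤ Real.log ((1 - σ ^ 3) / (1 - σ ^ 2)) := by
    refine le_trans ?_ (Real.one_sub_inv_le_log_of_pos (by positivity))
    rw [inv_div, le_sub_comm, div_le_iff₀ h4]
    nlinarith [pow_pos hσ0 2, pow_pos hσ0 3, mul_pos (pow_pos hσ0 2) (sub_pos.2 hσ1),
      mul_pos (pow_pos hσ0 3) (sub_pos.2 hσ1)]
  refine abs_le_of_sq_le_sq' ?_ (by positivity) |>.2
  rw [mul_pow (Real.sqrt _), Real.sq_sqrt (by positivity)]
  have ht := hμ.tail_nonneg hρ.1.le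
  calc _ = σ ^ (24 * m + 32) * weightTail μ (σ ^ 2) ^ 2 := by ring
    _ ≤ σ ^ (24 * m + 29) * weightTail μ (σ ^ 2) ^ 2 := by
        refine mul_le_mul_of_nonneg_right (pow_le_pow_of_le_one hσ0.le hσ1.le (by omega))
          (by positivity)
    _ = 3 * ((σ ^ 3) ^ (8 * (m + 1) + 1) * weightTail μ (σ ^ 2) ^ 2 * (σ ^ 2 / 3)) := by ring
    _ ≤ 3 * ((σ ^ 3) ^ (8 * (m + 1) + 1) * weightTail μ (σ ^ 2) ^ 2 *
        Real.log ((1 - σ ^ 3) / (1 - σ ^ 2))) := by gcongr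
    _ ≤ 3 * (C * weightMoment μ (8 * (m + 1) + 1) ^ 2) := by gcongr
    _ = _ := by ring

theorem moment_le_of_testing (hμ : IsRadialWeight μ)
    (h : ∀ n : ℕ, ∫⁻ ρ in Ioo (0 : ℝ) 1,
      ENNReal.ofReal (ρ ^ (2 * n + 3) * weightTail μ ρ ^ 2 / (1 - ρ)) ≤
        ENNReal.ofReal (C * weightMoment μ (2 * n + 3) ^ 2)) (hC : 0 < C) (m : ℕ) :
    weightMoment μ (7 * (m + 1) + 3) ≤
      7 * Real.sqrt (3 * C) * weightMoment μ (8 * (m + 1) + 1) := by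
  have hM := hμ.moment_pos (8 * (m + 1) + 1)
  have hs : 0 ≤ Real.sqrt (3 * C) := Real.sqrt_nonneg _
  rw [hμ.moment_succ (7 * (m + 1) + 2)]
  have h1 : ∫ u in Ioo (0 : ℝ) 1, u ^ (7 * (m + 1) + 2) * weightTail μ u ≤
      ∫ u in Ioo (0 : ℝ) 1, u ^ (m + 1) * (Real.sqrt (3 * C) * weightMoment μ (8 * (m + 1) + 1)) := by
    refine setIntegral_mono_on ((hμ.integrableOn_pow_mul_tail _).mono_set Ioo_subset_Icc_self)
      ((Continuous.integrableOn_Icc (by fun_prop)).mono_set Ioo_subset_Icc_self)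
      measurableSet_Ioo fun u hu => ?_
    rw [show 7 * (m + 1) + 2 = (m + 1) + (6 * (m + 1) + 2) by ring, pow_add, mul_assoc]
    exact mul_le_mul_of_nonneg_left (tail_mul_pow_le_of_testing hμ h hC m hu)
      (pow_nonneg hu.1.le _)
  have h2 : ∫ u in Ioo (0 : ℝ) 1, u ^ (m + 1) = 1 / ((m : ℝ) + 2) := by
    rw [← integral_Ioc_eq_integral_Ioo, ← intervalIntegral.integral_of_le zero_le_one, integral_pow]
    push_cast
    rw [one_pow, zero_pow (by omega), sub_zero, add_assoc]
    norm_num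
  rw [integral_mul_const, h2] at h1
  refine (mul_le_mul_of_nonneg_left h1 (by positivity)).trans ?_
  have hm : (0 : ℝ) ≤ m := Nat.cast_nonneg m
  have h3 : (((7 * (m + 1) + 2 : ℕ) : ℝ) + 1) * (1 / ((m : ℝ) + 2)) ≤ 7 := by
    push_cast
    rw [mul_one_div, div_le_iff₀ (by positivity)]
    linarith
  rw [← mul_assoc, mul_assoc 7]
  gcongr

theorem moment_le_add_tail (hμ : IsRadialWeight μ) {R : ℝ} (hR0 : 0 ≤ R) (hR1 : R < 1) (y k : ℕ) :
    weightMoment μ (y + k) ≤ R ^ k * weightMoment μ y + weightTail μ R := by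
  have hsub1 : Ico 0 R ⊆ Ico (0 : ℝ) 1 := Ico_subset_Ico_right hR1.le
  have hsub2 : Ico R 1 ⊆ Ico (0 : ℝ) 1 := Ico_subset_Ico_left hR0
  rw [weightMoment, ← Ico_union_Ico_eq_Ico hR0 hR1.le,
    setIntegral_union (Ico_disjoint_Ico_same) measurableSet_Ico
      ((hμ.integrableOn_pow_mul _).mono_set hsub1) ((hμ.integrableOn_pow_mul _).mono_set hsub2)]
  refine add_le_add ?_ ?_
  · calc ∫ s in Ico 0 R, s ^ (y + k) * μ s ≤ ∫ s in Ico 0 R, R ^ k * (s ^ y * μ s) := by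
          refine setIntegral_mono_on ((hμ.integrableOn_pow_mul _).mono_set hsub1)
            (((hμ.integrableOn_pow_mul _).mono_set hsub1).const_mul _) measurableSet_Ico
            fun s hs => ?_
          have h1 := hμ.nonneg s (hsub1 hs)
          have h2 := hs.1
          have h3 := hs.2.le
          calc s ^ (y + k) * μ s = s ^ k * (s ^ y * μ s) := by ring
            _ ≤ _ := by gcongr
      _ = R ^ k * ∫ s in Ico 0 R, s ^ y * μ s := integral_const_mul _ _
      _ ≤ _ := by
          refine mul_le_mul_of_nonneg_left ?_ (pow_nonneg hR0 k)
          refine setIntegral_mono_set (hμ.integrableOn_pow_mul y) ?_ hsub1.eventuallyLE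
          filter_upwards [ae_restrict_mem measurableSet_Ico] with x hx
          exact mul_nonneg (pow_nonneg hx.1 _) (hμ.nonneg x hx)
  · refine setIntegral_mono_on ((hμ.integrableOn_pow_mul _).mono_set hsub2)
      (hμ.integrableOn_Ico hR0) measurableSet_Ico fun s hs => ?_
    exact mul_le_of_le_one_left (hμ.nonneg s (hsub2 hs)) (pow_le_one₀ (hsub2 hs).1 hs.2.le)

/-- The moment whose order is comparable to `1 / (1 - r)` is controlled by the tail. -/
theorem exists_moment_index_of_testing (hμ : IsRadialWeight μ)
    (h : ∀ n : ℕ, ∫⁻ ρ in Ioo (0 : ℝ) 1,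
      ENNReal.ofReal (ρ ^ (2 * n + 3) * weightTail μ ρ ^ 2 / (1 - ρ)) ≤
        ENNReal.ofReal (C * weightMoment μ (2 * n + 3) ^ 2)) (hC : 0 < C) :
    ∃ c : ℝ, 0 < c ∧ ∀ r ∈ Ico (1 / 2 : ℝ) 1, ∃ n : ℕ, c ≤ r ^ (2 * n + 3) ∧
      weightMoment μ (2 * n + 3) ≤ 2 * weightTail μ ((1 + r) / 2) := by
  set A : ℝ := 28 * Real.sqrt (3 * C) with hA
  have hA0 : 0 ≤ A := by positivity
  refine ⟨Real.exp (-(2 * (8 * A + 25))), Real.exp_pos _, fun r hr => ?_⟩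
  have hr0 : 0 < r := by linarith [hr.1]
  have ht : 0 < 1 - r := by linarith [hr.2]
  set k := ⌈A / (1 - r)⌉₊ with hk
  have hk1 : A / (1 - r) ≤ k := Nat.le_ceil _
  have hk2 : (k : ℝ) < A / (1 - r) + 1 := Nat.ceil_lt_add_one (by positivity)
  refine ⟨4 * k + 7, ?_, ?_⟩
  · have hlog : -(2 * (1 - r)) ≤ Real.log r := by
      refine le_trans ?_ (Real.one_sub_inv_le_log_of_pos hr0)
      rw [le_sub_comm, inv_le_iff_one_le_mul₀ hr0]
      nlinarith [hr.1]
    rw [← Real.exp_log (pow_pos hr0 _), Real.log_pow]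
    refine Real.exp_le_exp.2 ?_
    have h1 : (k : ℝ) * (1 - r) ≤ A + (1 - r) := by
      have := mul_le_mul_of_nonneg_right hk2.le ht.le
      rwa [add_mul, one_mul, div_mul_cancel₀ _ ht.ne'] at this
    push_cast
    have h2 : 0 ≤ 2 * (4 * (k : ℝ) + 7) + 3 := by positivity
    have h3 := mul_le_mul_of_nonneg_left hlog h2
    nlinarith [hr.1]
  · have hR0 : 0 ≤ (1 + r) / 2 := by linarith
    have hR1 : (1 + r) / 2 < 1 := by linarith
    have h1 := moment_le_add_tail hμ hR0 hR1 (7 * (k + 1 + 1) + 3) k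
    have h2 := moment_le_of_testing hμ h hC (k + 1)
    have h3 := one_sub_mul_pow_le (s := (1 + r) / 2) ⟨hR0, hR1⟩ k
    rw [show 7 * (k + 1 + 1) + 3 + k = 8 * (k + 1 + 1) + 1 by ring] at h1
    rw [show 2 * (4 * k + 7) + 3 = 8 * (k + 1 + 1) + 1 by ring]
    set M := weightMoment μ (8 * (k + 1 + 1) + 1) with hM
    have hM0 : 0 < M := hμ.moment_pos _
    have h4 : A ≤ k * (1 - r) := (div_le_iff₀ ht).1 hk1
    have h5 : ((1 + r) / 2) ^ k * (A / 2) ≤ 1 := by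
      rw [le_div_iff₀ (by positivity)] at h3
      have h6 : 0 ≤ ((1 + r) / 2) ^ k := by positivity
      nlinarith
    have h7 : ((1 + r) / 2) ^ k * weightMoment μ (7 * (k + 1 + 1) + 3) ≤ M / 2 := by
      calc _ ≤ ((1 + r) / 2) ^ k * (7 * Real.sqrt (3 * C) * M) := by gcongr
        _ = (((1 + r) / 2) ^ k * (A / 2)) * (M / 2) := by
            rw [hA]
            ring
        _ ≤ 1 * (M / 2) := by gcongr
        _ = _ := one_mul _
    linarith

theorem isUpperDoubling_of_testing (hμ : IsRadialWeight μ)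
    (h : ∀ n : ℕ, ∫⁻ ρ in Ioo (0 : ℝ) 1,
      ENNReal.ofReal (ρ ^ (2 * n + 3) * weightTail μ ρ ^ 2 / (1 - ρ)) ≤
        ENNReal.ofReal (C * weightMoment μ (2 * n + 3) ^ 2)) (hC : 0 < C) : IsUpperDoubling μ := by
  obtain ⟨c, hc, hn⟩ := exists_moment_index_of_testing hμ h hC
  have h34 := hμ.tail_pos' (r := 3 / 4) ⟨by norm_num, by norm_num⟩
  have h0 := hμ.tail_pos' (r := 0) ⟨by norm_num, by norm_num⟩
  refine ⟨2 / c + weightTail μ 0 / weightTail μ (3 / 4), by positivity, fun r hr => ?_⟩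
  have hR := hμ.tail_pos' (r := (1 + r) / 2) ⟨by linarith [hr.1], by linarith [hr.2]⟩
  rw [add_mul]
  rcases le_or_gt (1 / 2) r with h12 | h12
  · obtain ⟨n, h1, h2⟩ := hn r ⟨h12, hr.2⟩
    have h3 := hμ.pow_mul_tail_le_moment hr.1 (2 * n + 3)
    have h4 := hμ.tail_nonneg hr.1
    have h5 : c * weightTail μ r ≤ 2 * weightTail μ ((1 + r) / 2) :=
      (mul_le_mul_of_nonneg_right h1 h4).trans (h3.trans h2)
    have h6 : weightTail μ r ≤ 2 / c * weightTail μ ((1 + r) / 2) := by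
      rw [div_mul_eq_mul_div, le_div_iff₀ hc]
      linarith
    have : 0 ≤ weightTail μ 0 / weightTail μ (3 / 4) * weightTail μ ((1 + r) / 2) := by positivity
    linarith
  · have h1 := hμ.tail_anti le_rfl hr.1
    have h2 := hμ.tail_anti (r := (1 + r) / 2) (s := 3 / 4) (by linarith [hr.1]) (by linarith)
    have h3 : weightTail μ 0 ≤ weightTail μ 0 / weightTail μ (3 / 4) * weightTail μ ((1 + r) / 2) := by
      rw [div_mul_eq_mul_div, le_div_iff₀ h34]
      gcongr
    have : 0 ≤ 2 / c * weightTail μ ((1 + r) / 2) := by positivity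
    linarith

theorem isLowerDoubling_of_testing (hμ : IsRadialWeight μ)
    (h : ∀ n : ℕ, ∫⁻ ρ in Ioo (0 : ℝ) 1,
      ENNReal.ofReal (ρ ^ (2 * n + 3) * weightTail μ ρ ^ 2 / (1 - ρ)) ≤
        ENNReal.ofReal (C * weightMoment μ (2 * n + 3) ^ 2)) (hC : 0 < C) : IsLowerDoubling μ := by
  obtain ⟨c, hc, hn⟩ := exists_moment_index_of_testing hμ h hC
  set K := Real.exp (16 * C / c) with hK
  have hK1 : 1 < K := Real.one_lt_exp_iff.2 (by positivity)
  have hK0 : 0 < K := by linarith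
  have key : ∀ R ∈ Ico (3 / 4 : ℝ) 1, 2 * weightTail μ (1 - (1 - R) / K) ≤ weightTail μ R := by
    intro R hR
    have hR1 : 0 < 1 - R := by linarith [hR.2]
    obtain ⟨n, h1, h2⟩ := hn (2 * R - 1) ⟨by linarith [hR.1], by linarith [hR.2]⟩
    rw [show (1 + (2 * R - 1)) / 2 = R by ring] at h2
    have h3 : (1 - R) / K ≤ 1 - R := div_le_self hR1.le hK1.le
    have h4 : 0 < (1 - R) / K := by positivity
    have h5 := pow_mul_tail_sq_mul_log_le hμ h hC n (a := R) (b := 1 - (1 - R) / K)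
      (by linarith [hR.1]) (by linarith) (by linarith)
    rw [sub_sub_cancel, div_div_cancel₀ hR1.ne', hK, Real.log_exp, ← hK] at h5
    have hM := hμ.moment_pos (2 * n + 3)
    have hT := hμ.tail_nonneg (r := R) (by linarith [hR.1])
    have hT' := hμ.tail_nonneg (r := 1 - (1 - R) / K) (by linarith [hR.1])
    have h6 : c ≤ R ^ (2 * n + 3) := h1.trans (pow_le_pow_left₀ (by linarith [hR.1])
      (by linarith [hR.2]) _)
    have h7 : c * weightTail μ (1 - (1 - R) / K) ^ 2 * (16 * C / c) ≤
        C * (2 * weightTail μ R) ^ 2 :=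
      calc _ ≤ R ^ (2 * n + 3) * weightTail μ (1 - (1 - R) / K) ^ 2 * (16 * C / c) := by gcongr
        _ ≤ _ := h5
        _ ≤ _ := by gcongr
    have h8 : (2 * weightTail μ (1 - (1 - R) / K)) ^ 2 ≤ weightTail μ R ^ 2 := by
      have e : c * weightTail μ (1 - (1 - R) / K) ^ 2 * (16 * C / c) =
          (4 * C) * (2 * weightTail μ (1 - (1 - R) / K)) ^ 2 := by
        field_simp
        ring
      rw [e, show C * (2 * weightTail μ R) ^ 2 = (4 * C) * weightTail μ R ^ 2 by ring] at h7
      exact le_of_mul_le_mul_left h7 (by positivity)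
    exact (abs_le_of_sq_le_sq' h8 hT).2
  refine ⟨4 * K, 2, by linarith, by norm_num, fun r hr => ?_⟩
  rcases le_or_gt (3 / 4) r with h34 | h34
  · refine le_trans ?_ (key r ⟨h34, hr.2⟩)
    have hr1 : 0 < 1 - r := by linarith [hr.2]
    have h3 : (1 - r) / K ≤ 1 - r := div_le_self hr1.le hK1.le
    have h4 : (1 - r) / (4 * K) ≤ (1 - r) / K := by
      gcongr
      linarith
    have := hμ.tail_anti (r := 1 - (1 - r) / K) (s := 1 - (1 - r) / (4 * K)) (by linarith [hr.1])
      (by linarith)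
    linarith
  · have h1 := key (3 / 4) ⟨le_rfl, by norm_num⟩
    have h2 := hμ.tail_anti hr.1 h34.le
    have h3 : (1 - 3 / 4) / K ≤ 1 - 3 / 4 := div_le_self (by norm_num) hK1.le
    have h4 : (1 - r) / (4 * K) ≤ (1 - 3 / 4) / K := by
      rw [div_le_div_iff₀ (by positivity) hK0]
      nlinarith [hr.1]
    have := hμ.tail_anti (r := 1 - (1 - 3 / 4) / K) (s := 1 - (1 - r) / (4 * K)) (by linarith)
      (by linarith)
    linarith

end

theorem isRadialDoubling_of_dominatedOn {μ : ℝ → ℝ} (hμ : IsRadialWeight μ)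
    (h : DominatedOn VMOA (bmoaWeightNorm μ) bmoaNorm) : IsRadialDoubling μ := by
  obtain ⟨C, hC, hn⟩ := exists_lintegral_tail_sq_le hμ h
  exact ⟨isUpperDoubling_of_testing hμ hn hC, isLowerDoubling_of_testing hμ hn hC⟩

theorem DominatedOn.mono {X Y : Set (ℂ → ℂ)} {A B : (ℂ → ℂ) → ℝ≥0∞} (h : DominatedOn Y A B)
    (hXY : X ⊆ Y) : DominatedOn X A B := by
  obtain ⟨C, hC, hd⟩ := h
  exact ⟨C, hC, fun g hg => hd g (hXY hg)⟩

theorem theorem4 (μ : ℝ → ℝ) (hμ : IsRadialWeight μ) :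
    List.TFAE
      [ IsRadialDoubling μ,
        ComparableOn {g | IsAnalyticOnDisc g} (bmoaWeightNorm μ) bmoaNorm,
        DominatedOn {g | IsAnalyticOnDisc g} (bmoaWeightNorm μ) bmoaNorm,
        weightVMOA μ = VMOA ∧ ComparableOn VMOA (bmoaWeightNorm μ) bmoaNorm,
        VMOA ⊆ weightVMOA μ ∧ DominatedOn VMOA (bmoaWeightNorm μ) bmoaNorm,
        weightVMOA μ ⊆ VMOA ∧ DominatedOn VMOA (bmoaWeightNorm μ) bmoaNorm ] ∧
    DominatedOn {g | IsAnalyticOnDisc g} bmoaNorm (bmoaWeightNorm μ) ∧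
    weightVMOA μ ⊆ VMOA := by
  have hsub : VMOA ⊆ {g | IsAnalyticOnDisc g} := fun g hg => hg.1
  have hdom := bmoaNorm_dominatedOn hμ
  have hV := weightVMOA_subset_VMOA hμ
  refine ⟨?_, hdom, hV⟩
  tfae_have 1 → 2 := fun h => ⟨bmoaWeightNorm_dominatedOn hμ h, hdom⟩
  tfae_have 2 → 3 := fun h => h.1
  tfae_have 3 → 1 := fun h => isRadialDoubling_of_dominatedOn hμ (h.mono hsub)
  tfae_have 1 → 4 := fun h => ⟨hV.antisymm (VMOA_subset_weightVMOA hμ h),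
    (bmoaWeightNorm_dominatedOn hμ h).mono hsub, hdom.mono hsub⟩
  tfae_have 4 → 5 := fun h => ⟨h.1.ge, h.2.1⟩
  tfae_have 4 → 6 := fun h => ⟨h.1.le, h.2.1⟩
  tfae_have 5 → 1 := fun h => isRadialDoubling_of_dominatedOn hμ h.2
  tfae_have 6 → 1 := fun h => isRadialDoubling_of_dominatedOn hμ h.2
  tfae_finish
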